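/- All graphs are finite and undirected, and loops are allowed. For graphs $G$, $H$ let $G\,\square\,H$ be the Cartesian product and $G\times H$ the tensor product, both with vertex set $V(G)\times V(H)$, where nested tuples are flattened to finite sequences (so that, e.g., $((a,b),c)=(a,(b,c))=(a,b,c)$): there is an edge between $(v_1,u_1)$ and $(v_2,u_2)$ in $G\,\square\,H$ iff $v_1=v_2$ and $(u_1,u_2)\in E(H)$, or $u_1=u_2$ and $(v_1,v_2)\in E(G)$; and in $G\times H$ iff $(v_1,v_2)\in E(G)$ and $(u_1,u_2)\in E(H)$. Let $G\cup H$ be the graph with vertex set $V(G)\cup V(H)$ and edge set $E(G)\cup E(H)$. A factored graph $G=f(G_1,\dots,G_m)$ is a formula $f$ built from input graphs $G_1,\dots,G_m$ with the operations $\square,\times,\cup$; it is of complexity $(n,k)$ if $f$ has $k-1$ operations and every input graph has at most $n$ vertices ($n\ge 1$). It is given to an algorithm as the formula whose leaves carry the input graphs, each as a list of its vertices (natural numbers) and its adjacency matrix. Algorithms are programs of a unit-cost random access machine with addition, truncated subtraction and indirect addressing (no multiplication). For a graph $H$ on vertices $b_1,\dots,b_s$, an exact copy of $H$ in $G$ is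 an ordered tuple $(a_1,\dots,a_s)$ of distinct vertices of $G$ such that for all $i,j\in\{1,\dots,s\}$, $a_i,a_j$ are adjacent in $G$ if and only if $b_i,b_j$ are adjacent in $H$. Let $\#H(G)$ be the number of exact copies of $H$ in $G$. Theorem. Let $H$ be a clique (a complete graph without loops) on $s$ vertices. Then computing $\#H(G)$ on factored graphs is fixed parameter tractable: there are an algorithm, a function $g_0$ and a constant $C$ independent of $k$ such that the algorithm computes $\#H(G)$ on every factored graph $G$ of complexity $(n,k)$ in time at most $g_0(k)\,n^{C}$. In particular, there is a function $g(s,k)$ such that for every $s$ there is an algorithm that computes $\#H(G)$ on every factored graph $G=f(G_1,\dots,G_m)$ of complexity $(n,k)$ in time at most $g(s,k)\,n^{s}$. -/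

import Mathlib

/-! ### Graphs and the three graph operations -/

/-- An undirected graph whose vertices form a set of elements of `V`
(so that graphs on overlapping vertex sets can be united). Loops are allowed. -/
@[ext]
structure UGraph (V : Type) where
  /-- the vertex set -/
  verts : Set V
  /-- the edge relation -/
  Adj : V → V → Prop
  symm : ∀ x y, Adj x y → Adj y x
  mem_of_adj : ∀ x y, Adj x y → x ∈ verts

namespace UGraph

/-- The union of two graphs: union of the vertex sets and of the edge sets. -/
def union {V : Type} (G H : UGraph V) : UGraph V where
  verts := G.verts ∪ H.verts
  Adj x y := G.Adj x y ∨ H.Adj x y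
  symm x y h := h.imp (G.symm x y) (H.symm x y)
  mem_of_adj x y h := h.imp (G.mem_of_adj x y) (H.mem_of_adj x y)

/-- The Cartesian product. Vertices are finite sequences, and the pair `(v, u)` is identified with
the concatenated sequence `v ++ u`. -/
def cartesian {L : Type} (G H : UGraph (List L)) : UGraph (List L) where
  verts := {x | ∃ v ∈ G.verts, ∃ u ∈ H.verts, x = v ++ u}
  Adj x y := ∃ v₁ ∈ G.verts, ∃ u₁ ∈ H.verts, ∃ v₂ ∈ G.verts, ∃ u₂ ∈ H.verts,
    x = v₁ ++ u₁ ∧ y = v₂ ++ u₂ ∧ ((v₁ = v₂ ∧ H.Adj u₁ u₂) ∨ (u₁ = u₂ ∧ G.Adj v₁ v₂))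
  symm := by
    rintro x y ⟨v₁, hv₁, u₁, hu₁, v₂, hv₂, u₂, hu₂, hx, hy, h⟩
    refine ⟨v₂, hv₂, u₂, hu₂, v₁, hv₁, u₁, hu₁, hy, hx, ?_⟩
    exact h.imp (fun h => ⟨h.1.symm, H.symm _ _ h.2⟩) (fun h => ⟨h.1.symm, G.symm _ _ h.2⟩)
  mem_of_adj := by
    rintro x y ⟨v₁, hv₁, u₁, hu₁, -, -, -, -, hx, -⟩
    exact ⟨v₁, hv₁, u₁, hu₁, hx⟩

/-- The tensor product, with the same identification of pairs with concatenated sequences. -/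
def tensor {L : Type} (G H : UGraph (List L)) : UGraph (List L) where
  verts := {x | ∃ v ∈ G.verts, ∃ u ∈ H.verts, x = v ++ u}
  Adj x y := ∃ v₁ ∈ G.verts, ∃ u₁ ∈ H.verts, ∃ v₂ ∈ G.verts, ∃ u₂ ∈ H.verts,
    x = v₁ ++ u₁ ∧ y = v₂ ++ u₂ ∧ G.Adj v₁ v₂ ∧ H.Adj u₁ u₂
  symm := by
    rintro x y ⟨v₁, hv₁, u₁, hu₁, v₂, hv₂, u₂, hu₂, hx, hy, h, h'⟩
    exact ⟨v₂, hv₂, u₂, hu₂, v₁, hv₁, u₁, hu₁, hy, hx, G.symm _ _ h, H.symm _ _ h'⟩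
  mem_of_adj := by
    rintro x y ⟨v₁, hv₁, u₁, hu₁, -, -, -, -, hx, -⟩
    exact ⟨v₁, hv₁, u₁, hu₁, hx⟩

/-- The exact copies of `H` in `G`: the ordered `s`-tuples of distinct vertices of `G` such that
the `i`-th and `j`-th are adjacent in `G` if and only if `i` and `j` are adjacent in `H`. -/
def exactCopies {V : Type} {s : ℕ} (H : SimpleGraph (Fin s)) (G : UGraph V) : Set (Fin s → V) :=
  {a | Function.Injective a ∧ (∀ i, a i ∈ G.verts) ∧ ∀ i j, G.Adj (a i) (a j) ↔ H.Adj i j}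

end UGraph

/-! ### Factored graphs -/

/-- An explicitly given finite undirected graph: the list of its (distinct) vertices, which are
natural numbers, and its symmetric adjacency matrix. -/
structure InputGraph where
  /-- the number of vertices -/
  size : ℕ
  /-- the vertices, in the order in which they are listed -/
  label : Fin size → ℕ
  label_injective : Function.Injective label
  /-- the adjacency matrix -/
  adj : Fin size → Fin size → Bool
  adj_symm : ∀ i j, adj i j = adj j i

namespace InputGraph

/-- The graph given by `G`; a vertex `x` is regarded as the sequence `[x]` of length one. -/
def toUGraph (G : InputGraph) : UGraph (List ℕ) where
  verts := {x | ∃ i, x = [G.label i]}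
  Adj x y := ∃ i j, x = [G.label i] ∧ y = [G.label j] ∧ G.adj i j = true
  symm := by
    rintro x y ⟨i, j, hx, hy, h⟩
    exact ⟨j, i, hy, hx, by rw [G.adj_symm, h]⟩
  mem_of_adj := by
    rintro x y ⟨i, j, hx, -, -⟩
    exact ⟨i, hx⟩

/-- The number of vertices, the vertices, and the adjacency matrix row by row. -/
def encode (G : InputGraph) : List ℕ :=
  G.size :: (List.ofFn G.label ++
    (List.ofFn fun i => List.ofFn fun j => if G.adj i j then 1 else 0).flatten)

end InputGraph

/-- Factored graph formulas: expressions built from input graphs by the three operations.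
An input graph that is used several times labels several leaves. -/
inductive FactoredGraph where
  | leaf (G : InputGraph)
  | cartesian (A B : FactoredGraph)
  | tensor (A B : FactoredGraph)
  | union (A B : FactoredGraph)

namespace FactoredGraph

/-- The graph that a formula describes. -/
def toUGraph : FactoredGraph → UGraph (List ℕ)
  | leaf G => G.toUGraph
  | cartesian A B => A.toUGraph.cartesian B.toUGraph
  | tensor A B => A.toUGraph.tensor B.toUGraph
  | union A B => A.toUGraph.union B.toUGraph

/-- The number of operations in a formula. -/
def numOps : FactoredGraph → ℕ
  | leaf _ => 0
  | cartesian A B => A.numOps + B.numOps + 1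
  | tensor A B => A.numOps + B.numOps + 1
  | union A B => A.numOps + B.numOps + 1

/-- All input graphs have at most `n` vertices. -/
def SizeLE (n : ℕ) : FactoredGraph → Prop
  | leaf G => G.size ≤ n
  | cartesian A B => A.SizeLE n ∧ B.SizeLE n
  | tensor A B => A.SizeLE n ∧ B.SizeLE n
  | union A B => A.SizeLE n ∧ B.SizeLE n

/-- The formula is of complexity `(n, k)`: it has `k - 1` operations, on input graphs with at most
`n` vertices. -/
def HasComplexity (F : FactoredGraph) (n k : ℕ) : Prop :=
  F.numOps + 1 = k ∧ F.SizeLE n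

/-- The formula in prefix notation, as a list of natural numbers. -/
def encode : FactoredGraph → List ℕ
  | leaf G => 0 :: G.encode
  | cartesian A B => 1 :: (A.encode ++ B.encode)
  | tensor A B => 2 :: (A.encode ++ B.encode)
  | union A B => 3 :: (A.encode ++ B.encode)

/-- A factored graph has finitely many vertices. -/
theorem finite_verts (F : FactoredGraph) : F.toUGraph.verts.Finite := by
  have key : ∀ S T : Set (List ℕ), S.Finite → T.Finite →
      {x | ∃ v ∈ S, ∃ u ∈ T, x = v ++ u}.Finite := by
    intro S T hS hT
    refine (hS.image2 (fun v u => v ++ u) hT).subset ?_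
    rintro x ⟨v, hv, u, hu, rfl⟩
    exact ⟨v, hv, u, hu, rfl⟩
  induction F with
  | leaf G =>
    refine (Set.finite_range fun i => [G.label i]).subset ?_
    rintro x ⟨i, rfl⟩
    exact ⟨i, rfl⟩
  | cartesian A B hA hB => exact key _ _ hA hB
  | tensor A B hA hB => exact key _ _ hA hB
  | union A B hA hB => exact hA.union hB

/-- The number of exact copies of `H` in a factored graph (a finite number). -/
noncomputable def countCopies {s : ℕ} (H : SimpleGraph (Fin s)) (F : FactoredGraph) : ℕ :=
  (F.toUGraph.exactCopies H).ncard

theorem finite_exactCopies {s : ℕ} (H : SimpleGraph (Fin s)) (F : FactoredGraph) :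
    (F.toUGraph.exactCopies H).Finite := by
  refine (Set.Finite.pi' fun _ : Fin s => F.finite_verts).subset ?_
  intro a ha
  exact ha.2.1

end FactoredGraph

/-! ### Random access machines

Structured programs with natural-number registers and zero-initialised arrays (a memory with
indirect addressing). Each assignment, memory access and test costs one step. The arithmetic
operations are addition and truncated subtraction; there is no multiplication. -/

/-- RAM programs. Registers and arrays are named by natural numbers, so that a program mentions
only finitely many of them. -/
inductive Prog where
  /-- do nothing -/
  | skip
  /-- `x := c` -/
  | const (x c : ℕ)
  /-- `x := y + z` -/
  | plus (x y z : ℕ)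
  /-- `x := y - z`, or `0` if `y < z` -/
  | minus (x y z : ℕ)
  /-- `x := a[y]` -/
  | load (x a y : ℕ)
  /-- `a[y] := x` -/
  | store (a y x : ℕ)
  /-- first `p`, then `q` -/
  | seq (p q : Prog)
  /-- if `x ≠ 0` then `p` else `q` -/
  | branch (x : ℕ) (p q : Prog)
  /-- while `x ≠ 0` do `p` -/
  | loop (x : ℕ) (p : Prog)

/-- The contents of the registers and of the arrays. -/
structure RamState where
  reg : ℕ → ℕ
  arr : ℕ → ℕ → ℕ

namespace RamState

/-- Assign `v` to the register `x`. -/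
def setReg (σ : RamState) (x v : ℕ) : RamState :=
  ⟨Function.update σ.reg x v, σ.arr⟩

/-- Assign `v` to the entry `i` of the array `a`. -/
def setArr (σ : RamState) (a i v : ℕ) : RamState :=
  ⟨σ.reg, Function.update σ.arr a (Function.update (σ.arr a) i v)⟩

/-- The initial state on an input: array `0` holds the input, everything else is `0`. -/
def start (w : List ℕ) : RamState :=
  ⟨fun _ => 0, fun a i => if a = 0 then w.getD i 0 else 0⟩

end RamState

/-- `Exec p σ t τ`: the program `p`, started in the state `σ`, halts after exactly `t` steps in the
state `τ`. -/
inductive Exec : Prog → RamState → ℕ → RamState → Prop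
  | skip (σ : RamState) : Exec .skip σ 1 σ
  | const (σ : RamState) (x c : ℕ) : Exec (.const x c) σ 1 (σ.setReg x c)
  | plus (σ : RamState) (x y z : ℕ) :
      Exec (.plus x y z) σ 1 (σ.setReg x (σ.reg y + σ.reg z))
  | minus (σ : RamState) (x y z : ℕ) :
      Exec (.minus x y z) σ 1 (σ.setReg x (σ.reg y - σ.reg z))
  | load (σ : RamState) (x a y : ℕ) :
      Exec (.load x a y) σ 1 (σ.setReg x (σ.arr a (σ.reg y)))
  | store (σ : RamState) (a y x : ℕ) :
      Exec (.store a y x) σ 1 (σ.setArr a (σ.reg y) (σ.reg x))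
  | seq {p q : Prog} {σ ρ τ : RamState} {t u : ℕ} :
      Exec p σ t ρ → Exec q ρ u τ → Exec (.seq p q) σ (t + u) τ
  | branch_true {x : ℕ} {p q : Prog} {σ τ : RamState} {t : ℕ} :
      σ.reg x ≠ 0 → Exec p σ t τ → Exec (.branch x p q) σ (t + 1) τ
  | branch_false {x : ℕ} {p q : Prog} {σ τ : RamState} {t : ℕ} :
      σ.reg x = 0 → Exec q σ t τ → Exec (.branch x p q) σ (t + 1) τ
  | loop_done {x : ℕ} {p : Prog} {σ : RamState} :
      σ.reg x = 0 → Exec (.loop x p) σ 1 σ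
  | loop_step {x : ℕ} {p : Prog} {σ ρ τ : RamState} {t u : ℕ} :
      σ.reg x ≠ 0 → Exec p σ t ρ → Exec (.loop x p) ρ u τ → Exec (.loop x p) σ (t + u + 1) τ

/-! ### Problems on factored graphs and fixed parameter tractability -/

/-- On every factored graph of complexity `(n, k)`, where `n ≥ 1`, the program halts after at most
`T n k` steps with the value of `problem` in register `0`. -/
def SolvesInTime (p : Prog) (problem : FactoredGraph → ℕ) (T : ℕ → ℕ → ℕ) : Prop :=
  ∀ (F : FactoredGraph) (n k : ℕ), 1 ≤ n → F.HasComplexity n k →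
    ∃ (t : ℕ) (τ : RamState), Exec p (RamState.start F.encode) t τ ∧ t ≤ T n k ∧
      τ.reg 0 = problem F

/-- Fixed parameter tractability on factored graphs: solvable in time `g(k) * n ^ C` for some
function `g` and some constant `C`, by one program for all `n` and `k`. -/
def FixedParameterTractable (problem : FactoredGraph → ℕ) : Prop :=
  ∃ (p : Prog) (g : ℕ → ℕ) (C : ℕ), SolvesInTime p problem fun n k => g k * n ^ C

/-! Let `s ≥ 1`. The vertices of a copy of the clique are pairwise adjacent, and adjacent vertices
of a factored graph are sequences of the same length. A copy is therefore a matrix of labels with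
`s` rows and at most `m` columns, where `m = 2 * k - 1` is the number of symbols of the formula in
prefix notation.

Whether two rows are the same vertex, or are adjacent, is decided by scanning the formula along the
columns. Each symbol pops a mode (equality, edge, skip) from a stack. An operation pushes modes for
its two parts, depending on a binary choice: which factor of a Cartesian product carries the edge,
or which side of a union is used. An input graph that is not skipped consumes one column. Some
sequence of choices accepts iff the relation holds (`accepts_tokens`). The scan examines labels only
by asking whether two of them are equal vertices of, or adjacent in, an input graph. All such
answers for the entries of one column form its signature. Columns of equal signature are
interchangeable (`sigOf_inj`, `scanAccepts_congr`), and the signatures lie below `sigBound m s`,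
which does not depend on `n`.

Hence the number of copies is a sum over the sequences of at most `m` signatures whose
representatives pass the clique test, and each sequence contributes the product of the numbers of
columns with these signatures (`countCopies_top_eq`). There are at most `m * n` labels, so counting
the columns by signature takes `n ^ s` times a function of `m` and `s`. In the summation `n` enters
only through the multiplication by column counts, done by at most `(m * n) ^ s` repeated additions.
The exponent `s` does not depend on `k`, so both assertions follow.

The programs are verified with a timed Hoare logic (`WP`). In the main phase registers `1` to `4`
hold `m`, the number of labels, `s` and a base `Q` above all signatures that occur. Arrays `0` to
`9` hold the input, the symbol codes, the positions of the input graphs, the lookup table (`3` and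
`4`), the marks and the list of labels, the current column, and the counts and representatives of
the signatures. -/

/-! ### A calculus of timed total correctness for RAM programs -/

namespace RamState

@[simp] theorem reg_setReg (σ : RamState) (x v y : ℕ) :
    (σ.setReg x v).reg y = if y = x then v else σ.reg y := by
  simp [setReg, Function.update_apply]

@[simp] theorem arr_setReg (σ : RamState) (x v : ℕ) : (σ.setReg x v).arr = σ.arr := rfl

@[simp] theorem reg_setArr (σ : RamState) (a i v : ℕ) : (σ.setArr a i v).reg = σ.reg := rfl

@[simp] theorem arr_setArr (σ : RamState) (a i v b : ℕ) :
    (σ.setArr a i v).arr b = if b = a then Function.update (σ.arr a) i v else σ.arr b := by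
  simp only [setArr, Function.update_apply]

end RamState

namespace Prog

/-- `p` contains an assignment to the register `x`. -/
def wr : Prog → ℕ → Prop
  | skip, _ => False
  | const y _, x => x = y
  | plus y _ _, x => x = y
  | minus y _ _, x => x = y
  | load y _ _, x => x = y
  | store _ _ _, _ => False
  | seq p q, x => p.wr x ∨ q.wr x
  | branch _ p q, x => p.wr x ∨ q.wr x
  | loop _ p, x => p.wr x

/-- `p` contains an assignment to an entry of the array `a`. -/
def wa : Prog → ℕ → Prop
  | store b _ _, a => a = b
  | seq p q, a => p.wa a ∨ q.wa a
  | branch _ p q, a => p.wa a ∨ q.wa a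
  | loop _ p, a => p.wa a
  | _, _ => False

end Prog

/-- This keeps invariants short: whatever a program does not syntactically assign to is unchanged
and need not be mentioned. -/
theorem Exec.frame {p : Prog} {σ τ : RamState} {t : ℕ} (h : Exec p σ t τ) :
    (∀ x, ¬ p.wr x → τ.reg x = σ.reg x) ∧ ∀ a, ¬ p.wa a → τ.arr a = σ.arr a := by
  induction h with
  | skip | const | plus | minus | load => simp_all [Prog.wr]
  | store σ a y x =>
    refine ⟨fun _ _ => rfl, fun b hb => ?_⟩
    simp_all [Prog.wa]
  | seq _ _ h₁ h₂ =>
    simp only [Prog.wr, Prog.wa, not_or]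
    exact ⟨fun x hx => (h₂.1 x hx.2).trans (h₁.1 x hx.1),
      fun a ha => (h₂.2 a ha.2).trans (h₁.2 a ha.1)⟩
  | branch_true _ _ h =>
    simp only [Prog.wr, Prog.wa, not_or]
    exact ⟨fun x hx => h.1 x hx.1, fun a ha => h.2 a ha.1⟩
  | branch_false _ _ h =>
    simp only [Prog.wr, Prog.wa, not_or]
    exact ⟨fun x hx => h.1 x hx.2, fun a ha => h.2 a ha.2⟩
  | loop_done => simp
  | loop_step _ _ _ h₁ h₂ =>
    exact ⟨fun x hx => (h₂.1 x hx).trans (h₁.1 x hx), fun a ha => (h₂.2 a ha).trans (h₁.2 a ha)⟩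

/-- Started in `σ`, the program `p` halts within `T` steps in a state satisfying `Q`. -/
def WP (p : Prog) (T : ℕ) (Q : RamState → Prop) (σ : RamState) : Prop :=
  ∃ t τ, Exec p σ t τ ∧ t ≤ T ∧ Q τ

/-- `τ` agrees with `σ` on everything that `p` does not mention as a target. -/
def Frame (p : Prog) (σ τ : RamState) : Prop :=
  (∀ x, ¬ p.wr x → τ.reg x = σ.reg x) ∧ ∀ a, ¬ p.wa a → τ.arr a = σ.arr a

namespace WP

variable {p q : Prog} {T T₁ T₂ : ℕ} {Q R : RamState → Prop} {σ : RamState}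

theorem mono (h : WP p T₁ Q σ) (hT : T₁ ≤ T₂) (hQ : ∀ τ, Q τ → R τ) : WP p T₂ R σ := by
  obtain ⟨t, τ, he, ht, hq⟩ := h
  exact ⟨t, τ, he, ht.trans hT, hQ τ hq⟩

theorem post (h : WP p T Q σ) (hQ : ∀ τ, Q τ → R τ) : WP p T R σ := h.mono le_rfl hQ

theorem time (h : WP p T₁ Q σ) (hT : T₁ ≤ T₂) : WP p T₂ Q σ := h.mono hT fun _ => id

theorem frame (h : WP p T Q σ) : WP p T (fun τ => Q τ ∧ Frame p σ τ) σ := by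
  obtain ⟨t, τ, he, ht, hq⟩ := h
  exact ⟨t, τ, he, ht, hq, he.frame⟩

theorem skip (h : Q σ) : WP .skip 1 Q σ := ⟨1, σ, .skip σ, le_rfl, h⟩

theorem const {x c : ℕ} (h : Q (σ.setReg x c)) : WP (.const x c) 1 Q σ :=
  ⟨1, _, .const σ x c, le_rfl, h⟩

theorem plus {x y z : ℕ} (h : Q (σ.setReg x (σ.reg y + σ.reg z))) : WP (.plus x y z) 1 Q σ :=
  ⟨1, _, .plus σ x y z, le_rfl, h⟩

theorem minus {x y z : ℕ} (h : Q (σ.setReg x (σ.reg y - σ.reg z))) : WP (.minus x y z) 1 Q σ :=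
  ⟨1, _, .minus σ x y z, le_rfl, h⟩

theorem load {x a y : ℕ} (h : Q (σ.setReg x (σ.arr a (σ.reg y)))) : WP (.load x a y) 1 Q σ :=
  ⟨1, _, .load σ x a y, le_rfl, h⟩

theorem store {a y x : ℕ} (h : Q (σ.setArr a (σ.reg y) (σ.reg x))) : WP (.store a y x) 1 Q σ :=
  ⟨1, _, .store σ a y x, le_rfl, h⟩

theorem seq (h : WP p T₁ (fun ρ => WP q T₂ Q ρ) σ) : WP (.seq p q) (T₁ + T₂) Q σ := by
  obtain ⟨t, ρ, he, ht, u, τ, he', hu, hq⟩ := h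
  exact ⟨t + u, τ, .seq he he', by omega, hq⟩

theorem branch {x : ℕ} (h₁ : σ.reg x ≠ 0 → WP p T₁ Q σ) (h₂ : σ.reg x = 0 → WP q T₂ Q σ) :
    WP (.branch x p q) (T₁ + T₂ + 1) Q σ := by
  by_cases hx : σ.reg x = 0
  · obtain ⟨t, τ, he, ht, hq⟩ := h₂ hx
    exact ⟨t + 1, τ, .branch_false hx he, by omega, hq⟩
  · obtain ⟨t, τ, he, ht, hq⟩ := h₁ hx
    exact ⟨t + 1, τ, .branch_true hx he, by omega, hq⟩

theorem loop_done {x : ℕ} (hx : σ.reg x = 0) (h : Q σ) : WP (.loop x p) 1 Q σ :=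
  ⟨1, σ, .loop_done hx, le_rfl, h⟩

theorem loop_step {x : ℕ} (hx : σ.reg x ≠ 0)
    (h : WP p T₁ (fun ρ => WP (.loop x p) T₂ Q ρ) σ) : WP (.loop x p) (T₁ + T₂ + 1) Q σ := by
  obtain ⟨t, ρ, he, ht, u, τ, he', hu, hq⟩ := h
  exact ⟨t + u + 1, τ, .loop_step hx he he', by omega, hq⟩

end WP

namespace Prog

/-- `for i := 0, …, lim - 1 do body`, where the register `i + 1` is scratch space. -/
def forUp (i lim : ℕ) (body : Prog) : Prog :=
  .seq (.const i 0) (.seq (.minus (i + 1) lim i) (.loop (i + 1)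
    (.seq body (.seq (.const (i + 1) 1) (.seq (.plus i i (i + 1)) (.minus (i + 1) lim i))))))

@[simp] theorem wr_forUp (i lim : ℕ) (body : Prog) (x : ℕ) :
    (forUp i lim body).wr x ↔ x = i ∨ x = i + 1 ∨ body.wr x := by
  simp only [forUp, wr]; tauto

@[simp] theorem wa_forUp (i lim : ℕ) (body : Prog) (a : ℕ) :
    (forUp i lim body).wa a ↔ body.wa a := by
  simp [forUp, wa]

end Prog

/-- Same arrays, and same registers except `i` and `i + 1`. -/
def SameBut (i : ℕ) (σ τ : RamState) : Prop :=
  (∀ x, x ≠ i → x ≠ i + 1 → τ.reg x = σ.reg x) ∧ τ.arr = σ.arr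

/-- Induction on the number of rounds left, which is the content of register `i + 1`. The body may
spoil that register, since it is recomputed after each round; `hI` says that the invariant ignores
the registers of the loop itself. A round costs the body, three assignments and a test. The bound
`N` replaces `n` so that the time can be stated in terms of parameters. -/
theorem WP.forUp {i lim n N T : ℕ} {body : Prog} {σ : RamState} {Q : RamState → Prop}
    (I : ℕ → RamState → Prop) (hlim : σ.reg lim = n) (hn : n ≤ N)
    (hl : lim ≠ i ∧ lim ≠ i + 1) (hw : ¬ body.wr i ∧ ¬ body.wr lim)
    (hI : ∀ j τ τ', SameBut i τ τ' → I j τ → I j τ')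
    (h0 : I 0 σ)
    (hs : ∀ j, j < n → ∀ τ, Frame (.forUp i lim body) σ τ → τ.reg i = j → I j τ →
      WP body T (I (j + 1)) τ)
    (hQ : ∀ τ, Frame (.forUp i lim body) σ τ → I n τ → Q τ) :
    WP (.forUp i lim body) (N * (T + 4) + 3) Q σ := by
  have key : ∀ d j, j + d = n → ∀ τ, Frame (.forUp i lim body) σ τ → τ.reg i = j →
      τ.reg (i + 1) = d → I j τ →
      WP (.loop (i + 1)
        (.seq body (.seq (.const (i + 1) 1) (.seq (.plus i i (i + 1)) (.minus (i + 1) lim i)))))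
        (d * (T + 4) + 1) Q τ := by
    intro d
    induction d with
    | zero =>
      intro j hj τ hf hi hd hIj
      obtain rfl : j = n := by omega
      exact (WP.loop_done hd (hQ τ hf hIj)).time (by omega)
    | succ d ih =>
      intro j hj τ hf hi hd hIj
      refine (WP.loop_step (T₁ := T + (1 + (1 + 1))) (T₂ := d * (T + 4) + 1) (by omega) ?_).time
        (by ring_nf; omega)
      refine WP.seq ((hs j (by omega) τ hf hi hIj).frame.post ?_)
      rintro ρ ⟨hIρ, hfρ⟩
      refine WP.seq (WP.const (WP.seq (WP.plus (WP.minus ?_))))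
      have hi' : ρ.reg i = j := by rw [hfρ.1 _ hw.1, hi]
      have hlim' : ρ.reg lim = n := by
        rw [hfρ.1 _ hw.2, hf.1, hlim]
        simp [hl, hw]
      refine ih (j + 1) (by omega) _ ⟨?_, ?_⟩ ?_ ?_ (hI _ ρ _ ⟨?_, ?_⟩ hIρ)
      · intro x hx
        have hx' := hx
        simp only [Prog.wr_forUp, not_or] at hx
        simp [hx, hfρ.1 x hx.2.2, hf.1 x hx']
      · intro a ha
        have ha' := ha
        simp only [Prog.wa_forUp] at ha
        simp [hfρ.2 a ha, hf.2 a ha']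
      · simp [hi']
      · simp [hi', hl, hlim']; omega
      · intro x hx hx'
        simp [hx, hx']
      · simp
  refine (WP.seq (WP.const (WP.seq (WP.minus (key n 0 (by omega) _ ⟨?_, ?_⟩ ?_ ?_ ?_))))).time
    (T₁ := 1 + (1 + (n * (T + 4) + 1))) ?_
  · intro x hx
    simp only [Prog.wr_forUp, not_or] at hx
    simp [hx]
  · intro a ha
    simp
  · simp
  · simp [hl, hlim]
  · refine hI 0 σ _ ⟨?_, ?_⟩ h0
    · intro x hx hx'
      simp [hx, hx']
    · simp
  · have := Nat.mul_le_mul_right (T + 4) hn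
    omega

/-- Iterate `v ↦ f j v` for `j = 0, …, n - 1`. -/
def foldN (f : ℕ → ℕ → ℕ) : ℕ → ℕ → ℕ
  | 0, v => v
  | n + 1, v => f n (foldN f n v)

/-- A loop whose body replaces the value `v` of the register `x` by `f j v`, and changes no
array. -/
theorem WP.forUp_fold {i lim n N T x : ℕ} {body : Prog} {σ : RamState} {Q : RamState → Prop}
    (f : ℕ → ℕ → ℕ) (P : ℕ → Prop) (hlim : σ.reg lim = n) (hn : n ≤ N)
    (hl : lim ≠ i ∧ lim ≠ i + 1) (hw : ¬ body.wr i ∧ ¬ body.wr lim)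
    (hx : x ≠ i ∧ x ≠ i + 1) (h0 : P (σ.reg x)) (hP : ∀ j, j < n → ∀ v, P v → P (f j v))
    (hs : ∀ j, j < n → ∀ τ, Frame (.forUp i lim body) σ τ → τ.reg i = j → P (τ.reg x) →
      WP body T (fun τ' => τ'.reg x = f j (τ.reg x)) τ)
    (hQ : ∀ τ, Frame (.forUp i lim body) σ τ → τ.reg x = foldN f n (σ.reg x) →
      P (τ.reg x) → Q τ) :
    WP (.forUp i lim body) (N * (T + 4) + 3) Q σ := by
  refine WP.forUp (fun j τ => τ.reg x = foldN f j (σ.reg x) ∧ P (τ.reg x)) hlim hn hl hw ?_ ?_ ?_ ?_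
  · rintro j τ τ' ⟨h, -⟩ h'
    rw [h x hx.1 hx.2]; exact h'
  · exact ⟨rfl, h0⟩
  · rintro j hj τ hf hi ⟨h, hp⟩
    refine (hs j hj τ hf hi hp).post fun τ' h' => ?_
    rw [h']
    exact ⟨by rw [h]; rfl, hP j hj _ hp⟩
  · rintro τ hf ⟨h, hp⟩
    exact hQ τ hf h hp

theorem foldN_congr {f g : ℕ → ℕ → ℕ} {n : ℕ} (h : ∀ j, j < n → ∀ v, f j v = g j v) (v : ℕ) :
    foldN f n v = foldN g n v := by
  induction n with
  | zero => rfl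
  | succ n ih => simp only [foldN]; rw [ih fun j hj => h j (by omega), h n (by omega)]

theorem foldN_add (g : ℕ → ℕ) (n v : ℕ) :
    foldN (fun j a => a + g j) n v = v + ∑ j ∈ Finset.range n, g j := by
  induction n with
  | zero => simp [foldN]
  | succ n ih => simp only [foldN, ih, Finset.sum_range_succ]; ring

/-! ### Arithmetic subroutines -/

namespace Prog

/-- `d := a + lim * b`, using the registers `d`, `d + 1`, `d + 2`. -/
def mulAdd (d lim a b : ℕ) : Prog :=
  .seq (.const d 0) (.seq (.plus d d a) (forUp (d + 1) lim (.plus d d b)))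

@[simp] theorem wr_mulAdd (d lim a b x : ℕ) :
    (mulAdd d lim a b).wr x ↔ x = d ∨ x = d + 1 ∨ x = d + 2 := by
  simp [mulAdd, wr]; tauto

@[simp] theorem wa_mulAdd (d lim a b x : ℕ) : ¬ (mulAdd d lim a b).wa x := by
  simp [mulAdd, wa]

/-- `d := y / b` and `d + 1 := y % b`, using the registers `d`, …, `d + 4`. -/
def divMod (d y b : ℕ) : Prog :=
  .seq (.const d 0) (.seq (.const (d + 1) 0) (.seq (.plus (d + 1) (d + 1) y)
    (forUp (d + 2) y (.seq (.const (d + 4) 1) (.seq (.plus (d + 4) (d + 4) (d + 1))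
      (.seq (.minus (d + 4) (d + 4) b) (.branch (d + 4)
        (.seq (.minus (d + 1) (d + 1) b) (.seq (.const (d + 4) 1) (.plus d d (d + 4))))
        .skip)))))))

@[simp] theorem wr_divMod (d y b x : ℕ) :
    (divMod d y b).wr x ↔ d ≤ x ∧ x ≤ d + 4 := by
  simp [divMod, wr]; omega

@[simp] theorem wa_divMod (d y b x : ℕ) : ¬ (divMod d y b).wa x := by
  simp [divMod, wa]

end Prog

/-- Same arrays, and same registers below `d`. -/
def Agree (d : ℕ) (σ τ : RamState) : Prop :=
  (∀ x, x < d → τ.reg x = σ.reg x) ∧ τ.arr = σ.arr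

theorem Frame.agree {p : Prog} {d : ℕ} {σ τ : RamState} (h : Frame p σ τ)
    (hr : ∀ x, p.wr x → d ≤ x) (ha : ∀ a, ¬ p.wa a) : Agree d σ τ :=
  ⟨fun x hx => h.1 x fun hp => absurd (hr x hp) (by omega), funext fun a => h.2 a (ha a)⟩

/-- The time depends only on the factor in `lim`. The other factor may be arbitrarily large, for
instance a label. -/
theorem wp_mulAdd {d lim a b N : ℕ} {σ : RamState} (h : lim < d ∧ a < d ∧ b < d)
    (hN : σ.reg lim ≤ N) :
    WP (.mulAdd d lim a b) (N * 5 + 5)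
      (fun τ => τ.reg d = σ.reg a + σ.reg lim * σ.reg b ∧ Agree d σ τ) σ := by
  obtain ⟨h1, h2, h3⟩ := h
  refine (WP.frame (Q := fun τ => τ.reg d = σ.reg a + σ.reg lim * σ.reg b) ?_).post ?_
  · refine (WP.seq (WP.const (WP.seq (WP.plus ?_)))).time
      (T₁ := 1 + (1 + (N * (1 + 4) + 3))) (by omega)
    refine WP.forUp_fold (x := d) (fun j v => v + σ.reg b) (fun _ => True) (n := σ.reg lim) ?_ hN
      ⟨by omega, by omega⟩ ?_ ⟨by omega, by omega⟩ trivial (fun _ _ _ _ => trivial) ?_ ?_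
    · simp [show lim ≠ d by omega]
    · simp [Prog.wr]; omega
    · intro j hj τ hf hi _
      refine WP.plus ?_
      have := hf.1 b (by simp [Prog.wr]; omega)
      simp [this, show b ≠ d by omega]
    · intro τ hf hx _
      rw [hx, foldN_add]
      simp [show a ≠ d by omega]
  · rintro τ ⟨hq, hf⟩
    exact ⟨hq, hf.agree (by simp) (by simp)⟩

theorem wp_divMod {d y b N : ℕ} {σ : RamState} (h : y < d ∧ b < d) (hb : 1 ≤ σ.reg b)
    (hN : σ.reg y ≤ N) :
    WP (.divMod d y b) (N * 12 + 6)
      (fun τ => τ.reg d = σ.reg y / σ.reg b ∧ τ.reg (d + 1) = σ.reg y % σ.reg b ∧ Agree d σ τ)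
      σ := by
  obtain ⟨h1, h2⟩ := h
  refine (WP.frame (Q := fun τ => τ.reg d = σ.reg y / σ.reg b ∧
    τ.reg (d + 1) = σ.reg y % σ.reg b) ?_).post ?_
  · refine (WP.seq (WP.const (WP.seq (WP.const (WP.seq (WP.plus ?_)))))).time
      (T₁ := 1 + (1 + (1 + (N * (8 + 4) + 3)))) (by omega)
    -- As long as the remainder is too large, every round has subtracted the divisor, so the
    -- quotient equals the round number. After `σ.reg y` rounds that is impossible, since the
    -- divisor is positive. The test value `1 + r - b` is nonzero exactly if `b ≤ r`.
    refine WP.forUp (fun j τ => σ.reg y = τ.reg d * σ.reg b + τ.reg (d + 1) ∧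
      (τ.reg (d + 1) < σ.reg b ∨ τ.reg d = j)) (n := σ.reg y) ?_ hN
      ⟨by omega, by omega⟩ ?_ ?_ ?_ ?_ ?_
    · simp [show y ≠ d by omega, show y ≠ d + 1 by omega]
    · simp [Prog.wr]; omega
    · rintro j τ τ' ⟨h, -⟩
      rw [h d (by omega) (by omega), h (d + 1) (by omega) (by omega)]
      exact id
    · simp [show y ≠ d by omega, show y ≠ d + 1 by omega]
    · rintro j hj τ hf hi ⟨hy, hj'⟩
      have hbb := hf.1 b (by simp [Prog.wr]; omega)
      simp [show b ≠ d by omega, show b ≠ d + 1 by omega] at hbb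
      refine (WP.seq (WP.const (WP.seq (WP.plus (WP.seq (WP.minus
        (WP.branch (T₁ := 3) (T₂ := 1) (fun hc => ?_) (fun hc => ?_)))))))).time (by omega)
      · refine WP.seq (WP.minus (WP.seq (WP.const (WP.plus ?_)))) (T₁ := 1) (T₂ := 1 + 1)
        simp [show b ≠ d + 4 by omega, hbb] at hc ⊢
        refine ⟨?_, ?_⟩
        · rw [add_mul]; omega
        · omega
      · refine WP.skip ?_
        simp [show b ≠ d + 4 by omega, hbb] at hc ⊢
        exact ⟨hy, by omega⟩
    · rintro τ hf ⟨hy, hj⟩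
      have hlt : τ.reg (d + 1) < σ.reg b := by
        rcases hj with hj | hj
        · exact hj
        · by_contra hcon
          rw [hj] at hy
          nlinarith [Nat.le_mul_of_pos_right (σ.reg y) hb]
      have hb' : 0 < σ.reg b := hb
      constructor
      · rw [hy, mul_comm, Nat.mul_add_div hb', Nat.div_eq_of_lt hlt, add_zero]
      · rw [hy, mul_comm, Nat.mul_add_mod, Nat.mod_eq_of_lt hlt]
  · rintro τ ⟨hq, hf⟩
    exact ⟨hq.1, hq.2, hf.agree (by simp +contextual) (by simp)⟩

/-! ### Rules that keep track of the remaining time -/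

namespace WP

variable {p q : Prog} {T T₁ : ℕ} {Q R : RamState → Prop} {σ : RamState}

/-- The time spent is subtracted from a budget `T` fixed in advance, so that no sum of running times
has to be guessed. -/
theorem bind (h : WP p T₁ R σ) (k : ∀ τ, R τ → WP q (T - T₁) Q τ) (hT : T₁ ≤ T := by omega) :
    WP (.seq p q) T Q σ :=
  (WP.seq (T₁ := T₁) (h.post k)).time (by omega)

theorem const_bind {x c : ℕ} (k : WP q (T - 1) Q (σ.setReg x c)) (hT : 1 ≤ T := by omega) :
    WP (.seq (.const x c) q) T Q σ :=
  (WP.const (Q := fun τ => τ = σ.setReg x c) rfl).bind (by rintro _ rfl; exact k) hT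

theorem plus_bind {x y z : ℕ} (k : WP q (T - 1) Q (σ.setReg x (σ.reg y + σ.reg z)))
    (hT : 1 ≤ T := by omega) : WP (.seq (.plus x y z) q) T Q σ :=
  (WP.plus (Q := fun τ => τ = σ.setReg x _) rfl).bind (by rintro _ rfl; exact k) hT

theorem minus_bind {x y z : ℕ} (k : WP q (T - 1) Q (σ.setReg x (σ.reg y - σ.reg z)))
    (hT : 1 ≤ T := by omega) : WP (.seq (.minus x y z) q) T Q σ :=
  (WP.minus (Q := fun τ => τ = σ.setReg x _) rfl).bind (by rintro _ rfl; exact k) hT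

theorem load_bind {x a y : ℕ} (k : WP q (T - 1) Q (σ.setReg x (σ.arr a (σ.reg y))))
    (hT : 1 ≤ T := by omega) : WP (.seq (.load x a y) q) T Q σ :=
  (WP.load (Q := fun τ => τ = σ.setReg x _) rfl).bind (by rintro _ rfl; exact k) hT

theorem store_bind {a y x : ℕ} (k : WP q (T - 1) Q (σ.setArr a (σ.reg y) (σ.reg x)))
    (hT : 1 ≤ T := by omega) : WP (.seq (.store a y x) q) T Q σ :=
  (WP.store (Q := fun τ => τ = σ.setArr a _ _) rfl).bind (by rintro _ rfl; exact k) hT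

theorem const_end {x c : ℕ} (h : Q (σ.setReg x c)) (hT : 1 ≤ T := by omega) :
    WP (.const x c) T Q σ := (WP.const h).time hT

theorem plus_end {x y z : ℕ} (h : Q (σ.setReg x (σ.reg y + σ.reg z))) (hT : 1 ≤ T := by omega) :
    WP (.plus x y z) T Q σ := (WP.plus h).time hT

theorem minus_end {x y z : ℕ} (h : Q (σ.setReg x (σ.reg y - σ.reg z)))
    (hT : 1 ≤ T := by omega) : WP (.minus x y z) T Q σ := (WP.minus h).time hT

theorem load_end {x a y : ℕ} (h : Q (σ.setReg x (σ.arr a (σ.reg y)))) (hT : 1 ≤ T := by omega) :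
    WP (.load x a y) T Q σ := (WP.load h).time hT

theorem store_end {a y x : ℕ} (h : Q (σ.setArr a (σ.reg y) (σ.reg x))) (hT : 1 ≤ T := by omega) :
    WP (.store a y x) T Q σ := (WP.store h).time hT

theorem skip_end (h : Q σ) (hT : 1 ≤ T := by omega) : WP .skip T Q σ := (WP.skip h).time hT

theorem branch_end {x : ℕ} (h₁ : σ.reg x ≠ 0 → WP p (T - 1) Q σ)
    (h₂ : σ.reg x = 0 → WP q (T - 1) Q σ) (hT : 1 ≤ T := by omega) : WP (.branch x p q) T Q σ := by
  by_cases hx : σ.reg x = 0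
  · obtain ⟨t, τ, he, ht, hq⟩ := h₂ hx
    exact ⟨t + 1, τ, .branch_false hx he, by omega, hq⟩
  · obtain ⟨t, τ, he, ht, hq⟩ := h₁ hx
    exact ⟨t + 1, τ, .branch_true hx he, by omega, hq⟩

end WP

/-! ### Factored graphs as token sequences, and recognition of their edges -/

/-- The symbols of a formula in prefix notation; the operations `0`, `1`, `2` are the Cartesian
product, the tensor product and the union. -/
inductive Tok where
  | leaf (G : InputGraph)
  | op (c : ℕ)

namespace Tok

/-- The encoding of a symbol. -/
def encode : Tok → List ℕ
  | leaf G => 0 :: G.encode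
  | op c => [c + 1]

/-- Two labels are related in an input graph: in mode `1` if they are adjacent, in any other mode
if they are equal and the label of a vertex. -/
def bit : Tok → ℕ → ℕ × ℕ → Prop
  | leaf G, μ, x => ∃ i j, G.label i = x.1 ∧ G.label j = x.2 ∧
      if μ = 1 then G.adj i j = true else x.1 = x.2
  | op _, _, _ => False

end Tok

/-- The symbol number `t`. -/
def symb (ts : List Tok) (t : ℕ) : Tok := ts.getD t (.op 0)

/-- The symbols of a formula in prefix notation. -/
def FactoredGraph.tokens : FactoredGraph → List Tok
  | leaf G => [.leaf G]
  | cartesian A B => .op 0 :: (A.tokens ++ B.tokens)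
  | tensor A B => .op 1 :: (A.tokens ++ B.tokens)
  | union A B => .op 2 :: (A.tokens ++ B.tokens)

theorem FactoredGraph.length_tokens (F : FactoredGraph) :
    F.tokens.length = 2 * F.numOps + 1 := by
  induction F with
  | leaf G => rfl
  | cartesian A B hA hB | tensor A B hA hB | union A B hA hB =>
    simp [tokens, numOps, hA, hB]; ring

/-- The mode of the left part: `0` recognizes equal vertices, `1` edges, `2` skips. -/
def leftMode (c μ b : ℕ) : ℕ :=
  if 2 ≤ c then (if b = 0 then μ else 2) else if c = 0 ∧ μ = 1 ∧ b ≠ 0 then 0 else μ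

/-- The mode of the right part. -/
def rightMode (c μ b : ℕ) : ℕ :=
  if 2 ≤ c then (if b = 0 then 2 else μ) else if c = 0 ∧ μ = 1 ∧ b = 0 then 0 else μ

/-- Scan a token sequence with a stack `S` of modes, written in base `3`, and a sequence `z` of
choices, written in base `2`, consuming the letters of a word. -/
def scanAccepts : List Tok → ℕ → ℕ → List (ℕ × ℕ) → Prop
  | [], _, _, w => w = []
  | .leaf G :: ts, S, z, w =>
    if S % 3 = 2 then scanAccepts ts (S / 3) (z / 2) w
    else match w with
      | [] => False
      | x :: w => (Tok.leaf G).bit (S % 3) x ∧ scanAccepts ts (S / 3) (z / 2) w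
  | .op c :: ts, S, z, w =>
    scanAccepts ts (3 * (3 * (S / 3) + rightMode c (S % 3) (z % 2)) + leftMode c (S % 3) (z % 2))
      (z / 2) w

/-- The words recognized by a formula in a given mode. -/
def Lang : FactoredGraph → ℕ → List (ℕ × ℕ) → Prop
  | _, 2, w => w = []
  | F, 1, w => F.toUGraph.Adj (w.map Prod.fst) (w.map Prod.snd)
  | F, _, w => w.map Prod.fst = w.map Prod.snd ∧ w.map Prod.fst ∈ F.toUGraph.verts

/-- A union may contain vertices of different lengths, but each of its edges lies in one of the two
parts. So two adjacent vertices can be read as one word of pairs of labels. -/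
theorem FactoredGraph.length_eq_of_adj (F : FactoredGraph) :
    ∀ x y, F.toUGraph.Adj x y → x.length = y.length := by
  induction F with
  | leaf G =>
    rintro x y ⟨i, j, rfl, rfl, -⟩
    rfl
  | cartesian A B hA hB =>
    rintro x y ⟨v₁, -, u₁, -, v₂, -, u₂, -, rfl, rfl, ⟨rfl, h⟩ | ⟨rfl, h⟩⟩
    · simp [hB _ _ h]
    · simp [hA _ _ h]
  | tensor A B hA hB =>
    rintro x y ⟨v₁, -, u₁, -, v₂, -, u₂, -, rfl, rfl, h, h'⟩
    simp [hA _ _ h, hB _ _ h']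
  | union A B hA hB => exact fun x y h => h.elim (hA x y) (hB x y)

/-- Both rows are cut at the same place, so the word of columns can be cut there too. -/
theorem exists_zip {v₁ v₂ u₁ u₂ : List ℕ} {w : List (ℕ × ℕ)} (hv : v₁.length = v₂.length)
    (h₁ : w.map Prod.fst = v₁ ++ u₁) (h₂ : w.map Prod.snd = v₂ ++ u₂) :
    ∃ w₁ w₂, w = w₁ ++ w₂ ∧ w₁.map Prod.fst = v₁ ∧ w₁.map Prod.snd = v₂ ∧
      w₂.map Prod.fst = u₁ ∧ w₂.map Prod.snd = u₂ := by
  refine ⟨w.take v₁.length, w.drop v₁.length, by simp, ?_, ?_, ?_, ?_⟩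
  · simp [List.map_take, h₁]
  · rw [hv]; simp [List.map_take, h₂]
  · simp [List.map_drop, h₁]
  · rw [hv]; simp [List.map_drop, h₂]

theorem lang_cartesian_one (A B : FactoredGraph) (w : List (ℕ × ℕ)) :
    Lang (.cartesian A B) 1 w ↔ ∃ w₁ w₂, w = w₁ ++ w₂ ∧
      ((Lang A 0 w₁ ∧ Lang B 1 w₂) ∨ (Lang A 1 w₁ ∧ Lang B 0 w₂)) := by
  constructor
  · rintro ⟨v₁, hv₁, u₁, hu₁, v₂, hv₂, u₂, hu₂, h₁, h₂, ⟨rfl, h⟩ | ⟨rfl, h⟩⟩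
    · obtain ⟨w₁, w₂, rfl, rfl, hw, rfl, rfl⟩ := exists_zip rfl h₁ h₂
      exact ⟨w₁, w₂, rfl, .inl ⟨⟨hw.symm, hv₁⟩, h⟩⟩
    · obtain ⟨w₁, w₂, rfl, rfl, rfl, rfl, hw⟩ := exists_zip (A.length_eq_of_adj _ _ h) h₁ h₂
      exact ⟨w₁, w₂, rfl, .inr ⟨h, ⟨hw.symm, hu₁⟩⟩⟩
  · rintro ⟨w₁, w₂, rfl, ⟨⟨h, h'⟩, h''⟩ | ⟨h'', ⟨h, h'⟩⟩⟩
    · exact ⟨_, h', _, B.toUGraph.mem_of_adj _ _ h'', _, h ▸ h', _,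
        B.toUGraph.mem_of_adj _ _ (B.toUGraph.symm _ _ h''), by simp, by simp, .inl ⟨h, h''⟩⟩
    · exact ⟨_, A.toUGraph.mem_of_adj _ _ h'', _, h', _,
        A.toUGraph.mem_of_adj _ _ (A.toUGraph.symm _ _ h''), _, h ▸ h', by simp, by simp,
        .inr ⟨h, h''⟩⟩

theorem lang_tensor_one (A B : FactoredGraph) (w : List (ℕ × ℕ)) :
    Lang (.tensor A B) 1 w ↔ ∃ w₁ w₂, w = w₁ ++ w₂ ∧ Lang A 1 w₁ ∧ Lang B 1 w₂ := by
  constructor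
  · rintro ⟨v₁, hv₁, u₁, hu₁, v₂, hv₂, u₂, hu₂, h₁, h₂, h, h'⟩
    obtain ⟨w₁, w₂, rfl, rfl, rfl, rfl, rfl⟩ := exists_zip (A.length_eq_of_adj _ _ h) h₁ h₂
    exact ⟨w₁, w₂, rfl, h, h'⟩
  · rintro ⟨w₁, w₂, rfl, h, h'⟩
    exact ⟨_, A.toUGraph.mem_of_adj _ _ h, _, B.toUGraph.mem_of_adj _ _ h', _,
      A.toUGraph.mem_of_adj _ _ (A.toUGraph.symm _ _ h), _,
      B.toUGraph.mem_of_adj _ _ (B.toUGraph.symm _ _ h'), by simp, by simp, h, h'⟩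

theorem lang_product_zero (A B : FactoredGraph) (w : List (ℕ × ℕ)) :
    (w.map Prod.fst = w.map Prod.snd ∧
      ∃ v ∈ A.toUGraph.verts, ∃ u ∈ B.toUGraph.verts, w.map Prod.fst = v ++ u) ↔
      ∃ w₁ w₂, w = w₁ ++ w₂ ∧ Lang A 0 w₁ ∧ Lang B 0 w₂ := by
  constructor
  · rintro ⟨h, v, hv, u, hu, h'⟩
    obtain ⟨w₁, w₂, rfl, rfl, h₁, rfl, h₂⟩ := exists_zip rfl h' (h ▸ h')
    exact ⟨w₁, w₂, rfl, ⟨h₁.symm, hv⟩, ⟨h₂.symm, hu⟩⟩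
  · rintro ⟨w₁, w₂, rfl, ⟨h₁, hv⟩, ⟨h₂, hu⟩⟩
    exact ⟨by simp [h₁, h₂], _, hv, _, hu, by simp⟩

theorem lang_union (A B : FactoredGraph) {μ : ℕ} (hμ : μ < 2) (w : List (ℕ × ℕ)) :
    Lang (.union A B) μ w ↔ Lang A μ w ∨ Lang B μ w := by
  interval_cases μ
  · simp [Lang, FactoredGraph.toUGraph, UGraph.union, and_or_left]
  · simp [Lang, FactoredGraph.toUGraph, UGraph.union]

theorem lang_leaf (G : InputGraph) {μ : ℕ} (hμ : μ < 2) (w : List (ℕ × ℕ)) :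
    Lang (.leaf G) μ w ↔ ∃ x, w = [x] ∧ (Tok.leaf G).bit μ x := by
  interval_cases μ
  · constructor
    · rintro ⟨h, i, hi⟩
      rw [List.map_eq_singleton_iff] at hi
      obtain ⟨x, rfl, hx⟩ := hi
      simp only [List.map_cons, List.map_nil, List.cons.injEq, and_true] at h
      exact ⟨x, rfl, i, i, hx.symm, by rw [← h, hx], by simpa using h⟩
    · rintro ⟨x, rfl, i, j, hi, hj, h⟩
      exact ⟨by simpa using h, i, by simp [hi]⟩
  · constructor
    · rintro ⟨i, j, hi, hj, h⟩
      rw [List.map_eq_singleton_iff] at hi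
      obtain ⟨x, rfl, hx⟩ := hi
      simp only [List.map_cons, List.map_nil, List.cons.injEq, and_true] at hj
      exact ⟨x, rfl, i, j, hx.symm, hj.symm, by simpa using h⟩
    · rintro ⟨x, rfl, i, j, hi, hj, h⟩
      exact ⟨i, j, by simp [hi], by simp [hj], by simpa using h⟩

/-- Choices are made one at a time. -/
theorem exists_choice (N : ℕ) (P : ℕ → ℕ → Prop) :
    (∃ z < 2 ^ (N + 1), P (z % 2) (z / 2)) ↔
      (∃ z < 2 ^ N, P 0 z) ∨ ∃ z < 2 ^ N, P 1 z := by
  constructor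
  · rintro ⟨z, hz, h⟩
    have : z / 2 < 2 ^ N := by rw [pow_succ] at hz; omega
    rcases Nat.mod_two_eq_zero_or_one z with h' | h' <;> rw [h'] at h
    exacts [.inl ⟨_, this, h⟩, .inr ⟨_, this, h⟩]
  · rintro (⟨z, hz, h⟩ | ⟨z, hz, h⟩)
    · exact ⟨2 * z, by rw [pow_succ]; omega, by simpa using h⟩
    · refine ⟨2 * z + 1, by rw [pow_succ]; omega, ?_⟩
      rw [show (2 * z + 1) % 2 = 1 by omega, show (2 * z + 1) / 2 = z by omega]
      exact h

/-- Some sequence of choices accepts. -/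
def Accepts (ts : List Tok) (S : ℕ) (w : List (ℕ × ℕ)) : Prop :=
  ∃ z < 2 ^ ts.length, scanAccepts ts S z w

/-! ### Correctness of the scan. -/

theorem accepts_op (c : ℕ) (ts : List Tok) (S : ℕ) (w : List (ℕ × ℕ)) :
    Accepts (.op c :: ts) S w ↔
      Accepts ts (3 * (3 * (S / 3) + rightMode c (S % 3) 0) + leftMode c (S % 3) 0) w ∨
      Accepts ts (3 * (3 * (S / 3) + rightMode c (S % 3) 1) + leftMode c (S % 3) 1) w :=
  exists_choice ts.length fun b z => scanAccepts ts
    (3 * (3 * (S / 3) + rightMode c (S % 3) b) + leftMode c (S % 3) b) z w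

/-- An input graph uses up one binary digit of the choices without looking at it, so that every
symbol has its own digit; both values lead to the same condition. -/
theorem accepts_leaf (G : InputGraph) (ts : List Tok) (S : ℕ) (w : List (ℕ × ℕ)) :
    Accepts (.leaf G :: ts) S w ↔
      if S % 3 = 2 then Accepts ts (S / 3) w
      else ∃ x w', w = x :: w' ∧ (Tok.leaf G).bit (S % 3) x ∧ Accepts ts (S / 3) w' := by
  by_cases h : S % 3 = 2
  · rw [if_pos h]
    have := exists_choice ts.length fun _ z => scanAccepts ts (S / 3) z w
    simpa only [Accepts, scanAccepts, h, if_true, List.length_cons, or_self] using this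
  · rw [if_neg h]
    cases w with
    | nil => simp [Accepts, scanAccepts, h]
    | cons x w =>
      have := exists_choice ts.length fun b z =>
        (Tok.leaf G).bit (S % 3) x ∧ scanAccepts ts (S / 3) z w
      simp only [Accepts, scanAccepts, h, if_false, List.length_cons, List.cons.injEq] at this ⊢
      rw [this]
      constructor
      · rintro (⟨z, hz, hb, h⟩ | ⟨z, hz, hb, h⟩) <;> exact ⟨x, w, ⟨rfl, rfl⟩, hb, z, hz, h⟩
      · rintro ⟨_, _, ⟨rfl, rfl⟩, hb, z, hz, h⟩
        exact .inl ⟨z, hz, hb, h⟩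

/-- Induction on the formula with arbitrary continuation: a formula removes its own mode and a
prefix of the word, and hands the stack `S` and the remaining letters to `rest`. For an operation,
the right part followed by `rest` is the continuation of the left part. The place of the cut needs
no choice of its own, because every input graph consumes one letter or, if skipped, none. -/
theorem accepts_tokens (F : FactoredGraph) : ∀ (μ : ℕ), μ < 3 → ∀ (rest : List Tok) (S : ℕ)
    (w : List (ℕ × ℕ)), Accepts (F.tokens ++ rest) (3 * S + μ) w ↔
      ∃ w₁ w₂, w = w₁ ++ w₂ ∧ Lang F μ w₁ ∧ Accepts rest S w₂ := by
  -- A skipped formula consumes nothing.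
  have hskip : ∀ (F : FactoredGraph) rest S w, (∃ w₁ w₂, w = w₁ ++ w₂ ∧ Lang F 2 w₁ ∧
      Accepts rest S w₂) ↔ Accepts rest S w := by
    intro F rest S w
    constructor
    · rintro ⟨_, w₂, rfl, rfl, h⟩
      exact h
    · exact fun h => ⟨[], w, rfl, rfl, h⟩
  have hassoc : ∀ (P R : List (ℕ × ℕ) → Prop) (T : List (ℕ × ℕ) → Prop) (w : List (ℕ × ℕ)),
      (∃ w₁ w₂, w = w₁ ++ w₂ ∧ P w₁ ∧ ∃ w₃ w₄, w₂ = w₃ ++ w₄ ∧ R w₃ ∧ T w₄) ↔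
      ∃ w₁ w₂, w = w₁ ++ w₂ ∧ (∃ w₃ w₄, w₁ = w₃ ++ w₄ ∧ P w₃ ∧ R w₄) ∧ T w₂ := by
    intro P R T w
    constructor
    · rintro ⟨w₁, _, rfl, hp, w₃, w₄, rfl, hr, ht⟩
      exact ⟨w₁ ++ w₃, w₄, by simp, ⟨_, _, rfl, hp, hr⟩, ht⟩
    · rintro ⟨_, w₂, rfl, ⟨w₃, w₄, rfl, hp, hr⟩, ht⟩
      exact ⟨w₃, w₄ ++ w₂, by simp, hp, _, _, rfl, hr, ht⟩
  have hdm : ∀ S μ : ℕ, μ < 3 → (3 * S + μ) % 3 = μ ∧ (3 * S + μ) / 3 = S := by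
    intro S μ h; omega
  -- Mode `0` is restated with `3 * S` in place of `3 * S + 0`, the form to which `norm_num`
  -- simplifies it.
  have hzero : ∀ {F : FactoredGraph}, (∀ (μ : ℕ), μ < 3 → ∀ (rest : List Tok) (S : ℕ)
      (w : List (ℕ × ℕ)), Accepts (F.tokens ++ rest) (3 * S + μ) w ↔
      ∃ w₁ w₂, w = w₁ ++ w₂ ∧ Lang F μ w₁ ∧ Accepts rest S w₂) → ∀ rest S w,
      Accepts (F.tokens ++ rest) (3 * S) w ↔
      ∃ w₁ w₂, w = w₁ ++ w₂ ∧ Lang F 0 w₁ ∧ Accepts rest S w₂ :=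
    fun h => h 0 (by norm_num)
  induction F with
  | leaf G =>
    intro μ hμ rest S w
    simp only [FactoredGraph.tokens, List.cons_append, List.nil_append]
    rw [accepts_leaf, (hdm S μ hμ).1, (hdm S μ hμ).2]
    by_cases h : μ = 2
    · subst h
      rw [if_pos rfl, hskip]
    · rw [if_neg h]
      simp only [lang_leaf G (show μ < 2 by omega)]
      constructor
      · rintro ⟨x, w', rfl, hb, h⟩
        exact ⟨[x], w', rfl, ⟨x, rfl, hb⟩, h⟩
      · rintro ⟨_, w', rfl, ⟨x, rfl, hb⟩, h⟩
        exact ⟨x, w', rfl, hb, h⟩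
  | cartesian A B hA hB =>
    intro μ hμ rest S w
    simp only [FactoredGraph.tokens, List.cons_append, List.append_assoc]
    rw [accepts_op, (hdm S μ hμ).1, (hdm S μ hμ).2]
    interval_cases μ
    · simp only [leftMode, rightMode]
      norm_num
      rw [hzero hA]
      simp only [hzero hB]
      rw [hassoc]
      simp only [← lang_product_zero]
      rfl
    · simp only [leftMode, rightMode]
      norm_num
      rw [hzero hA, hA 1 (by norm_num)]
      simp only [hzero hB, hB 1 (by norm_num)]
      rw [hassoc, hassoc, ← exists_or]
      simp only [← exists_or, lang_cartesian_one]
      refine exists_congr fun w₁ => exists_congr fun w₂ => ?_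
      rw [← and_or_left, ← or_and_right]
      refine and_congr_right fun _ => and_congr_left fun _ => ?_
      simp only [← exists_or, ← and_or_left]
      exact exists_congr fun w₃ => exists_congr fun w₄ => and_congr_right fun _ => or_comm
    · simp only [leftMode, rightMode]
      norm_num
      rw [hA 2 (by norm_num), hskip, hB 2 (by norm_num), hskip, hskip]
  | tensor A B hA hB =>
    intro μ hμ rest S w
    simp only [FactoredGraph.tokens, List.cons_append, List.append_assoc]
    rw [accepts_op, (hdm S μ hμ).1, (hdm S μ hμ).2]
    interval_cases μ
    · simp only [leftMode, rightMode]
      norm_num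
      rw [hzero hA]
      simp only [hzero hB]
      rw [hassoc]
      simp only [← lang_product_zero]
      rfl
    · simp only [leftMode, rightMode]
      norm_num
      rw [hA 1 (by norm_num)]
      simp only [hB 1 (by norm_num)]
      rw [hassoc]
      simp only [← lang_tensor_one]
    · simp only [leftMode, rightMode]
      norm_num
      rw [hA 2 (by norm_num), hskip, hB 2 (by norm_num), hskip, hskip]
  | union A B hA hB =>
    intro μ hμ rest S w
    simp only [FactoredGraph.tokens, List.cons_append, List.append_assoc]
    rw [accepts_op, (hdm S μ hμ).1, (hdm S μ hμ).2]
    simp only [leftMode, rightMode]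
    norm_num
    rw [hA μ hμ, hA 2 (by norm_num), hskip, hB μ hμ]
    simp only [hB 2 (by norm_num), hskip]
    by_cases h : μ = 2
    · subst h
      simp only [hskip, or_self]
    · simp only [lang_union A B (show μ < 2 by omega), or_and_right, and_or_left, exists_or]

theorem accepts_iff_lang (F : FactoredGraph) {μ : ℕ} (hμ : μ < 2) (w : List (ℕ × ℕ)) :
    Accepts F.tokens μ w ↔ Lang F μ w := by
  have := accepts_tokens F μ (by omega) [] 0 w
  simp only [List.append_nil, mul_zero, zero_add] at this
  rw [this]
  constructor
  · rintro ⟨w₁, w₂, rfl, h, z, -, rfl⟩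
    simpa using h
  · exact fun h => ⟨w, [], by simp, h, 0, by simp, rfl⟩

/-- Each symbol consumes at most one letter. This bounds the number of columns of a copy. -/
theorem scanAccepts_length {ts : List Tok} : ∀ {S z : ℕ} {w : List (ℕ × ℕ)},
    scanAccepts ts S z w → w.length ≤ ts.length := by
  induction ts with
  | nil => rintro S z w rfl; simp
  | cons t ts ih =>
    intro S z w h
    cases t with
    | op c => exact (ih h).trans (by simp)
    | leaf G =>
      simp only [scanAccepts] at h
      split_ifs at h
      · exact (ih h).trans (by simp)
      · cases w with
        | nil => simp
        | cons x w => simpa using ih h.2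

/-- Recognition depends only on the relations between the labels in the input graphs. -/
theorem scanAccepts_congr {ts : List Tok} : ∀ {S z : ℕ} {w w' : List (ℕ × ℕ)},
    List.Forall₂ (fun x x' => ∀ t ∈ ts, ∀ μ < 2, t.bit μ x ↔ t.bit μ x') w w' →
    (scanAccepts ts S z w ↔ scanAccepts ts S z w') := by
  induction ts with
  | nil =>
    intro S z w w' h
    simp only [scanAccepts]
    cases h <;> simp
  | cons t ts ih =>
    intro S z w w' h
    have hts : ∀ {w w'}, List.Forall₂ (fun x x' => ∀ t' ∈ t :: ts, ∀ μ < 2,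
        t'.bit μ x ↔ t'.bit μ x') w w' → List.Forall₂ (fun x x' => ∀ t ∈ ts, ∀ μ < 2,
        t.bit μ x ↔ t.bit μ x') w w' :=
      fun h => h.imp fun _ _ h t' ht' => h t' (List.mem_cons_of_mem _ ht')
    cases t with
    | op c => exact ih (hts h)
    | leaf G =>
      simp only [scanAccepts]
      split_ifs with hS
      · exact ih (hts h)
      · cases h with
        | nil => rfl
        | cons hx h => exact and_congr (hx _ (by simp) _ (by omega)) (ih (hts h))

/-! ### Counting the copies of a clique by signatures of columns -/

/-- The truth value of a relation between labels. -/
noncomputable def bitVal (t : Tok) (μ : ℕ) (x : ℕ × ℕ) : ℕ :=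
  open Classical in if t.bit μ x then 1 else 0

theorem bitVal_le (t : Tok) (μ : ℕ) (x : ℕ × ℕ) : bitVal t μ x ≤ 1 := by
  unfold bitVal; split_ifs <;> simp

theorem bitVal_inj {t : Tok} {μ : ℕ} {x x' : ℕ × ℕ} (h : bitVal t μ x = bitVal t μ x') :
    t.bit μ x ↔ t.bit μ x' := by
  unfold bitVal at h; split_ifs at h <;> simp_all

/-- The signature of a column `c` of `s` labels: all relations between its entries in the input
graphs, as the binary digits of a number. -/
noncomputable def sigOf (ts : List Tok) (s : ℕ) (c : ℕ → ℕ) : ℕ :=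
  foldN (fun t => foldN (fun i => foldN (fun i' => foldN (fun μ v =>
    v + v + bitVal (symb ts t) μ (c i, c i')) 2) s) s) ts.length 1

/-- If every single step can be undone, the result of the fold determines the initial value and all
data that entered. Nested four times, this decodes signatures. -/
theorem foldN_inj {f g : ℕ → ℕ → ℕ} {P : ℕ → Prop} {n : ℕ}
    (h : ∀ j < n, ∀ v v', f j v = g j v' → v = v' ∧ P j) {v v' : ℕ}
    (he : foldN f n v = foldN g n v') : v = v' ∧ ∀ j < n, P j := by
  induction n with
  | zero => exact ⟨he, by simp⟩
  | succ n ih =>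
    obtain ⟨h₁, h₂⟩ := h n (by omega) _ _ he
    obtain ⟨h₃, h₄⟩ := ih (fun j hj => h j (by omega)) h₁
    refine ⟨h₃, fun j hj => ?_⟩
    rcases Nat.lt_succ_iff_lt_or_eq.1 hj with hj | rfl
    exacts [h₄ j hj, h₂]

/-- Growth is measured by `v + 1` because appending a binary digit at most doubles this quantity.
The growth factors of nested loops then simply become powers. -/
theorem foldN_growth {f : ℕ → ℕ → ℕ} {n K : ℕ}
    (h : ∀ j v, v ≤ f j v ∧ f j v + 1 ≤ K * (v + 1)) (v : ℕ) :
    v ≤ foldN f n v ∧ foldN f n v + 1 ≤ K ^ n * (v + 1) := by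
  induction n with
  | zero => simp [foldN]
  | succ n ih =>
    obtain ⟨h₁, h₂⟩ := h n (foldN f n v)
    refine ⟨ih.1.trans h₁, h₂.trans ?_⟩
    calc K * (foldN f n v + 1) ≤ K * (K ^ n * (v + 1)) := Nat.mul_le_mul_left _ ih.2
      _ = K ^ (n + 1) * (v + 1) := by ring

/-- A bound for signatures. -/
def sigBound (m s : ℕ) : ℕ := (((2 ^ 2) ^ s) ^ s) ^ m * 2

/-- The initial value `1` of the fold keeps signatures positive, so that they can serve as leading
digits; it also accounts for the factor `2 = 1 + 1` in `sigBound`. -/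
theorem sigOf_bounds (ts : List Tok) (s : ℕ) (c : ℕ → ℕ) :
    1 ≤ sigOf ts s c ∧ sigOf ts s c < sigBound ts.length s := by
  have := foldN_growth (n := ts.length) (K := ((2 ^ 2) ^ s) ^ s) (f := fun t => foldN (fun i =>
    foldN (fun i' => foldN (fun μ v =>
    v + v + bitVal (symb ts t) μ (c i, c i')) 2) s) s)
    (fun t v => foldN_growth (fun i v => foldN_growth (fun i' v => foldN_growth (fun μ v => by
      have := bitVal_le (symb ts t) μ (c i, c i')
      omega) v) v) v) 1
  exact this

/-- The bit appended last is the parity of the number, and the earlier value is its half. -/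
theorem sigOf_inj {ts : List Tok} {s : ℕ} {c c' : ℕ → ℕ} (h : sigOf ts s c = sigOf ts s c') :
    ∀ i < s, ∀ i' < s, ∀ t ∈ ts, ∀ μ < 2, t.bit μ (c i, c i') ↔ t.bit μ (c' i, c' i') := by
  have key := (foldN_inj (n := ts.length)
    (P := fun t => ∀ i < s, ∀ i' < s, ∀ μ < 2, bitVal (symb ts t) μ (c i, c i') =
      bitVal (symb ts t) μ (c' i, c' i'))
    (fun t _ v v' h => foldN_inj (fun i _ v v' h => foldN_inj (fun i' _ v v' h =>
      foldN_inj (fun μ _ v v' h => by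
        have h₁ := bitVal_le (symb ts t) μ (c i, c i')
        have h₂ := bitVal_le (symb ts t) μ (c' i, c' i')
        constructor <;> omega) h) h) h) h).2
  intro i hi i' hi' t ht μ hμ
  obtain ⟨j, hj, rfl⟩ := List.getElem_of_mem ht
  have := key j hj i hi i' hi' μ hμ
  rw [symb, List.getD_eq_getElem _ _ hj] at this
  exact bitVal_inj this

/-- The columns with entries in `U` in the first `d` places that agree with `c` elsewhere. -/
noncomputable def columns (U : Finset ℕ) : ℕ → (ℕ → ℕ) → Finset (ℕ → ℕ)
  | 0, c => {c}
  | d + 1, c => open Classical in U.biUnion fun u => columns U d (Function.update c d u)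

theorem mem_columns {U : Finset ℕ} {d : ℕ} : ∀ {c c' : ℕ → ℕ},
    c' ∈ columns U d c ↔ (∀ i < d, c' i ∈ U) ∧ ∀ i, d ≤ i → c' i = c i := by
  induction d with
  | zero =>
    intro c c'
    simp [columns, funext_iff]
  | succ d ih =>
    intro c c'
    simp only [columns, Finset.mem_biUnion, ih]
    constructor
    · rintro ⟨u, hu, h, h'⟩
      refine ⟨fun i hi => ?_, fun i hi => ?_⟩
      · rcases Nat.lt_succ_iff_lt_or_eq.1 hi with hi | rfl
        · exact h i hi
        · rw [h' i le_rfl]; simpa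
      · rw [h' i (by omega), Function.update_of_ne (by omega)]
    · rintro ⟨h, h'⟩
      refine ⟨c' d, h d (by omega), fun i hi => h i (by omega), fun i hi => ?_⟩
      by_cases hid : i = d
      · subst hid; simp
      · rw [Function.update_of_ne hid, h' i (by omega)]

/-- The number of columns of signature `σ`. -/
noncomputable def numCols (ts : List Tok) (s : ℕ) (U : Finset ℕ) (d : ℕ) (c : ℕ → ℕ) (σ : ℕ) : ℕ :=
  open Classical in ((columns U d c).filter fun c' => sigOf ts s c' = σ).card

/-! ### Counting columns and sequences of columns by signature. -/

theorem numCols_zero (ts : List Tok) (s : ℕ) (U : Finset ℕ) (c : ℕ → ℕ) (σ : ℕ) :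
    numCols ts s U 0 c σ = if sigOf ts s c = σ then 1 else 0 := by
  unfold numCols columns
  rw [Finset.filter_singleton]
  split_ifs <;> simp

theorem numCols_succ (ts : List Tok) (s : ℕ) (U : Finset ℕ) (d : ℕ) (c : ℕ → ℕ) (σ : ℕ) :
    numCols ts s U (d + 1) c σ = ∑ u ∈ U, numCols ts s U d (Function.update c d u) σ := by
  classical
  simp only [numCols, columns]
  rw [Finset.filter_biUnion, Finset.card_biUnion]
  intro u _ u' _ hne
  rw [Function.onFun, Finset.disjoint_left]
  intro c' h h'
  rw [Finset.mem_filter, mem_columns] at h h'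
  have h₁ := h.1.2 d le_rfl
  have h₂ := h'.1.2 d le_rfl
  simp only [Function.update_self] at h₁ h₂
  exact hne (h₁.symm.trans h₂)

theorem numCols_le (ts : List Tok) (s : ℕ) (U : Finset ℕ) (d : ℕ) : ∀ (c : ℕ → ℕ) (σ : ℕ),
    numCols ts s U d c σ ≤ U.card ^ d := by
  induction d with
  | zero => intro c σ; rw [numCols_zero]; split_ifs <;> simp
  | succ d ih =>
    intro c σ
    rw [numCols_succ, pow_succ']
    exact (Finset.sum_le_card_nsmul U _ _ fun u _ => ih _ σ).trans_eq (by simp)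

/-- The sequences of columns with a given sequence of signatures. -/
noncomputable def fiber (A : Finset (ℕ → ℕ)) (f : (ℕ → ℕ) → ℕ) : List ℕ → Finset (List (ℕ → ℕ))
  | [] => {[]}
  | d :: D => open Classical in
    ((A.filter fun c => f c = d) ×ˢ fiber A f D).image fun p => p.1 :: p.2

theorem mem_fiber {A : Finset (ℕ → ℕ)} {f : (ℕ → ℕ) → ℕ} {D : List ℕ} :
    ∀ {W : List (ℕ → ℕ)}, W ∈ fiber A f D ↔ (∀ c ∈ W, c ∈ A) ∧ W.map f = D := by
  induction D with
  | nil => intro W; cases W <;> simp [fiber]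
  | cons d D ih =>
    intro W
    cases W with
    | nil => simp [fiber]
    | cons c W =>
      simp only [fiber, Finset.mem_image, Finset.mem_product, Finset.mem_filter, ih, Prod.exists,
        List.cons.injEq, List.map_cons, List.mem_cons, forall_eq_or_imp]
      constructor
      · rintro ⟨_, _, ⟨⟨h₁, h₂⟩, h₃, h₄⟩, rfl, rfl⟩
        exact ⟨⟨h₁, h₃⟩, h₂, h₄⟩
      · rintro ⟨⟨h₁, h₃⟩, h₂, h₄⟩
        exact ⟨_, _, ⟨⟨h₁, h₂⟩, h₃, h₄⟩, rfl, rfl⟩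

theorem card_fiber (A : Finset (ℕ → ℕ)) (f : (ℕ → ℕ) → ℕ) (D : List ℕ) :
    (fiber A f D).card =
      (D.map fun d => open Classical in (A.filter fun c => f c = d).card).prod := by
  classical
  induction D with
  | nil => simp [fiber]
  | cons d D ih =>
    rw [fiber, Finset.card_image_of_injective, Finset.card_product, ih, List.map_cons,
      List.prod_cons]
    rintro ⟨c, W⟩ ⟨c', W'⟩ h
    simpa using h

/-- The sequences `x`, with entry `x i` in row `i`, form a copy of the clique. -/
def IsClique (ts : List Tok) (s : ℕ) (word : ℕ → ℕ → List (ℕ × ℕ)) : Prop :=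
  ∀ i < s, ∀ i' < s, ∀ μ < 2, Accepts ts μ (word i i') ↔ if μ = 1 then i ≠ i' else i = i'

/-- The word that compares the rows `i` and `i'` of the sequence of columns with the signatures
given by the digits of `y` in base `Q`. -/
def repWord (s Q : ℕ) (rep : ℕ → ℕ) (y i i' : ℕ) : List (ℕ × ℕ) :=
  (Nat.digits Q y).map fun d => (rep (i + s * d), rep (i' + s * d))

theorem isClique_congr {ts : List Tok} {s : ℕ} {word word' : ℕ → ℕ → List (ℕ × ℕ)}
    (h : ∀ i < s, ∀ i' < s, List.Forall₂ (fun x x' => ∀ t ∈ ts, ∀ μ < 2, t.bit μ x ↔ t.bit μ x')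
      (word i i') (word' i i')) : IsClique ts s word ↔ IsClique ts s word' := by
  unfold IsClique
  refine forall₂_congr fun i hi => forall₂_congr fun i' hi' => forall₂_congr fun μ hμ => ?_
  have : Accepts ts μ (word i i') ↔ Accepts ts μ (word' i i') := by
    unfold Accepts
    exact exists_congr fun z => and_congr_right fun _ => scanAccepts_congr (h i hi i' hi')
  rw [this]

/-! ### Copies of the clique as matrices of labels. -/

theorem FactoredGraph.mem_of_mem_verts (F : FactoredGraph) (U : Finset ℕ)
    (hU : ∀ G, Tok.leaf G ∈ F.tokens → ∀ i, G.label i ∈ U) :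
    ∀ x ∈ F.toUGraph.verts, ∀ a ∈ x, a ∈ U := by
  induction F with
  | leaf G =>
    rintro x ⟨i, rfl⟩ a ha
    rw [List.mem_singleton.1 ha]
    exact hU G (by simp [tokens]) i
  | cartesian A B hA hB | tensor A B hA hB =>
    rintro x ⟨v, hv, u, hu, rfl⟩ a ha
    rcases List.mem_append.1 ha with ha | ha
    · exact hA (fun G hG => hU G (by simp [tokens, hG])) v hv a ha
    · exact hB (fun G hG => hU G (by simp [tokens, hG])) u hu a ha
  | union A B hA hB =>
    rintro x (hx | hx) a ha
    · exact hA (fun G hG => hU G (by simp [tokens, hG])) x hx a ha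
    · exact hB (fun G hG => hU G (by simp [tokens, hG])) x hx a ha

/-- A sequence of columns represents a copy of the clique iff its rows are one. -/
theorem isClique_iff (F : FactoredGraph) (s : ℕ) (W : List (ℕ → ℕ)) :
    IsClique F.tokens s (fun i i' => W.map fun c => (c i, c i')) ↔
      (fun i : Fin s => W.map fun c => c i) ∈ F.toUGraph.exactCopies (⊤ : SimpleGraph (Fin s)) := by
  unfold IsClique UGraph.exactCopies
  constructor
  · intro h
    have h0 := fun i hi i' hi' => h i hi i' hi' 0 (by norm_num)
    have h1 := fun i hi i' hi' => h i hi i' hi' 1 (by norm_num)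
    simp only [accepts_iff_lang _ (show 0 < 2 by norm_num),
      accepts_iff_lang _ (show 1 < 2 by norm_num), Lang, List.map_map, Function.comp_def] at h0 h1
    norm_num at h0 h1
    have hv : ∀ i : Fin s, (W.map fun c => c i) ∈ F.toUGraph.verts :=
      fun i => ((h0 i i.2 i i.2).2 rfl).2
    refine ⟨fun i i' hii => ?_, hv, fun i i' => ?_⟩
    · exact Fin.ext ((h0 i i.2 i' i'.2).1 ⟨by simpa using hii, hv i⟩)
    · rw [h1 i i.2 i' i'.2, SimpleGraph.top_adj, ne_eq, Fin.ext_iff]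
  · rintro ⟨hinj, hv, hadj⟩ i hi i' hi' μ hμ
    rw [accepts_iff_lang _ hμ]
    interval_cases μ
    · simp only [Lang, List.map_map, Function.comp_def]
      norm_num
      constructor
      · rintro ⟨h, -⟩
        simpa using @hinj ⟨i, hi⟩ ⟨i', hi'⟩ (by simpa using h)
      · rintro rfl
        exact ⟨fun _ _ => rfl, hv ⟨i, hi⟩⟩
    · have := hadj ⟨i, hi⟩ ⟨i', hi'⟩
      simp only [Lang, List.map_map, Function.comp_def]
      simpa using this

/-- Copies, read as sequences of columns, are classified by their sequences of signatures, which are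
the digits of `y` in base `Q`. The clique property is constant on a class, so it may be tested on
the representatives `rep`, which need not have entries in `U`. The size of a class is a product of
column counts. If some digit is the signature of no column, the class is empty and the product is
`0`, whatever the test says. -/
theorem countCopies_top_eq (F : FactoredGraph) (s : ℕ) (hs : 1 ≤ s) (U : Finset ℕ)
    (hU : ∀ G, Tok.leaf G ∈ F.tokens → ∀ i, G.label i ∈ U) (Q : ℕ) (hQ : 2 ≤ Q) (rep : ℕ → ℕ)
    (hrep : ∀ σ, numCols F.tokens s U s (fun _ => 0) σ ≠ 0 → σ < Q ∧
      ∃ c, sigOf F.tokens s c = σ ∧ ∀ i < s, rep (i + s * σ) = c i) :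
    F.countCopies (⊤ : SimpleGraph (Fin s)) = ∑ y ∈ Finset.range (Q ^ F.tokens.length),
      open Classical in if IsClique F.tokens s (repWord s Q rep y) then
        ((Nat.digits Q y).map (numCols F.tokens s U s fun _ => 0)).prod else 0 := by
  classical
  set A := columns U s fun _ => 0 with hA
  set sg := sigOf F.tokens s with hsg
  have hcard : ∀ D, (fiber A sg D).card = (D.map (numCols F.tokens s U s fun _ => 0)).prod := by
    intro D
    rw [card_fiber]
    congr 1
  have hsig : ∀ c ∈ A, numCols F.tokens s U s (fun _ => 0) (sg c) ≠ 0 := by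
    intro c hc
    unfold numCols
    exact Finset.card_ne_zero.2 ⟨c, by simp [hc, hsg, ← hA]⟩
  have hlist : ∀ y, ∀ W ∈ fiber A sg (Nat.digits Q y), (IsClique F.tokens s (repWord s Q rep y) ↔
      IsClique F.tokens s (fun i i' => W.map fun c => (c i, c i'))) := by
    intro y W hW
    obtain ⟨hWA, hWy⟩ := mem_fiber.1 hW
    refine isClique_congr fun i hi i' hi' => ?_
    rw [repWord, ← hWy, List.map_map, List.forall₂_map_left_iff, List.forall₂_map_right_iff,
      List.forall₂_same]
    intro c hc
    obtain ⟨-, c', hc', hr⟩ := hrep _ (hsig c (hWA c hc))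
    simp only [Function.comp_apply, hr i hi, hr i' hi']
    exact sigOf_inj hc' i hi i' hi'
  set S := ((Finset.range (Q ^ F.tokens.length)).filter fun y =>
    IsClique F.tokens s (repWord s Q rep y)).biUnion fun y => fiber A sg (Nat.digits Q y) with hS
  have hSA : ∀ W ∈ S, ∀ c ∈ W, c ∈ A := by
    intro W hW
    obtain ⟨y, -, hy⟩ := Finset.mem_biUnion.1 hW
    exact (mem_fiber.1 hy).1
  have hS' : S.card = ∑ y ∈ Finset.range (Q ^ F.tokens.length),
      if IsClique F.tokens s (repWord s Q rep y) then
        ((Nat.digits Q y).map (numCols F.tokens s U s fun _ => 0)).prod else 0 := by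
    rw [hS, Finset.card_biUnion, ← Finset.sum_filter]
    · exact Finset.sum_congr rfl fun y _ => hcard _
    · intro y _ y' _ hne
      rw [Function.onFun, Finset.disjoint_left]
      intro W h h'
      exact hne (Nat.digits_inj_iff.1 ((mem_fiber.1 h).2.symm.trans (mem_fiber.1 h').2))
  rw [← hS', FactoredGraph.countCopies, ← Set.ncard_coe_finset]
  symm
  refine Set.ncard_congr (fun W _ => fun i : Fin s => W.map fun c => c i) ?_ ?_ ?_
  · intro W hW
    obtain ⟨y, hy, hy'⟩ := Finset.mem_biUnion.1 hW
    rw [← isClique_iff, ← hlist y W hy']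
    exact (Finset.mem_filter.1 hy).2
  · intro W W' hW hW' h
    -- Row `0` exists since `1 ≤ s`, and its length is the number of columns.
    have hlen : W.length = W'.length := by
      simpa using congrArg List.length (congrFun h ⟨0, hs⟩)
    refine List.ext_getElem hlen fun p hp hp' => funext fun i => ?_
    by_cases hi : i < s
    · have := List.getElem_of_eq (congrFun h ⟨i, hi⟩) (i := p) (by simpa using hp)
      simpa using this
    -- From place `s` on the columns in `A` are `0`, so the rows determine them completely.
    · rw [(mem_columns.1 (hSA W hW _ (List.getElem_mem hp))).2 i (by omega),
        (mem_columns.1 (hSA W' hW' _ (List.getElem_mem hp'))).2 i (by omega)]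
  · intro a ha
    -- This is where the clique is used: distinct rows are adjacent and hence equally long.
    have hlen : ∀ i, (a i).length = (a ⟨0, hs⟩).length := by
      intro i
      by_cases hi : i = ⟨0, hs⟩
      · rw [hi]
      · exact F.length_eq_of_adj _ _ ((ha.2.2 _ _).2 (by simpa using hi))
    set W : List (ℕ → ℕ) := (List.range (a ⟨0, hs⟩).length).map fun p i =>
      if hi : i < s then (a ⟨i, hi⟩).getD p 0 else 0 with hW
    have hrow : (fun i : Fin s => W.map fun c => c i) = a := by
      funext i
      refine List.ext_getElem (by simp [hW, hlen i]) fun p hp hp' => ?_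
      simp [hW, hp']
    have hWA : ∀ c ∈ W, c ∈ A := by
      intro c hc
      obtain ⟨p, hp, rfl⟩ := List.mem_map.1 hc
      refine mem_columns.2 ⟨fun i hi => ?_, fun i hi => by simp [show ¬ i < s by omega]⟩
      have hp' : p < (a ⟨i, hi⟩).length := by rw [hlen]; exact List.mem_range.1 hp
      simp only [hi, dif_pos]
      rw [List.getD_eq_getElem _ _ hp']
      exact F.mem_of_mem_verts U hU _ (ha.2.1 _) _ (List.getElem_mem hp')
    have hcl : IsClique F.tokens s (fun i i' => W.map fun c => (c i, c i')) := by
      rw [isClique_iff, hrow]; exact ha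
    -- Row `0` is accepted as equal to itself, and an accepted word is no longer than the formula.
    have hWl : W.length ≤ F.tokens.length := by
      obtain ⟨z, -, hz⟩ := (hcl 0 hs 0 hs 0 (by norm_num)).2 (by simp)
      simpa using scanAccepts_length hz
    have hdig : Nat.digits Q (Nat.ofDigits Q (W.map sg)) = W.map sg := by
      refine Nat.digits_ofDigits Q hQ _ ?_ ?_
      · intro d hd
        obtain ⟨c, hc, rfl⟩ := List.mem_map.1 hd
        exact (hrep _ (hsig c (hWA c hc))).1
      -- The leading digit is a signature and therefore not `0`, so the digits of `y` retain the
      -- number of columns.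
      · intro hne h0
        obtain ⟨c, -, hc⟩ := List.mem_map.1 (List.getLast_mem hne)
        have : 1 ≤ sg c := (sigOf_bounds F.tokens s c).1
        omega
    have hfib : W ∈ fiber A sg (Nat.digits Q (Nat.ofDigits Q (W.map sg))) :=
      mem_fiber.2 ⟨hWA, hdig.symm⟩
    refine ⟨W, Finset.mem_coe.2 (Finset.mem_biUnion.2 ⟨_, Finset.mem_filter.2 ⟨?_,
      (hlist _ W hfib).2 hcl⟩, hfib⟩), hrow⟩
    refine Finset.mem_range.2 ((Nat.ofDigits_lt_base_pow_length hQ ?_).trans_le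
      (Nat.pow_le_pow_right (by omega) (by simpa using hWl)))
    intro d hd
    obtain ⟨c, hc, rfl⟩ := List.mem_map.1 hd
    exact (hrep _ (hsig c (hWA c hc))).1

/-! ### Looking up relations between labels -/

infixr:60 " ;; " => Prog.seq

/-- The code of a symbol in the array of operations. -/
def Tok.code : Tok → ℕ
  | leaf _ => 0
  | op c => c + 1

/-- The table entry with index `p` for the label `l`, when the first `n` vertices of `G` have been
entered: `row p` is the position of the row of that vertex in the input, and `col p` its index. -/
def Cell (inp row col : ℕ → ℕ) (G : InputGraph) (n p l : ℕ) : Prop :=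
  (∀ i : Fin G.size, (i : ℕ) < n → G.label i = l → row p ≠ 0 ∧ col p = i ∧
    ∀ j : Fin G.size, inp (row p + j) = if G.adj i j then 1 else 0) ∧
  ((∀ i : Fin G.size, (i : ℕ) < n → G.label i ≠ l) → row p = 0)

/-- The table entry with index `p` for the label `l` and a symbol. -/
def Entry (inp row col : ℕ → ℕ) (p l : ℕ) : Tok → Prop
  | .leaf G => Cell inp row col G G.size p l
  | .op _ => row p = 0

/-- The tables for the symbols `ts` have been set up. -/
structure Tables (ts : List Tok) (σ : RamState) : Prop where
  size : σ.reg 1 = ts.length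
  op : ∀ t < ts.length, σ.arr 1 t = (symb ts t).code
  entry : ∀ t < ts.length, ∀ l, Entry (σ.arr 0) (σ.arr 3) (σ.arr 4) (t + ts.length * l) l
    (symb ts t)

theorem Tables.of_eq {ts : List Tok} {σ τ : RamState} (h : Tables ts σ) (h1 : τ.reg 1 = σ.reg 1)
    (h0 : ∀ a < 5, τ.arr a = σ.arr a) : Tables ts τ := by
  refine ⟨by rw [h1, h.size], ?_, ?_⟩
  · rw [h0 1 (by norm_num)]; exact h.op
  · rw [h0 0 (by norm_num), h0 3 (by norm_num), h0 4 (by norm_num)]; exact h.entry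

/-- The row of a vertex never has position `0` in the input, so the value `0` is free to mean that
the label does not occur in this graph or that the symbol is an operation. -/
theorem Entry.bitVal_eq_zero {inp row col : ℕ → ℕ} {p l : ℕ} {t : Tok}
    (h : Entry inp row col p l t) (hp : row p = 0) (μ x : ℕ) :
    bitVal t μ (l, x) = 0 ∧ bitVal t μ (x, l) = 0 := by
  unfold bitVal
  cases t with
  | op c => simp [Tok.bit]
  | leaf G =>
    have : ∀ i, G.label i ≠ l := fun i hi => (h.1 i i.2 hi).1 hp
    constructor <;> rw [if_neg] <;> rintro ⟨i, j, h₁, h₂, -⟩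
    exacts [this i h₁, this j h₂]

/-- Labels are distinct within an input graph, so the vertices recorded in the table are the only
ones that can witness the adjacency. -/
theorem Entry.bitVal_one {inp row col : ℕ → ℕ} {p l p' l' : ℕ} {t : Tok}
    (h : Entry inp row col p l t) (h' : Entry inp row col p' l' t)
    (hp : row p ≠ 0) (hp' : row p' ≠ 0) : bitVal t 1 (l, l') = inp (row p + col p') := by
  unfold bitVal
  cases t with
  | op c => exact absurd h hp
  | leaf G =>
    obtain ⟨i, hi⟩ : ∃ i, G.label i = l := by
      by_contra hc
      exact hp (h.2 fun i _ hi => hc ⟨i, hi⟩)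
    obtain ⟨j, hj⟩ : ∃ j, G.label j = l' := by
      by_contra hc
      exact hp' (h'.2 fun i _ hi => hc ⟨i, hi⟩)
    rw [(h'.1 j j.2 hj).2.1, (h.1 i i.2 hi).2.2 j]
    congr 1
    refine propext ⟨?_, fun hij => ⟨i, j, hi, hj, by simpa using hij⟩⟩
    rintro ⟨i', j', hi', hj', hij⟩
    obtain rfl := G.label_injective (hi'.trans hi.symm)
    obtain rfl := G.label_injective (hj'.trans hj.symm)
    simpa using hij

theorem Entry.bitVal_zero {inp row col : ℕ → ℕ} {p l l' : ℕ} {t : Tok}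
    (h : Entry inp row col p l t) (hp : row p ≠ 0) :
    bitVal t 0 (l, l') = if l = l' then 1 else 0 := by
  unfold bitVal
  cases t with
  | op c => exact absurd h hp
  | leaf G =>
    obtain ⟨i, hi⟩ : ∃ i, G.label i = l := by
      by_contra hc
      exact hp (h.2 fun i _ hi => hc ⟨i, hi⟩)
    congr 1
    refine propext ⟨?_, fun h => ⟨i, i, hi, hi.trans h, by simpa using h⟩⟩
    rintro ⟨_, _, -, -, h⟩
    simpa using h

namespace Prog

/-- `reg 90 := bit` of the symbol number `reg t` in mode `reg μ` for the labels `reg a`,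
`reg b`. -/
def lookup (t μ a b : ℕ) : Prog :=
  .const 90 0 ;; mulAdd 91 1 t a ;; .load 94 3 91 ;; mulAdd 95 1 t b ;; .load 98 3 95 ;;
  .load 99 4 95 ;; .branch 94 (.branch 98 (.branch μ
    (.plus 100 94 99 ;; .load 90 0 100)
    (.minus 100 a b ;; .minus 101 b a ;; .plus 100 100 101 ;; .const 101 1 ;; .minus 90 101 100))
    .skip) .skip

theorem wr_lookup {t μ a b x : ℕ} (h : (lookup t μ a b).wr x) : 90 ≤ x ∧ x < 102 := by
  simp [lookup, wr] at h; omega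

@[simp] theorem wa_lookup (t μ a b x : ℕ) : ¬ (lookup t μ a b).wa x := by
  simp [lookup, wa]

end Prog

/-- The table index `t + m * l` is computed by adding the label `m` times, so the size of the labels
does not affect the time. In mode `0` the answer is `1 - |a - b|`, truncated. -/
theorem wp_lookup {ts : List Tok} {σ : RamState} {t μ a b : ℕ}
    (hr : t < 90 ∧ μ < 90 ∧ a < 90 ∧ b < 90) (hT : Tables ts σ) (htm : σ.reg t < ts.length)
    (hμ2 : σ.reg μ < 2) :
    WP (.lookup t μ a b) (10 * ts.length + 30) (fun τ =>
      τ.reg 90 = bitVal (symb ts (σ.reg t)) (σ.reg μ) (σ.reg a, σ.reg b) ∧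
      Agree 90 σ τ) σ := by
  obtain ⟨ht, hμ, ha, hb⟩ := hr
  refine (WP.frame (Q := fun τ =>
      τ.reg 90 = bitVal (symb ts (σ.reg t)) (σ.reg μ) (σ.reg a, σ.reg b)) ?_).post ?_
  · refine WP.const_bind ((wp_mulAdd (N := ts.length) (by omega) (by simp [hT.size])).bind ?_)
    rintro τ₁ ⟨h91, hr₁, ha₁⟩
    refine WP.load_bind ((wp_mulAdd (N := ts.length) (by omega) (by simp [hT.size, hr₁])).bind ?_)
    rintro τ₂ ⟨h95, hr₂, ha₂⟩
    have hbase : ∀ x < 90, τ₂.reg x = σ.reg x := by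
      intro x hx
      rw [hr₂ x (by omega), RamState.reg_setReg, if_neg (by omega), hr₁ x (by omega),
        RamState.reg_setReg, if_neg (by omega)]
    have harr : τ₂.arr = σ.arr := by rw [ha₂, RamState.arr_setReg, ha₁, RamState.arr_setReg]
    have e91 : τ₁.reg 91 = σ.reg t + ts.length * σ.reg a := by
      rw [h91]
      simp [hT.size, show t ≠ 90 by omega, show a ≠ 90 by omega]
    have e94 : τ₂.reg 94 = σ.arr 3 (σ.reg t + ts.length * σ.reg a) := by
      rw [hr₂ 94 (by norm_num), RamState.reg_setReg, if_pos rfl, ha₁, e91]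
      simp
    have e95 : τ₂.reg 95 = σ.reg t + ts.length * σ.reg b := by
      rw [h95]
      simp only [RamState.reg_setReg]
      rw [if_neg (by omega), if_neg (by omega), if_neg (by omega), hr₁ t (by omega),
        hr₁ b (by omega), hr₁ 1 (by omega)]
      simp [hT.size, show t ≠ 90 by omega, show b ≠ 90 by omega]
    have e90 : τ₂.reg 90 = 0 := by
      rw [hr₂ 90 (by norm_num), RamState.reg_setReg, if_neg (by norm_num), hr₁ 90 (by norm_num)]
      simp
    have hEa := hT.entry _ htm (σ.reg a)
    have hEb := hT.entry _ htm (σ.reg b)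
    refine WP.load_bind (WP.load_bind (WP.branch_end (fun h₁ => WP.branch_end (fun h₂ =>
      WP.branch_end (fun h₃ => WP.plus_bind (WP.load_end ?_)) (fun h₃ => WP.minus_bind
        (WP.minus_bind (WP.plus_bind (WP.const_bind (WP.minus_end ?_))))))
      (fun h₂ => WP.skip_end ?_)) (fun h₁ => WP.skip_end ?_)))
    · simp [e94, e95, harr, hbase, show μ ≠ 99 by omega, show μ ≠ 98 by omega, hμ] at h₁ h₂ h₃ ⊢
      rw [show σ.reg μ = 1 by omega, hEa.bitVal_one hEb h₁ h₂]
    · simp [e94, e95, harr, hbase, show μ ≠ 99 by omega, show μ ≠ 98 by omega, hμ] at h₁ h₂ h₃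
      rw [h₃, hEa.bitVal_zero h₁]
      simp [show a ≠ 98 by omega, show b ≠ 98 by omega, show a ≠ 99 by omega,
        show b ≠ 99 by omega, show a ≠ 100 by omega, show b ≠ 100 by omega, ha, hb, hbase]
      split_ifs <;> omega
    · simp [e94, e95, harr, e90] at h₁ h₂ ⊢
      rw [(hEb.bitVal_eq_zero h₂ _ _).2]
    · simp [e94, e95, harr, e90] at h₁ ⊢
      rw [(hEa.bitVal_eq_zero h₁ _ _).1]
  · rintro τ ⟨hq, hf⟩
    exact ⟨hq, hf.agree (fun x hx => (Prog.wr_lookup hx).1) (by simp)⟩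

/-! ### Scanning a word -/

namespace Prog

/-- Read the symbol number `reg 48` into `reg 50`, pop a mode from the stack `reg 44` into
`reg 53`, and a choice from `reg 45` into `reg 59`. -/
def scanPop : Prog :=
  .load 50 1 48 ;; .const 51 3 ;; divMod 52 44 51 ;; .const 57 2 ;; divMod 58 45 57 ;;
  .const 44 0 ;; .plus 44 44 52 ;; .const 45 0 ;; .plus 45 45 58

/-- Compute the modes of the two parts into `reg 70` and `reg 71`. -/
def scanModes : Prog :=
  .branch 73 (.branch 59 (.const 70 2) (.const 71 2))
    (.const 72 1 ;; .minus 73 50 72 ;; .branch 73 .skip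
      (.branch 53 (.minus 73 53 72 ;; .branch 73 .skip (.branch 59 (.const 70 0) (.const 71 0)))
        .skip))

/-- Push the modes of the two parts. -/
def scanPush : Prog :=
  .const 70 0 ;; .plus 70 70 53 ;; .const 71 0 ;; .plus 71 71 53 ;; .const 72 2 ;;
  .minus 73 50 72 ;; scanModes ;; .plus 74 44 44 ;; .plus 44 74 44 ;; .plus 44 44 71 ;;
  .plus 74 44 44 ;; .plus 44 74 44 ;; .plus 44 44 70

/-- Remove a letter from the word `reg 46` and test it. -/
def scanLetter : Prog :=
  divMod 75 46 4 ;; .const 46 0 ;; .plus 46 46 75 ;; mulAdd 80 3 31 76 ;; .load 83 9 80 ;;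
  mulAdd 84 3 33 76 ;; .load 87 9 84 ;; lookup 48 53 83 87 ;; .branch 90 .skip (.const 47 0)

/-- Process an input graph. -/
def scanLeaf : Prog :=
  .const 72 1 ;; .minus 73 53 72 ;; .branch 73 .skip (.branch 46 scanLetter (.const 47 0))

/-- Process one symbol. -/
def scanStep : Prog := scanPop ;; .branch 50 scanPush scanLeaf

end Prog

theorem wp_scanPop {B Z : ℕ} {σ : RamState} (hB : σ.reg 44 ≤ B) (hZ : σ.reg 45 ≤ Z) :
    WP .scanPop (12 * B + 12 * Z + 30) (fun τ => τ.reg 50 = σ.arr 1 (σ.reg 48) ∧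
      τ.reg 44 = σ.reg 44 / 3 ∧ τ.reg 53 = σ.reg 44 % 3 ∧ τ.reg 45 = σ.reg 45 / 2 ∧
      τ.reg 59 = σ.reg 45 % 2) σ := by
  refine WP.load_bind (WP.const_bind ((wp_divMod (N := B) (by omega) (by simp)
    (by simpa using hB)).bind ?_))
  rintro τ₁ ⟨h52, h53, hr₁, ha₁⟩
  refine WP.const_bind ((wp_divMod (N := Z) (by omega) (by simp)
    (by simpa [hr₁] using hZ)).bind ?_)
  rintro τ₂ ⟨h58, h59, hr₂, ha₂⟩
  refine WP.const_bind (WP.plus_bind (WP.const_bind (WP.plus_end ?_)))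
  simp at h52 h53 h58 h59
  simp [hr₂, hr₁, h52, h53, h58, h59]

theorem wp_scanModes {σ : RamState} {c : ℕ} (hc : σ.reg 50 = c + 1) (h70 : σ.reg 70 = σ.reg 53)
    (h71 : σ.reg 71 = σ.reg 53) (h73 : σ.reg 73 = σ.reg 50 - 2) (hμ : σ.reg 53 < 3) :
    WP .scanModes 10 (fun τ => τ.reg 70 = leftMode c (σ.reg 53) (σ.reg 59) ∧
      τ.reg 71 = rightMode c (σ.reg 53) (σ.reg 59)) σ := by
  unfold leftMode rightMode
  refine WP.branch_end (fun h₁ => WP.branch_end (fun h₂ => WP.const_end ?_)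
    (fun h₂ => WP.const_end ?_)) (fun h₁ => WP.const_bind (WP.minus_bind (WP.branch_end
      (fun h₂ => WP.skip_end ?_) (fun h₂ => WP.branch_end (fun h₃ => WP.minus_bind (WP.branch_end
        (fun h₄ => WP.skip_end ?_) (fun h₄ => WP.branch_end (fun h₅ => WP.const_end ?_)
          (fun h₅ => WP.const_end ?_)))) (fun h₃ => WP.skip_end ?_)))))
  all_goals
    simp [hc, h70, h71, h73] at *
    grind

theorem wp_scanPush {σ : RamState} {c : ℕ} (hc : σ.reg 50 = c + 1) (hμ : σ.reg 53 < 3) :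
    WP .scanPush 30 (fun τ => τ.reg 44 = 3 * (3 * σ.reg 44 + rightMode c (σ.reg 53) (σ.reg 59)) +
      leftMode c (σ.reg 53) (σ.reg 59)) σ := by
  refine WP.const_bind (WP.plus_bind (WP.const_bind (WP.plus_bind (WP.const_bind (WP.minus_bind
    ((wp_scanModes (c := c) ?_ ?_ ?_ ?_ ?_).frame.bind ?_))))))
  any_goals simp [hc, hμ]
  rintro τ h70 h71 hf
  refine WP.plus_bind (WP.plus_bind (WP.plus_bind (WP.plus_bind (WP.plus_bind (WP.plus_end ?_)))))
  have h44 := hf.1 44 (by simp [Prog.scanModes, Prog.wr])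
  simp at h44
  simp [h70, h71, h44]
  ring

/-- The last digit of register `46` is the signature of the next column, and array `9` supplies the
entries of its representative in the two rows compared. A failed test clears the flag in register
`47`; the scan runs on but never sets the flag again. -/
theorem wp_scanLetter {ts : List Tok} {Y : ℕ} {σ : RamState} (hT : Tables ts σ)
    (ht : σ.reg 48 < ts.length) (hμ : σ.reg 53 < 2) (hQ : 2 ≤ σ.reg 4) (hY : σ.reg 46 ≤ Y) :
    WP .scanLetter (12 * Y + 10 * σ.reg 3 + 10 * ts.length + 60) (fun τ =>
      τ.reg 46 = σ.reg 46 / σ.reg 4 ∧ (τ.reg 47 ≠ 0 ↔ σ.reg 47 ≠ 0 ∧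
        (symb ts (σ.reg 48)).bit (σ.reg 53)
          (σ.arr 9 (σ.reg 31 + σ.reg 3 * (σ.reg 46 % σ.reg 4)),
           σ.arr 9 (σ.reg 33 + σ.reg 3 * (σ.reg 46 % σ.reg 4))))) σ := by
  refine (wp_divMod (N := Y) (by omega) (by omega) hY).bind ?_
  rintro τ₁ ⟨h75, h76, hr₁, ha₁⟩
  refine WP.const_bind (WP.plus_bind ((wp_mulAdd (N := σ.reg 3) (by omega)
    (by simp [hr₁])).bind ?_))
  rintro τ₂ ⟨h80, hr₂, ha₂⟩
  refine WP.load_bind ((wp_mulAdd (N := σ.reg 3) (by omega) (by simp [hr₁, hr₂])).bind ?_)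
  rintro τ₃ ⟨h84, hr₃, ha₃⟩
  simp at h75 h76 h80 h84
  simp [hr₁, hr₂, h76] at h80 h84
  have hb : ∀ x < 75, x ≠ 46 → τ₃.reg x = σ.reg x := by
    intro x hx h46
    rw [hr₃ x (by omega), RamState.reg_setReg, if_neg (by omega), hr₂ x (by omega)]
    simp [h46, hr₁ x hx]
  have h46 : τ₃.reg 46 = σ.reg 46 / σ.reg 4 := by
    simp [hr₃, hr₂, h75]
  have harr : τ₃.arr = σ.arr := by simp [ha₃, ha₂, ha₁]
  have h83 : τ₃.reg 83 = σ.arr 9 (σ.reg 31 + σ.reg 3 * (σ.reg 46 % σ.reg 4)) := by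
    simp [hr₃, ha₂, ha₁, h80]
  refine WP.load_bind ((wp_lookup (ts := ts) (by omega) ?_ ?_ ?_).bind ?_)
  · exact hT.of_eq (by simp [hb]) (by simp [harr])
  · simpa [hb] using ht
  · simpa [hb] using hμ
  rintro τ₄ ⟨h90, hr₄, ha₄⟩
  simp [hb, h83, harr, h84] at h90
  have hbit : τ₄.reg 90 ≠ 0 ↔ (symb ts (σ.reg 48)).bit (σ.reg 53)
          (σ.arr 9 (σ.reg 31 + σ.reg 3 * (σ.reg 46 % σ.reg 4)),
           σ.arr 9 (σ.reg 33 + σ.reg 3 * (σ.reg 46 % σ.reg 4))) := by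
    rw [h90, bitVal]; simp
  rw [← hbit]
  refine WP.branch_end (fun h => WP.skip_end ?_) (fun h => WP.const_end ?_)
  · simp [hr₄, h46, hb, h]
  · simp [hr₄, h46, h]

/-- The word that the register `46` stands for. -/
def RamState.word (σ : RamState) (y : ℕ) : List (ℕ × ℕ) :=
  repWord (σ.reg 3) (σ.reg 4) (σ.arr 9) y (σ.reg 31) (σ.reg 33)

/-- The equivalence makes "no failure so far, and the rest of the scan accepts" an invariant of the
loop over the symbols. The stack bound is the case of both pushed modes being `2`. -/
theorem wp_scanStep {ts : List Tok} {B Z Y : ℕ} {σ : RamState} (hT : Tables ts σ)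
    (ht : σ.reg 48 < ts.length) (hQ : 2 ≤ σ.reg 4)
    (hB : σ.reg 44 ≤ B) (hZ : σ.reg 45 ≤ Z) (hY : σ.reg 46 ≤ Y) :
    WP .scanStep (12 * B + 12 * Z + 12 * Y + 10 * σ.reg 3 + 10 * ts.length + 100) (fun τ =>
      ((τ.reg 47 ≠ 0 ∧ scanAccepts (ts.drop (σ.reg 48 + 1)) (τ.reg 44) (τ.reg 45)
          (σ.word (τ.reg 46))) ↔
        (σ.reg 47 ≠ 0 ∧ scanAccepts (ts.drop (σ.reg 48)) (σ.reg 44) (σ.reg 45)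
          (σ.word (σ.reg 46)))) ∧
      τ.reg 44 ≤ 3 * σ.reg 44 + 8 ∧ τ.reg 45 ≤ σ.reg 45 ∧ τ.reg 46 ≤ σ.reg 46) σ := by
  refine (wp_scanPop hB hZ).frame.bind ?_
  rintro τ₁ ⟨⟨h50, h44, h53, h45, h59⟩, hf₁⟩
  have hr : ∀ x, (x < 44 ∨ x = 46 ∨ x = 47 ∨ x = 48) → τ₁.reg x = σ.reg x := by
    intro x hx
    exact hf₁.1 x (by simp [Prog.scanPop, Prog.wr]; omega)
  have ha : τ₁.arr = σ.arr := funext fun a => hf₁.2 a (by simp [Prog.scanPop, Prog.wa])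
  rw [hT.op _ ht] at h50
  have hsymb : symb ts (σ.reg 48) = ts[σ.reg 48] := by
    rw [symb, List.getD_eq_getElem _ _ ht]
  rw [List.drop_eq_getElem_cons ht, ← hsymb]
  have hdiv := Nat.div_add_mod (σ.reg 44) 3
  have hmod := Nat.mod_lt (σ.reg 44) (show 0 < 3 by norm_num)
  cases hs : symb ts (σ.reg 48) with
  | op c =>
    rw [hs, Tok.code] at h50
    refine WP.branch_end (fun _ => ((wp_scanPush h50 (by omega)).frame.mono (by omega) ?_))
      (fun h => absurd h (by omega))
    rintro τ ⟨h44', hf⟩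
    have e : ∀ x, (x = 45 ∨ x = 46 ∨ x = 47) → τ.reg x = τ₁.reg x := by
      intro x hx
      exact hf.1 x (by simp [Prog.scanPush, Prog.scanModes, Prog.wr]; omega)
    rw [h44', e 45 (by simp), e 46 (by simp), e 47 (by simp), h45, hr 46 (by simp),
      hr 47 (by simp), h44, h53, h59]
    refine ⟨Iff.rfl, ?_, by omega, le_rfl⟩
    have : ∀ b, leftMode c (σ.reg 44 % 3) b ≤ 2 ∧ rightMode c (σ.reg 44 % 3) b ≤ 2 := by
      intro b; unfold leftMode rightMode; split_ifs <;> omega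
    have := this (σ.reg 45 % 2)
    omega
  | leaf G =>
    rw [hs, Tok.code] at h50
    refine WP.branch_end (fun h => absurd h50 h) (fun _ => ?_)
    have hw : σ.word = τ₁.word := by
      unfold RamState.word
      rw [hr 3 (by simp), hr 4 (by simp), hr 31 (by simp), hr 33 (by simp), ha]
    refine WP.const_bind (WP.minus_bind (WP.branch_end (fun h₁ => WP.skip_end ?_)
      (fun h₁ => WP.branch_end (fun h₂ => ?_) (fun h₂ => WP.const_end ?_))))
    · simp [h53] at h₁
      simp [h44, h45, hr, scanAccepts, show σ.reg 44 % 3 = 2 by omega]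
      omega
    · have h₃ : σ.reg 44 % 3 < 2 := by simp [h53] at h₁; omega
      refine (wp_scanLetter (ts := ts) (Y := Y) ?_ ?_ ?_ ?_ ?_).frame.mono ?_ ?_
      · exact hT.of_eq (by simp [hr]) (by simp [ha])
      · simpa [hr] using ht
      · simpa [h53] using h₃
      · simpa [hr] using hQ
      · simpa [hr] using hY
      · simp [hr]; omega
      rintro τ ⟨⟨h46, h47⟩, hf⟩
      have e : ∀ x, (x = 44 ∨ x = 45) → τ.reg x = τ₁.reg x := by
        intro x hx
        have := hf.1 x (by
          simp only [Prog.scanLetter, Prog.wr, Prog.wr_divMod, Prog.wr_mulAdd, not_or]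
          have := @Prog.wr_lookup 48 53 83 87 x
          refine ⟨by omega, by omega, by omega, by omega, by omega, by omega, by omega,
            fun h => by have := this h; omega, by simp, by omega⟩)
        rw [this]
        simp [show x ≠ 73 by omega, show x ≠ 72 by omega]
      simp [hr, h53, ha] at h46 h47 h₂
      rw [hs] at h47
      have hy : σ.word (σ.reg 46) = (σ.arr 9 (σ.reg 31 + σ.reg 3 * (σ.reg 46 % σ.reg 4)),
           σ.arr 9 (σ.reg 33 + σ.reg 3 * (σ.reg 46 % σ.reg 4))) ::
           σ.word (σ.reg 46 / σ.reg 4) := by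
        simp only [RamState.word, repWord]
        rw [Nat.digits_def' (by omega) (by omega), List.map_cons]
      rw [hy, h46, e 44 (by simp), e 45 (by simp), h44, h45]
      simp only [scanAccepts, if_neg (show σ.reg 44 % 3 ≠ 2 by omega)]
      refine ⟨?_, by omega, by omega, Nat.div_le_self _ _⟩
      rw [ne_eq, h47]
      tauto
    · simp [h53] at h₁
      simp [hr] at h₂
      have hy : σ.word (σ.reg 46) = [] := by
        simp [RamState.word, repWord, h₂]
      simp [h44, h45, hr, scanAccepts, hy, show σ.reg 44 % 3 ≠ 2 by omega]
      omega

/-! ### Recognizing cliques -/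

namespace Prog

theorem wr_scanStep {x : ℕ} (h : scanStep.wr x) : 44 ≤ x ∧ x < 102 ∧ x ≠ 48 ∧ x ≠ 49 := by
  simp only [scanStep, scanPop, scanPush, scanModes, scanLeaf, scanLetter, wr, wr_divMod,
    wr_mulAdd] at h
  have := @wr_lookup 48 53 83 87 x
  by_cases hl : (lookup 48 53 83 87).wr x
  · have := this hl
    omega
  · simp only [hl, false_or, or_false] at h
    omega

@[simp] theorem wa_scanStep (a : ℕ) : ¬ scanStep.wa a := by
  simp [scanStep, scanPop, scanPush, scanModes, scanLeaf, scanLetter, wa]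

/-- Scan the word `reg 10` in mode `reg 36` with the choices `reg 41`. -/
def scan : Prog :=
  .const 44 0 ;; .plus 44 44 36 ;; .const 45 0 ;; .plus 45 45 41 ;; .const 46 0 ;;
  .plus 46 46 10 ;; .const 47 1 ;; forUp 48 1 scanStep

theorem wr_scan {x : ℕ} (h : scan.wr x) : 44 ≤ x ∧ x < 102 := by
  simp only [scan, wr, wr_forUp] at h
  by_cases hl : scanStep.wr x
  · have := wr_scanStep hl
    omega
  · simp only [hl, or_false] at h
    omega

@[simp] theorem wa_scan (a : ℕ) : ¬ scan.wa a := by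
  simp [scan, wa]

/-- `reg 40 := 1` if some choices accept, else `0`. -/
def member : Prog :=
  .const 40 0 ;; forUp 41 14 (scan ;; .branch 47 (.branch 46 .skip (.const 40 1)) .skip)

theorem wr_member {x : ℕ} (h : member.wr x) : 40 ≤ x ∧ x < 102 := by
  simp only [member, wr, wr_forUp] at h
  by_cases hl : scan.wr x
  · have := wr_scan hl
    omega
  · simp only [hl, false_or, or_false] at h
    omega

@[simp] theorem wa_member (a : ℕ) : ¬ member.wa a := by
  simp [member, wa]

/-- Compare the result of `member` with what a clique requires. -/
def compare : Prog :=
  .minus 38 31 33 ;; .minus 39 33 31 ;; .plus 38 38 39 ;;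
  .branch 38 (.const 39 0 ;; .plus 39 39 36) (.const 39 1 ;; .minus 39 39 36) ;;
  .minus 38 40 39 ;; .minus 39 39 40 ;; .plus 30 30 38 ;; .plus 30 30 39

/-- Count in `reg 30` the violations of the conditions for a clique. -/
def clique : Prog :=
  .const 30 0 ;; forUp 31 3 (forUp 33 3 (.const 35 2 ;; forUp 36 35 (member ;; compare)))

theorem wr_clique {x : ℕ} (h : clique.wr x) : 30 ≤ x ∧ x < 102 := by
  simp only [clique, compare, wr, wr_forUp] at h
  by_cases hl : member.wr x
  · have := wr_member hl
    omega
  · simp only [hl, false_or] at h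
    omega

@[simp] theorem wa_clique (a : ℕ) : ¬ clique.wa a := by
  simp [clique, compare, wa]

end Prog

/-- A time bound for scanning. -/
def scanTime (m s Z Y : ℕ) : ℕ :=
  m * (12 * (5 * 3 ^ m) + 12 * Z + 12 * Y + 10 * s + 10 * m + 100 + 4) + 10

/-- A step takes a stack `S` to at most `3 * S + 8`, hence `S + 4` to at most `3 * (S + 4)`. The
initial mode is at most `1`, which gives the bound `5 * 3 ^ t`; the divisions by repeated
subtraction thus cost a function of the parameters only. -/
theorem wp_scan {ts : List Tok} {Z Y : ℕ} {σ : RamState} (hT : Tables ts σ) (hQ : 2 ≤ σ.reg 4)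
    (hμ : σ.reg 36 < 2) (hZ : σ.reg 41 ≤ Z) (hY : σ.reg 10 ≤ Y) :
    WP .scan (scanTime ts.length (σ.reg 3) Z Y) (fun τ =>
      (τ.reg 47 ≠ 0 ∧ τ.reg 46 = 0) ↔ scanAccepts ts (σ.reg 36) (σ.reg 41) (σ.word (σ.reg 10)))
      σ := by
  unfold scanTime
  refine WP.const_bind (WP.plus_bind (WP.const_bind (WP.plus_bind (WP.const_bind (WP.plus_bind
    (WP.const_bind ((WP.forUp (n := ts.length) (N := ts.length)
      (T := 12 * (5 * 3 ^ ts.length) + 12 * Z + 12 * Y + 10 * σ.reg 3 + 10 * ts.length + 100)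
      (fun t τ => ((τ.reg 47 ≠ 0 ∧ scanAccepts (ts.drop t) (τ.reg 44) (τ.reg 45)
          (σ.word (τ.reg 46))) ↔
          scanAccepts ts (σ.reg 36) (σ.reg 41) (σ.word (σ.reg 10))) ∧
        τ.reg 44 + 4 ≤ 5 * 3 ^ t ∧ τ.reg 45 ≤ Z ∧ τ.reg 46 ≤ Y)
      ?_ le_rfl (by omega) ?_ ?_ ?_ ?_ ?_).time (by omega))))))))
  · simp [hT.size]
  · exact ⟨fun h => absurd (Prog.wr_scanStep h) (by omega),
      fun h => absurd (Prog.wr_scanStep h) (by omega)⟩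
  · rintro j τ τ' ⟨h, -⟩
    rw [h 44 (by omega) (by omega), h 45 (by omega) (by omega), h 46 (by omega) (by omega),
      h 47 (by omega) (by omega)]
    exact id
  · simp [hZ, hY]
    omega
  · rintro t ht τ hf h48 ⟨hacc, hS, hz, hy⟩
    have hr : ∀ x, x < 44 → τ.reg x = σ.reg x := by
      intro x hx
      rw [hf.1 x (by
        rw [Prog.wr_forUp]
        rintro (h | h | h)
        · omega
        · omega
        · have := Prog.wr_scanStep h; omega)]
      simp [show x ≠ 44 by omega, show x ≠ 45 by omega, show x ≠ 46 by omega,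
        show x ≠ 47 by omega]
    have ha : τ.arr = σ.arr := funext fun a => hf.2 a (by simp)
    have hw : τ.word = σ.word := by
      unfold RamState.word
      rw [hr 3 (by omega), hr 4 (by omega), hr 31 (by omega), hr 33 (by omega), ha]
    have hpow : 3 ^ t ≤ 3 ^ ts.length := Nat.pow_le_pow_right (by norm_num) ht.le
    refine (wp_scanStep (ts := ts) (B := 5 * 3 ^ ts.length) (Z := Z) (Y := Y)
      (hT.of_eq (by simp [hr]) (by simp [ha])) (by omega) (by rw [hr 4 (by omega)]; exact hQ)
      (by omega) hz hy).mono ?_ ?_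
    · rw [hr 3 (by omega)]
    rintro τ' ⟨hacc', hS', hz', hy'⟩
    rw [hw, h48] at hacc'
    refine ⟨hacc'.trans hacc, ?_, by omega, by omega⟩
    rw [pow_succ]; omega
  -- The word is used up exactly if no digits are left, that is, if register `46` is `0`.
  · rintro τ hf ⟨hacc, -, -, -⟩
    rw [← hacc, List.drop_length]
    simp only [scanAccepts, RamState.word, repWord, List.map_eq_nil_iff,
      Nat.digits_eq_nil_iff_eq_zero]

theorem foldN_exists (P : ℕ → Prop) [DecidablePred P] (n : ℕ) :
    foldN (fun j v => if P j then 1 else v) n 0 = if ∃ j < n, P j then 1 else 0 := by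
  induction n with
  | zero => simp [foldN]
  | succ n ih =>
    rw [foldN, ih]
    by_cases h : P n
    · rw [if_pos h, if_pos ⟨n, by omega, h⟩]
    · rw [if_neg h]
      congr 1
      refine propext ⟨fun ⟨j, hj, hp⟩ => ⟨j, by omega, hp⟩, fun ⟨j, hj, hp⟩ => ⟨j, ?_, hp⟩⟩
      rcases Nat.lt_succ_iff_lt_or_eq.1 hj with hj | rfl
      exacts [hj, absurd hp h]

/-- A time bound for the search over all choices. -/
def memberTime (m s Y : ℕ) : ℕ := 2 ^ m * (scanTime m s (2 ^ m) Y + 6 + 4) + 10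

open Classical in
theorem wp_member {ts : List Tok} {Y : ℕ} {σ : RamState} (hT : Tables ts σ) (hQ : 2 ≤ σ.reg 4)
    (hμ : σ.reg 36 < 2) (h14 : σ.reg 14 = 2 ^ ts.length) (hY : σ.reg 10 ≤ Y) :
    WP .member (memberTime ts.length (σ.reg 3) Y) (fun τ =>
      τ.reg 40 = if Accepts ts (σ.reg 36) (σ.word (σ.reg 10)) then 1 else 0) σ := by
  unfold memberTime
  have hnw : ∀ x, x < 44 → ¬ Prog.scan.wr x := fun x hx h => by
    have := Prog.wr_scan h; omega
  refine WP.const_bind ((WP.forUp_fold (x := 40) (n := 2 ^ ts.length) (N := 2 ^ ts.length)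
    (T := scanTime ts.length (σ.reg 3) (2 ^ ts.length) Y + 6)
    (fun z v => if scanAccepts ts (σ.reg 36) z (σ.word (σ.reg 10)) then 1 else v)
    (fun _ => True) (by simp [h14]) le_rfl (by omega) ?_ (by omega) trivial
    (fun _ _ _ _ => trivial) ?_ ?_).time (by omega))
  · simp [Prog.wr, hnw]
  · rintro z hz τ hf h41 -
    have hr : ∀ x, x < 40 → τ.reg x = σ.reg x := by
      intro x hx
      rw [hf.1 x (by
        simp only [Prog.wr_forUp, Prog.wr, hnw x (by omega), false_or, or_false]; omega)]
      simp [show x ≠ 40 by omega]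
    have ha : τ.arr = σ.arr := funext fun a => hf.2 a (by simp [Prog.wa])
    have hw : τ.word = σ.word := by
      unfold RamState.word
      rw [hr 3 (by omega), hr 4 (by omega), hr 31 (by omega), hr 33 (by omega), ha]
    have hwp := wp_scan (ts := ts) (σ := τ) (Z := 2 ^ ts.length) (Y := Y)
      (hT.of_eq (by simp [hr]) (by simp [ha])) (by rw [hr 4 (by omega)]; exact hQ)
      (by rw [hr 36 (by omega)]; exact hμ) (by omega)
      (by rw [hr 10 (by omega)]; exact hY)
    rw [hr 3 (by omega)] at hwp
    refine hwp.frame.bind ?_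
    · rintro τ₁ ⟨hacc, hf₁⟩
      have h40 : τ₁.reg 40 = τ.reg 40 :=
        hf₁.1 40 fun h => absurd (Prog.wr_scan h) (by omega)
      rw [hw, h41, hr 36 (by omega), hr 10 (by omega)] at hacc
      rw [← hacc]
      refine WP.branch_end (fun h₁ => WP.branch_end (fun h₂ => WP.skip_end ?_)
        (fun h₂ => WP.const_end ?_)) (fun h₁ => WP.skip_end ?_)
      · simp [h₂, h40]
      · simp [h₁, h₂]
      · simp [h₁, h40]
  · rintro τ hf h -
    rw [h]
    simp only [RamState.reg_setReg, if_true]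
    rw [foldN_exists]
    unfold Accepts
    congr

/-- A time bound for the clique test. -/
def cliqueTime (m s Y : ℕ) : ℕ := s * (s * (2 * (memberTime m s Y + 20) + 20) + 20) + 20

-- After the branch register `39` holds the verdict required of a clique: `μ` if the rows have
-- different numbers, `1 - μ` otherwise. The two truncated differences add `1` exactly if the actual
-- verdict differs from it.
open Classical in
theorem wp_compare {σ : RamState} {p : Prop} (hμ : σ.reg 36 < 2)
    (h40 : σ.reg 40 = if p then 1 else 0) :
    WP .compare 16 (fun τ => τ.reg 30 = σ.reg 30 +
      if p ↔ (if σ.reg 36 = 1 then σ.reg 31 ≠ σ.reg 33 else σ.reg 31 = σ.reg 33) then 0 else 1)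
      σ := by
  refine WP.minus_bind (WP.minus_bind (WP.plus_bind (WP.bind (T₁ := 4)
    (R := fun τ => τ.reg 39 = (if (if σ.reg 36 = 1 then σ.reg 31 ≠ σ.reg 33 else
      σ.reg 31 = σ.reg 33) then 1 else 0) ∧ τ.reg 40 = σ.reg 40 ∧ τ.reg 30 = σ.reg 30)
    (WP.branch_end (fun h => WP.const_bind (WP.plus_end ?_))
      fun h => WP.const_bind (WP.minus_end ?_)) ?_)))
  · simp at h
    simp
    split_ifs <;> omega
  · simp at h
    simp
    split_ifs <;> omega
  · rintro τ ⟨h39, h40', h30⟩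
    refine WP.minus_bind (WP.minus_bind (WP.plus_bind (WP.plus_end ?_)))
    simp [h39, h40', h40, h30, -ite_not]
    split_ifs <;> simp_all

open Classical in
theorem wp_clique {ts : List Tok} {Y : ℕ} {σ : RamState} (hT : Tables ts σ) (hQ : 2 ≤ σ.reg 4)
    (h14 : σ.reg 14 = 2 ^ ts.length) (hY : σ.reg 10 ≤ Y) :
    WP .clique (cliqueTime ts.length (σ.reg 3) Y) (fun τ => τ.reg 30 = 0 ↔
      IsClique ts (σ.reg 3) (repWord (σ.reg 3) (σ.reg 4) (σ.arr 9) (σ.reg 10))) σ := by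
  unfold cliqueTime
  set d : ℕ → ℕ → ℕ → ℕ := fun i i' μ =>
    if Accepts ts μ (repWord (σ.reg 3) (σ.reg 4) (σ.arr 9) (σ.reg 10) i i') ↔
      (if μ = 1 then i ≠ i' else i = i') then 0 else 1 with hd
  have hnw : ∀ x, x < 40 → ¬ Prog.member.wr x := fun x hx h => by
    have := Prog.wr_member h; omega
  refine WP.const_bind ((WP.forUp_fold (x := 30) (n := σ.reg 3) (N := σ.reg 3)
    (T := σ.reg 3 * (2 * (memberTime ts.length (σ.reg 3) Y + 20) + 8 + 4) + 3)
    (fun i => foldN (fun i' => foldN (fun μ v => v + d i i' μ) 2) (σ.reg 3))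
    (fun _ => True) (by simp) le_rfl (by omega) ?_ (by omega) trivial
    (fun _ _ _ _ => trivial) ?_ ?_).time ?_)
  · simp [Prog.compare, Prog.wr, hnw]
  · intro i hi τ hf h31 _
    have hr : ∀ x, x < 30 → τ.reg x = σ.reg x := by
      intro x hx
      rw [hf.1 x (by
        simp only [Prog.wr_forUp, Prog.compare, Prog.wr, hnw x (by omega), false_or]; omega)]
      simp [show x ≠ 30 by omega]
    have ha : τ.arr = σ.arr := funext fun a => hf.2 a (by simp [Prog.compare, Prog.wa])
    refine WP.forUp_fold (x := 30) (n := σ.reg 3) (N := σ.reg 3)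
      (T := 2 * (memberTime ts.length (σ.reg 3) Y + 20) + 8)
      (fun i' => foldN (fun μ v => v + d i i' μ) 2)
      (fun _ => True) (hr 3 (by omega)) le_rfl (by omega) ?_ (by omega) trivial
      (fun _ _ _ _ => trivial) ?_ (fun _ _ h _ => h)
    · simp [Prog.compare, Prog.wr, hnw]
    intro i' hi' τ₁ hf₁ h33 _
    have hr₁ : ∀ x, x < 33 → x ≠ 30 → τ₁.reg x = τ.reg x := by
      intro x hx hx'
      rw [hf₁.1 x (by
        simp only [Prog.wr_forUp, Prog.compare, Prog.wr, hnw x (by omega), false_or]; omega)]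
    have ha₁ : τ₁.arr = σ.arr := by
      rw [← ha]
      exact funext fun a => hf₁.2 a (by simp [Prog.compare, Prog.wa])
    refine WP.const_bind ((WP.forUp_fold (x := 30) (n := 2) (N := 2)
      (T := memberTime ts.length (σ.reg 3) Y + 16)
      (fun μ v => v + d i i' μ)
      (fun _ => True) (by simp) le_rfl (by omega) ?_ (by omega) trivial
      (fun _ _ _ _ => trivial) ?_ ?_).time (by omega))
    · simp [Prog.compare, Prog.wr, hnw]
    · intro μ hμ τ₂ hf₂ h36 _
      have hr₂ : ∀ x, x < 35 → x ≠ 30 → τ₂.reg x = τ₁.reg x := by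
        intro x hx hx'
        rw [hf₂.1 x (by
          simp only [Prog.wr_forUp, Prog.compare, Prog.wr, hnw x (by omega), false_or]; omega)]
        simp [show x ≠ 35 by omega]
      have ha₂ : τ₂.arr = σ.arr := by
        rw [← ha₁]
        exact funext fun a => hf₂.2 a (by simp [Prog.compare, Prog.wa])
      have hr' : ∀ x, x < 30 → τ₂.reg x = σ.reg x := fun x hx => by
        rw [hr₂ x (by omega) (by omega), hr₁ x (by omega) (by omega), hr x hx]
      have e31 : τ₂.reg 31 = i := by
        rw [hr₂ 31 (by omega) (by omega), hr₁ 31 (by omega) (by omega), h31]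
      have e33 : τ₂.reg 33 = i' := by
        rw [hr₂ 33 (by omega) (by omega), h33]
      refine ((wp_member (ts := ts) (Y := Y) (hT.of_eq (by simp [hr']) (by simp [ha₂]))
        (by simpa [hr'] using hQ) (by omega) (by simpa [hr'] using h14)
        (by simpa [hr'] using hY)).frame.bind ?_ ?_)
      · rintro τ₃ ⟨h40, hf₃⟩
        have hr₃ : ∀ x, x < 40 → τ₃.reg x = τ₂.reg x := fun x hx => hf₃.1 x (hnw x hx)
        refine (wp_compare (by rw [hr₃ 36 (by omega)]; omega) h40).mono ?_ ?_
        · rw [hr' 3 (by omega)]; omega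
        intro τ₄ h
        rw [h, hr₃ 30 (by omega), hr₃ 31 (by omega), hr₃ 33 (by omega), hr₃ 36 (by omega), e31,
          e33, h36, hd]
        simp only [RamState.word, hr' 3 (by omega), hr' 4 (by omega), hr' 10 (by omega), ha₂,
          e31, e33]
      · rw [hr' 3 (by omega)]; omega
    · intro τ₂ _ h _
      rw [h]; simp
  · intro τ hf h _
    -- The nested loops sum up the violations, and a sum of natural numbers vanishes iff every term
    -- does.
    have : foldN (fun i => foldN (fun i' => foldN (fun μ v => v + d i i' μ) 2) (σ.reg 3))
        (σ.reg 3) 0 = ∑ i ∈ Finset.range (σ.reg 3), ∑ i' ∈ Finset.range (σ.reg 3),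
          ∑ μ ∈ Finset.range 2, d i i' μ := by
      rw [foldN_congr (fun i _ v => (foldN_congr (fun i' _ v => foldN_add (d i i') 2 v) v).trans
        (foldN_add _ _ v)) 0, foldN_add, zero_add]
    rw [h]
    simp only [RamState.reg_setReg, if_true]
    rw [this]
    simp only [Finset.sum_eq_zero_iff, Finset.mem_range, IsClique, hd]
    refine forall₂_congr fun i _ => forall₂_congr fun i' _ => forall₂_congr fun μ _ => ?_
    simp
  · have : σ.reg 3 * (2 * (memberTime ts.length (σ.reg 3) Y + 20) + 8 + 4) ≤
      σ.reg 3 * (2 * (memberTime ts.length (σ.reg 3) Y + 20) + 20) :=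
      Nat.mul_le_mul_left _ (by omega)
    have := Nat.mul_le_mul_left (σ.reg 3) (show σ.reg 3 * (2 * (memberTime ts.length (σ.reg 3) Y
      + 20) + 8 + 4) + 3 + 4 ≤ σ.reg 3 * (2 * (memberTime ts.length (σ.reg 3) Y + 20) + 20) + 20
      by omega)
    omega

/-! ### The sum over all sequences of signatures -/

namespace Prog

/-- `reg 12 := reg 4 ^ reg 1` and `reg 14 := 2 ^ reg 1`. -/
def powers : Prog :=
  .const 12 1 ;; forUp 10 1 (.const 13 0 ;; mulAdd 14 4 13 12 ;; .const 12 0 ;; .plus 12 12 14) ;;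
  .const 14 1 ;; forUp 16 1 (.plus 14 14 14)

/-- `reg 13` is set to the product of the entries of array `8` at the digits of `reg 10` in base
`reg 4`. -/
def digitProd : Prog :=
  .const 13 1 ;; .const 15 0 ;; .plus 15 15 10 ;; forUp 16 1 (.branch 15
    (divMod 20 15 4 ;; .load 25 8 21 ;; .const 26 0 ;; mulAdd 27 25 26 13 ;; .const 13 0 ;;
      .plus 13 13 27 ;; .const 15 0 ;; .plus 15 15 20) .skip)

/-- Add up in `reg 0` the number of copies for each sequence of signatures. -/
def total : Prog :=
  powers ;; .const 0 0 ;; forUp 10 12 (digitProd ;; clique ;; .branch 30 .skip (.plus 0 0 13))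

end Prog

theorem foldN_mul (k n v : ℕ) : foldN (fun _ a => k * a) n v = k ^ n * v := by
  induction n with
  | zero => simp [foldN]
  | succ n ih => rw [foldN, ih]; ring

theorem wp_powers {m Y : ℕ} {σ : RamState} (hm : σ.reg 1 = m) (hY : σ.reg 4 ≤ Y) :
    WP .powers (m * (5 * Y + 16 + 4) + m * 5 + 20) (fun τ => τ.reg 12 = σ.reg 4 ^ m ∧
      τ.reg 14 = 2 ^ m) σ := by
  refine WP.const_bind (WP.bind (T₁ := m * (5 * Y + 16 + 4) + 3)
    (R := fun τ => τ.reg 12 = σ.reg 4 ^ m ∧ τ.reg 1 = m)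
    (WP.forUp_fold (x := 12) (n := m) (N := m) (fun _ v => σ.reg 4 * v) (fun _ => True)
      (by simp [hm]) le_rfl (by omega) ?_ (by omega) trivial (fun _ _ _ _ => trivial) ?_
      fun τ hf h _ => ⟨?_, ?_⟩) ?_ (by omega))
  · simp [Prog.wr]
  · rintro j hj τ hf hi -
    have h4 : τ.reg 4 = σ.reg 4 := by rw [hf.1 4 (by simp [Prog.wr])]; simp
    refine WP.const_bind ((wp_mulAdd (N := Y) (by omega) (by simpa [h4] using hY)).bind ?_)
    rintro τ₁ ⟨h14, -⟩
    refine WP.const_bind (WP.plus_end ?_)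
    simp [h14, h4]
  · simp [h, foldN_mul]
  · rw [hf.1 1 (by simp [Prog.wr])]
    simpa
  · rintro τ ⟨h12, h1⟩
    refine WP.const_bind ((WP.forUp_fold (x := 14) (n := m) (N := m) (T := 1)
      (fun _ v => 2 * v) (fun _ => True) (by simp [h1]) le_rfl (by omega) (by simp [Prog.wr])
      (by omega) trivial (fun _ _ _ _ => trivial) (fun j hj τ hf hi _ => WP.plus_end ?_)
      fun τ hf h _ => ⟨?_, ?_⟩).time (by omega))
    · simp; ring
    · rw [hf.1 12 (by simp [Prog.wr])]
      simp [h12]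
    · simp [h, foldN_mul]

/-- The product so far, times the product over the digits still present, stays constant; `m` rounds
exhaust a number below `Q ^ m`. A column count, at most `M`, is the number of additions in each
multiplication. -/
theorem wp_digitProd {m Y M : ℕ} {σ : RamState} (hm : σ.reg 1 = m) (hQ : 2 ≤ σ.reg 4)
    (hy : σ.reg 10 < σ.reg 4 ^ m) (hY : σ.reg 10 ≤ Y) (hM : ∀ d, σ.arr 8 d ≤ M) :
    WP .digitProd (m * (12 * Y + 5 * M + 26 + 4) + 10) (fun τ =>
      τ.reg 13 = ((Nat.digits (σ.reg 4) (σ.reg 10)).map (σ.arr 8)).prod) σ := by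
  refine WP.const_bind (WP.const_bind (WP.plus_bind ((WP.forUp (n := m) (N := m)
    (T := 12 * Y + 5 * M + 26) (fun j τ =>
      τ.reg 13 * ((Nat.digits (σ.reg 4) (τ.reg 15)).map (σ.arr 8)).prod =
        ((Nat.digits (σ.reg 4) (σ.reg 10)).map (σ.arr 8)).prod ∧
      τ.reg 15 < σ.reg 4 ^ (m - j) ∧ τ.reg 15 ≤ Y)
    (by simp [hm]) le_rfl (by omega) (by simp [Prog.wr]) ?_ ?_ ?_ ?_).time (by omega))))
  · rintro j τ τ' ⟨h, -⟩
    rw [h 13 (by omega) (by omega), h 15 (by omega) (by omega)]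
    exact id
  · simp [hy, hY]
  · rintro j hj τ hf - ⟨hp, hlt, hle⟩
    have h4 : τ.reg 4 = σ.reg 4 := by rw [hf.1 4 (by simp [Prog.wr])]; simp
    have ha : τ.arr 8 = σ.arr 8 := by rw [hf.2 8 (by simp [Prog.wa])]; simp
    refine WP.branch_end (fun h => ?_) (fun h => WP.skip_end ⟨hp, ?_, hle⟩)
    · refine (wp_divMod (N := Y) (by omega) (by omega) hle).bind ?_
      rintro τ₁ ⟨h20, h21, hr₁, ha₁⟩
      refine WP.load_bind (WP.const_bind ((wp_mulAdd (N := M) (by omega)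
        (by simp [ha₁, ha, hM])).bind ?_))
      rintro τ₂ ⟨h27, hr₂, -⟩
      refine WP.const_bind (WP.plus_bind (WP.const_bind (WP.plus_end ?_)))
      simp [hr₂, h27, h20, h21, hr₁, ha₁, ha, h4]
      refine ⟨?_, ?_, (Nat.div_le_self _ _).trans hle⟩
      · rw [← hp, Nat.digits_def' (b := σ.reg 4) (n := τ.reg 15) (by omega) (by omega)]
        simp only [List.map_cons, List.prod_cons]
        ring
      · rw [Nat.div_lt_iff_lt_mul (by omega), ← pow_succ, show m - (j + 1) + 1 = m - j by omega]
        exact hlt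
    · rw [h]; exact Nat.pow_pos (by omega)
  · rintro τ - ⟨hp, hlt, -⟩
    have h0 : τ.reg 15 = 0 := by simpa using hlt
    simpa [h0] using hp

/-- A time bound for the final summation. -/
def totalTime (m s q M : ℕ) : ℕ :=
  m * (5 * q + 16 + 4) + m * 5 +
    q ^ m * (m * (12 * q ^ m + 5 * M + 26 + 4) + cliqueTime m s (q ^ m) + 26 + 4) + 30

open Classical in
theorem wp_total {ts : List Tok} {q M : ℕ} {σ : RamState} (hT : Tables ts σ) (hQ : 2 ≤ σ.reg 4)
    (hq : σ.reg 4 ≤ q) (hM : ∀ d, σ.arr 8 d ≤ M) :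
    WP .total (totalTime ts.length (σ.reg 3) q M) (fun τ => τ.reg 0 =
      ∑ y ∈ Finset.range (σ.reg 4 ^ ts.length),
        if IsClique ts (σ.reg 3) (repWord (σ.reg 3) (σ.reg 4) (σ.arr 9) y) then
          ((Nat.digits (σ.reg 4) y).map (σ.arr 8)).prod else 0) σ := by
  unfold totalTime
  have hnw : ∀ x, x < 30 → ¬ Prog.clique.wr x := fun x hx h => by
    have := Prog.wr_clique h; omega
  refine (wp_powers hT.size hq).frame.bind ?_
  rintro τ₁ ⟨⟨h12, h14⟩, hf₁⟩
  have hr₁ : ∀ x, x < 10 → τ₁.reg x = σ.reg x := fun x hx =>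
    hf₁.1 x (by simp [Prog.powers, Prog.wr]; omega)
  have ha₁ : τ₁.arr = σ.arr := funext fun a => hf₁.2 a (by simp [Prog.powers, Prog.wa])
  have hpow : σ.reg 4 ^ ts.length ≤ q ^ ts.length := Nat.pow_le_pow_left hq _
  refine WP.const_bind ((WP.forUp_fold (x := 0) (n := σ.reg 4 ^ ts.length) (N := q ^ ts.length)
    (T := ts.length * (12 * q ^ ts.length + 5 * M + 26 + 4) +
      cliqueTime ts.length (σ.reg 3) (q ^ ts.length) + 26)
    (fun y v => v + if IsClique ts (σ.reg 3) (repWord (σ.reg 3) (σ.reg 4) (σ.arr 9) y) then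
          ((Nat.digits (σ.reg 4) y).map (σ.arr 8)).prod else 0) (fun _ => True)
    (by simp [h12]) hpow (by omega) (by simp [Prog.wr, Prog.digitProd, hnw]) (by omega) trivial
    (fun _ _ _ _ => trivial) ?_ ?_).time (by omega))
  · rintro y hy τ hf h10 -
    have hr : ∀ x, 0 < x → (x < 10 ∨ x = 14) → τ.reg x = τ₁.reg x := fun x hx hx' => by
      rw [hf.1 x (by
        simp only [Prog.wr_forUp, Prog.digitProd, Prog.wr, hnw x (by omega), Prog.wr_divMod,
          Prog.wr_mulAdd, false_or, or_false]; omega)]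
      simp [show x ≠ 0 by omega]
    have ha : τ.arr = σ.arr := by
      rw [← ha₁]
      exact funext fun a => hf.2 a (by simp [Prog.wa, Prog.digitProd])
    have h3 : τ.reg 3 = σ.reg 3 := by rw [hr 3 (by omega) (by omega), hr₁ 3 (by omega)]
    have h4 : τ.reg 4 = σ.reg 4 := by rw [hr 4 (by omega) (by omega), hr₁ 4 (by omega)]
    have h1 : τ.reg 1 = σ.reg 1 := by rw [hr 1 (by omega) (by omega), hr₁ 1 (by omega)]
    have h14' : τ.reg 14 = 2 ^ ts.length := by rw [hr 14 (by omega) (by omega), h14]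
    refine (wp_digitProd (m := ts.length) (Y := q ^ ts.length) (M := M) (h1.trans hT.size)
      (by omega) (by rw [h4, h10]; exact hy) (by omega) (by rw [ha]; exact hM)).frame.bind ?_
    rintro τ₂ ⟨h13, hf₂⟩
    have hr₂ : ∀ x, x < 13 ∨ x = 14 → τ₂.reg x = τ.reg x := fun x hx =>
      hf₂.1 x (by simp [Prog.digitProd, Prog.wr]; omega)
    have ha₂ : τ₂.arr = σ.arr := by
      rw [← ha]
      exact funext fun a => hf₂.2 a (by simp [Prog.digitProd, Prog.wa])
    have hwp := wp_clique (ts := ts) (σ := τ₂) (Y := q ^ ts.length)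
      (hT.of_eq (by rw [hr₂ 1 (by omega), h1]) (by simp [ha₂]))
      (by rw [hr₂ 4 (by omega), h4]; exact hQ) (by rw [hr₂ 14 (by omega), h14'])
      (by rw [hr₂ 10 (by omega), h10]; omega)
    rw [hr₂ 3 (by omega), hr₂ 4 (by omega), hr₂ 10 (by omega), h10, h3, h4, ha₂] at hwp
    refine hwp.frame.bind ?_
    rintro τ₃ ⟨h30, hf₃⟩
    have hr₃ : ∀ x, x < 30 → τ₃.reg x = τ₂.reg x := fun x hx => hf₃.1 x (hnw x hx)
    rw [ha, h4, h10] at h13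
    refine WP.branch_end (fun h => WP.skip_end ?_) (fun h => WP.plus_end ?_)
    · rw [if_neg (fun hc => h (h30.2 hc)), hr₃ 0 (by omega), hr₂ 0 (by omega), add_zero]
    · rw [if_pos (h30.1 h)]
      simp [hr₃, hr₂, h13]
  · intro τ _ h _
    rw [h, foldN_add]
    simp

/-! ### Enumerating the columns -/

namespace Prog

/-- `reg 39 :=` the signature of the column in array `7`. -/
def signature : Prog :=
  .const 39 1 ;; forUp 40 1 (forUp 42 3 (.load 50 7 42 ;; forUp 44 3 (.load 51 7 44 ;;
    .const 52 2 ;; forUp 46 52 (lookup 40 46 50 51 ;; .plus 39 39 39 ;; .plus 39 39 90))))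

theorem wr_signature {x : ℕ} (h : signature.wr x) : 39 ≤ x ∧ x < 102 := by
  simp only [signature, wr, wr_forUp] at h
  by_cases hl : (lookup 40 46 50 51).wr x
  · have := wr_lookup hl
    omega
  · simp only [hl, false_or] at h
    omega

@[simp] theorem wa_signature (a : ℕ) : ¬ signature.wa a := by
  simp [signature, wa]

/-- Count the column in array `7`, whose signature is `reg 39`, and store it as a representative
of its signature; keep `reg 4` above all signatures. -/
def record : Prog :=
  .load 30 8 39 ;; .const 31 1 ;; .plus 30 30 31 ;; .store 8 39 30 ;; .plus 31 31 39 ;;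
  .minus 32 31 4 ;; .plus 4 4 32 ;;
  forUp 53 3 (mulAdd 55 3 53 39 ;; .load 58 7 53 ;; .store 9 55 58)

/-- Run through all columns with arbitrary labels in the first `d` places. -/
def columnLoops : ℕ → Prog
  | 0 => signature ;; record
  | d + 1 => forUp (200 + 2 * d) 2
      (.load 20 6 (200 + 2 * d) ;; .const 21 d ;; .store 7 21 20 ;; columnLoops d)

theorem wr_columnLoops {d x : ℕ} (h : (columnLoops d).wr x) :
    x = 4 ∨ (20 ≤ x ∧ x < 102) ∨ (200 ≤ x ∧ x < 200 + 2 * d) := by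
  induction d with
  | zero =>
    simp only [columnLoops, record, wr, wr_forUp, wr_mulAdd] at h
    by_cases hl : signature.wr x
    · have := wr_signature hl
      omega
    · simp only [hl, false_or, or_false] at h
      omega
  | succ d ih =>
    simp only [columnLoops, wr, wr_forUp] at h
    by_cases hl : (columnLoops d).wr x
    · have := ih hl
      omega
    · simp only [hl, or_false] at h
      omega

theorem wa_columnLoops {d a : ℕ} (h : (columnLoops d).wa a) : 7 ≤ a := by
  induction d with
  | zero => simp [columnLoops, record, wa] at h; omega
  | succ d ih =>
    simp only [columnLoops, wa, wa_forUp, false_or] at h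
    rcases h with rfl | h
    exacts [le_rfl, ih h]

end Prog

/-- A time bound for computing a signature. -/
def sigTime (m s : ℕ) : ℕ :=
  m * (s * (s * (2 * (10 * m + 32 + 4) + 5 + 4) + 4 + 4) + 3 + 4) + 4

theorem wp_signature {ts : List Tok} {σ : RamState} (hT : Tables ts σ) :
    WP .signature (sigTime ts.length (σ.reg 3)) (fun τ =>
      τ.reg 39 = sigOf ts (σ.reg 3) (σ.arr 7)) σ := by
  unfold sigTime
  have hnw : ∀ x, x < 90 → ¬ (Prog.lookup 40 46 50 51).wr x := fun x hx h => by
    have := Prog.wr_lookup h; omega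
  have key : ∀ {i lim : ℕ} {body : Prog} {ρ τ : RamState}, Frame (.forUp i lim body) ρ τ →
      (∀ a, ¬ body.wa a) → τ.arr = ρ.arr := fun h ha => funext fun a => h.2 a (by simpa using ha a)
  refine WP.const_bind ((WP.forUp_fold (x := 39) (n := ts.length) (N := ts.length)
    (T := σ.reg 3 * (σ.reg 3 * (2 * (10 * ts.length + 32 + 4) + 5 + 4) + 4 + 4) + 3)
    (fun t => foldN (fun i => foldN (fun i' => foldN (fun μ v =>
      v + v + bitVal (symb ts t) μ (σ.arr 7 i, σ.arr 7 i')) 2) (σ.reg 3)) (σ.reg 3))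
    (fun _ => True) (by simp [hT.size]) le_rfl (by omega) (by simp [Prog.wr, hnw]) (by omega)
    trivial (fun _ _ _ _ => trivial) ?_ ?_).time (by omega))
  · rintro t ht τ hf h40 -
    have hr : ∀ x, x < 39 → τ.reg x = σ.reg x := fun x hx => by
      rw [hf.1 x (by simp only [Prog.wr_forUp, Prog.wr, hnw x (by omega), false_or]; omega)]
      simp [show x ≠ 39 by omega]
    have ha : τ.arr = σ.arr := key (ρ := σ.setReg 39 1) hf (by simp [Prog.wa])
    refine WP.forUp_fold (x := 39) (n := σ.reg 3) (N := σ.reg 3)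
      (T := σ.reg 3 * (2 * (10 * ts.length + 32 + 4) + 5 + 4) + 4)
      (fun i => foldN (fun i' => foldN (fun μ v =>
        v + v + bitVal (symb ts t) μ (σ.arr 7 i, σ.arr 7 i')) 2) (σ.reg 3))
      (fun _ => True) (hr 3 (by omega)) le_rfl (by omega) (by simp [Prog.wr, hnw]) (by omega)
      trivial (fun _ _ _ _ => trivial) ?_ (fun τ _ h _ => h)
    rintro i hi τ₁ hf₁ h42 -
    have hr₁ : ∀ x, x < 42 → x ≠ 39 → τ₁.reg x = τ.reg x := fun x hx hx' => by
      rw [hf₁.1 x (by simp only [Prog.wr_forUp, Prog.wr, hnw x (by omega), false_or]; omega)]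
    have ha₁ : τ₁.arr = σ.arr := (key hf₁ (by simp [Prog.wa])).trans ha
    refine WP.load_bind ((WP.forUp_fold (x := 39) (n := σ.reg 3) (N := σ.reg 3)
      (T := 2 * (10 * ts.length + 32 + 4) + 5)
      (fun i' => foldN (fun μ v =>
        v + v + bitVal (symb ts t) μ (σ.arr 7 i, σ.arr 7 i')) 2)
      (fun _ => True) ?_ le_rfl (by omega) (by simp [Prog.wr, hnw]) (by omega)
      trivial (fun _ _ _ _ => trivial) ?_ (fun τ _ h _ => ?_)).time (by omega))
    · simp [hr₁, hr]
    · rintro i' hi' τ₂ hf₂ h44 -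
      have hr₂ : ∀ x, x < 43 → x ≠ 39 → τ₂.reg x = τ₁.reg x := fun x hx hx' => by
        rw [hf₂.1 x (by simp only [Prog.wr_forUp, Prog.wr, hnw x (by omega), false_or]; omega)]
        simp [show x ≠ 50 by omega]
      have h50 : τ₂.reg 50 = σ.arr 7 i := by
        rw [hf₂.1 50 (by simp [Prog.wr, hnw])]
        simp [ha₁, h42]
      have ha₂ : τ₂.arr = σ.arr := (key hf₂ (by simp [Prog.wa])).trans (by simpa using ha₁)
      refine WP.load_bind (WP.const_bind ((WP.forUp_fold (x := 39) (n := 2) (N := 2)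
        (T := 10 * ts.length + 32)
        (fun μ v => v + v + bitVal (symb ts t) μ (σ.arr 7 i, σ.arr 7 i'))
        (fun _ => True) (by simp) le_rfl (by omega) (by simp [Prog.wr, hnw]) (by omega)
        trivial (fun _ _ _ _ => trivial) ?_ (fun τ _ h _ => ?_)).time (by omega)))
      · rintro μ hμ τ₃ hf₃ h46 -
        have hr₃ : ∀ x, x < 46 → x ≠ 39 → τ₃.reg x = τ₂.reg x := fun x hx hx' => by
          rw [hf₃.1 x (by simp only [Prog.wr_forUp, Prog.wr, hnw x (by omega), false_or]; omega)]
          simp [show x ≠ 51 by omega, show x ≠ 52 by omega]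
        have e50 : τ₃.reg 50 = σ.arr 7 i := by
          rw [hf₃.1 50 (by simp [Prog.wr, hnw])]
          simpa using h50
        have e51 : τ₃.reg 51 = σ.arr 7 i' := by
          rw [hf₃.1 51 (by simp [Prog.wr, hnw])]
          simp [ha₂, h44]
        have ha₃ : τ₃.arr = σ.arr := (key hf₃ (by simp [Prog.wa])).trans (by simpa using ha₂)
        have e1 : τ₃.reg 1 = σ.reg 1 := by
          rw [hr₃ 1 (by omega) (by omega), hr₂ 1 (by omega) (by omega),
            hr₁ 1 (by omega) (by omega), hr 1 (by omega)]
        have e40 : τ₃.reg 40 = t := by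
          rw [hr₃ 40 (by omega) (by omega), hr₂ 40 (by omega) (by omega),
            hr₁ 40 (by omega) (by omega), h40]
        refine (wp_lookup (ts := ts) (by omega) (hT.of_eq e1 (by simp [ha₃])) (by omega)
          (by omega)).bind ?_
        rintro τ₄ ⟨h90, hr₄, -⟩
        rw [e40, e50, e51, h46] at h90
        refine WP.plus_bind (WP.plus_end ?_)
        simp [h90, hr₄]
      · simpa using h
    · simpa using h
  · rintro τ - h -
    rw [h]
    simp [sigOf]

/-- The numbers below `reg 4` are the signatures seen so far, with representatives in
array `9`. -/
def RepInv (ts : List Tok) (s : ℕ) (σ : RamState) : Prop :=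
  2 ≤ σ.reg 4 ∧ ∀ d, σ.arr 8 d ≠ 0 → d < σ.reg 4 ∧
    ∃ c, sigOf ts s c = d ∧ ∀ i < s, σ.arr 9 (i + s * d) = c i

theorem wp_record {ts : List Tok} {s : ℕ} {σ : RamState} (hs : σ.reg 3 = s)
    (hsig : σ.reg 39 = sigOf ts s (σ.arr 7)) (hR : RepInv ts s σ) :
    WP .record (s * (5 * s + 7 + 4) + 10) (fun τ =>
      (∀ e, τ.arr 8 e = σ.arr 8 e + if sigOf ts s (σ.arr 7) = e then 1 else 0) ∧
      τ.reg 4 ≤ max (σ.reg 4) (sigBound ts.length s) ∧ RepInv ts s τ) σ := by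
  refine WP.load_bind (WP.const_bind (WP.plus_bind (WP.store_bind (WP.plus_bind (WP.minus_bind
    (WP.plus_bind ((WP.forUp (n := s) (N := s) (T := 5 * s + 7) (fun j τ =>
      (∀ i < j, τ.arr 9 (i + s * σ.reg 39) = σ.arr 7 i) ∧
      ∀ p, (∀ i < s, p ≠ i + s * σ.reg 39) → τ.arr 9 p = σ.arr 9 p)
      (by simp [hs]) le_rfl (by omega) (by simp [Prog.wr]) ?_ ?_ ?_ ?_).time (by omega))))))))
  · rintro j τ τ' ⟨-, h⟩
    rw [h]
    exact id
  · simp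
  · rintro j hj τ hf h53 ⟨h₁, h₂⟩
    have h3 : τ.reg 3 = s := by rw [hf.1 3 (by simp [Prog.wr])]; simp [hs]
    have h39 : τ.reg 39 = σ.reg 39 := by rw [hf.1 39 (by simp [Prog.wr])]; simp
    have h7 : τ.arr 7 = σ.arr 7 := by rw [hf.2 7 (by simp [Prog.wa])]; simp
    refine (wp_mulAdd (N := s) (by omega) (by omega)).bind ?_
    rintro τ₁ ⟨h55, hr₁, ha₁⟩
    rw [h53, h3, h39] at h55
    refine WP.load_bind (WP.store_end ⟨?_, ?_⟩)
    · intro i hi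
      simp [Function.update_apply, h55, hr₁, h53, ha₁, h7]
      split_ifs with hij
      · rw [hij]
      · exact h₁ i (by omega)
    · intro p hp
      simp [h55, hr₁, h53, ha₁, hp j hj]
      exact h₂ p hp
  · rintro τ hf ⟨h₁, h₂⟩
    have h8 : τ.arr 8 = Function.update (σ.arr 8) (σ.reg 39) (σ.arr 8 (σ.reg 39) + 1) := by
      rw [hf.2 8 (by simp [Prog.wa])]; simp
    have h4 : τ.reg 4 = max (σ.reg 4) (σ.reg 39 + 1) := by
      rw [hf.1 4 (by simp [Prog.wr])]; simp; omega
    have hb := sigOf_bounds ts s (σ.arr 7)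
    rw [← hsig] at hb ⊢
    refine ⟨fun e => ?_, ?_, ?_, fun d hd => ?_⟩
    · rw [h8, Function.update_apply]
      by_cases he : e = σ.reg 39
      · simp [he]
      · simp [he, Ne.symm he]
    · omega
    · have := hR.1
      omega
    · by_cases he : d = σ.reg 39
      · subst he
        exact ⟨by omega, _, hsig.symm, h₁⟩
      · rw [h8, Function.update_of_ne he] at hd
        obtain ⟨h₃, c, hc, h₄⟩ := hR.2 d hd
        -- The representative of another signature is not overwritten: `i + s * d` determines `d`
        -- for `i < s`, by division by `s`.
        refine ⟨by omega, c, hc, fun i hi => ?_⟩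
        rw [h₂ _ fun i' hi' heq => he ?_, h₄ i hi]
        have := congrArg (· / s) heq
        simpa [Nat.add_mul_div_left _ _ (show 0 < s by omega), Nat.div_eq_of_lt hi,
          Nat.div_eq_of_lt hi'] using this

/-- The first `d` places are overwritten anyway, so what earlier rounds left there in array `7` is
irrelevant. -/
theorem columns_congr {U : Finset ℕ} {d : ℕ} {c c' : ℕ → ℕ} (h : ∀ i, d ≤ i → c i = c' i) :
    columns U d c = columns U d c' := by
  ext x
  rw [mem_columns, mem_columns]
  refine and_congr_right fun _ => forall₂_congr fun i hi => ?_
  rw [h i hi]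

/-- A time bound for running through all columns. -/
def columnTime (m s N : ℕ) : ℕ → ℕ
  | 0 => sigTime m s + (s * (5 * s + 7 + 4) + 10)
  | d + 1 => N * (columnTime m s N d + 3 + 4) + 3

/-- The cost of the innermost body does not involve `N`. Each further loop multiplies by `N` and
adds a small overhead, absorbed by `N + 1` and the summand `7 * d`. -/
theorem columnTime_le (m s N d : ℕ) :
    columnTime m s N d ≤ (columnTime m s 0 0 + 7 * d) * (N + 1) ^ d := by
  induction d with
  | zero => simp [columnTime]
  | succ d ih =>
    have h1 : 1 ≤ (N + 1) ^ d := Nat.one_le_pow _ _ (by omega)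
    calc columnTime m s N (d + 1) ≤ (N + 1) * (columnTime m s N d + 7) := by
          simp only [columnTime]; nlinarith
      _ ≤ (N + 1) * ((columnTime m s 0 0 + 7 * d) * (N + 1) ^ d + 7 * (N + 1) ^ d) :=
          Nat.mul_le_mul_left _ (by omega)
      _ = _ := by ring

/-- Induction on the depth, following `numCols_succ`: the outer loops have fixed the places from `d`
on. By `hu` the list of labels has no repetition, so no column is counted twice. -/
theorem wp_columnLoops {ts : List Tok} {s N : ℕ} {u : ℕ → ℕ} (hu : Set.InjOn u (Set.Iio N))
    (d : ℕ) : ∀ {σ : RamState}, Tables ts σ → σ.reg 3 = s → σ.reg 2 = N → σ.arr 6 = u →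
    RepInv ts s σ → WP (.columnLoops d) (columnTime ts.length s N d) (fun τ =>
      (∀ e, τ.arr 8 e = σ.arr 8 e + numCols ts s ((Finset.range N).image u) d (σ.arr 7) e) ∧
      (∀ i, d ≤ i → τ.arr 7 i = σ.arr 7 i) ∧
      τ.reg 4 ≤ max (σ.reg 4) (sigBound ts.length s) ∧ RepInv ts s τ) σ := by
  induction d with
  | zero =>
    intro σ hT hs hN hu' hR
    have hwp := wp_signature hT
    rw [hs] at hwp
    refine hwp.frame.bind ?_ (by simp [columnTime])
    rintro τ ⟨h39, hf⟩
    have hr : ∀ x, x < 39 → τ.reg x = σ.reg x := fun x hx => hf.1 x fun h => by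
      have := Prog.wr_signature h; omega
    have ha : τ.arr = σ.arr := funext fun a => hf.2 a (by simp)
    have hR' : RepInv ts s τ := by
      unfold RepInv
      rw [hr 4 (by omega), ha]
      exact hR
    refine (wp_record (ts := ts) (s := s) (by rw [hr 3 (by omega), hs]) (by rw [h39, ha])
      hR').frame.mono (by simp [columnTime]) ?_
    rintro τ' ⟨⟨h₁, h₂, h₃⟩, hf'⟩
    refine ⟨fun e => ?_, fun i _ => ?_, ?_, h₃⟩
    · rw [h₁, ha, numCols_zero]
    · rw [hf'.2 7 (by simp [Prog.record, Prog.wa]), ha]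
    · rwa [hr 4 (by omega)] at h₂
  | succ d ih =>
    intro σ hT hs hN hu' hR
    have hnw : ∀ x, x ≠ 4 → (x < 20 ∨ 200 + 2 * d ≤ x) → ¬ (Prog.columnLoops d).wr x :=
      fun x hx hx' h => by
        have := Prog.wr_columnLoops h; omega
    refine WP.forUp (n := N) (N := N) (T := columnTime ts.length s N d + 3) (fun j τ =>
      (∀ e, τ.arr 8 e = σ.arr 8 e + ∑ j' ∈ Finset.range j,
        numCols ts s ((Finset.range N).image u) d (Function.update (σ.arr 7) d (u j')) e) ∧
      (∀ i, d + 1 ≤ i → τ.arr 7 i = σ.arr 7 i) ∧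
      τ.reg 4 ≤ max (σ.reg 4) (sigBound ts.length s) ∧ RepInv ts s τ)
      hN le_rfl (by omega) ?_ ?_ ?_ ?_ ?_
    · simp only [Prog.wr, false_or, not_or]
      exact ⟨⟨by omega, by omega, hnw _ (by omega) (by omega)⟩,
        by omega, by omega, hnw _ (by omega) (by omega)⟩
    · rintro j τ τ' ⟨h, h'⟩
      unfold RepInv
      rw [h 4 (by omega) (by omega), h']
      exact id
    · refine ⟨fun e => by simp, fun i _ => rfl, by omega, hR⟩
    · rintro j hj τ hf hi ⟨h₁, h₂, h₃, h₄⟩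
      have hr : ∀ x, x < 4 → τ.reg x = σ.reg x := fun x hx => hf.1 x (by
        simp only [Prog.wr_forUp, Prog.wr, hnw x (by omega) (by omega), or_false]; omega)
      have ha : ∀ a, a < 7 → τ.arr a = σ.arr a := fun a ha => hf.2 a (by
        simp only [Prog.wa_forUp, Prog.wa, false_or]
        rintro (rfl | h)
        · omega
        · have := Prog.wa_columnLoops h; omega)
      refine WP.load_bind (WP.const_bind (WP.store_bind ((ih (σ := _) ?_ ?_ ?_ ?_ ?_).mono
        (by omega) ?_)))
      · refine hT.of_eq (by simp [hr]) fun a ha' => ?_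
        simp [show a ≠ 7 by omega, ha a (by omega)]
      · simp [hr, hs]
      · simp [hr, hN]
      · simp [ha, hu']
      · simpa [RepInv] using h₄
      · rintro τ' ⟨h₁', h₂', h₃', h₄'⟩
        simp [hi, ha 6 (by omega), hu'] at h₁' h₂' h₃'
        refine ⟨fun e => ?_, fun i hi' => ?_, by omega, h₄'⟩
        · rw [h₁', h₁, Finset.sum_range_succ, add_assoc]
          congr 2
          unfold numCols
          rw [columns_congr (c' := Function.update (σ.arr 7) d (u j))]
          intro i hi'
          by_cases hid : i = d
          · simp [hid]
          · rw [Function.update_of_ne hid, Function.update_of_ne hid, h₂ i (by omega)]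
        · rw [h₂' i (by omega), Function.update_of_ne (by omega), h₂ i hi']
    · rintro τ hf ⟨h₁, h₂, h₃, h₄⟩
      refine ⟨fun e => ?_, h₂, h₃, h₄⟩
      rw [h₁, numCols_succ, Finset.sum_image]
      intro x hx y hy h
      exact hu (by simpa using hx) (by simpa using hy) h

/-! ### Reading the input -/

/-- The array `a` contains the list `l` from position `o` on. -/
def Holds (a : ℕ → ℕ) (o : ℕ) (l : List ℕ) : Prop :=
  ∀ j (h : j < l.length), a (o + j) = l[j]

/-! ### Positions of the parts of an encoding. -/

theorem holds_append {a : ℕ → ℕ} {o : ℕ} {l l' : List ℕ} :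
    Holds a o (l ++ l') ↔ Holds a o l ∧ Holds a (o + l.length) l' := by
  constructor
  · intro h
    refine ⟨fun j hj => ?_, fun j hj => ?_⟩
    · rw [h j (by simp; omega), List.getElem_append_left]
    · rw [add_assoc, h (l.length + j) (by simp; omega), List.getElem_append_right (by omega)]
      simp
  · rintro ⟨h, h'⟩ j hj
    by_cases hl : j < l.length
    · rw [h j hl, List.getElem_append_left]
    · have := h' (j - l.length) (by simp at hj; omega)
      rw [List.getElem_append_right (by omega), ← this]
      congr 1
      omega

theorem holds_cons {a : ℕ → ℕ} {o x : ℕ} {l : List ℕ} :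
    Holds a o (x :: l) ↔ a o = x ∧ Holds a (o + 1) l := by
  rw [show x :: l = [x] ++ l from rfl, holds_append]
  simp [Holds]

theorem holds_ofFn {a : ℕ → ℕ} {o n : ℕ} {f : Fin n → ℕ} :
    Holds a o (List.ofFn f) ↔ ∀ i : Fin n, a (o + i) = f i := by
  constructor
  · intro h i
    rw [h i (by simp)]
    simp
  · intro h j hj
    have := h ⟨j, by simpa using hj⟩
    simp [this]

theorem flatten_ofFn_ofFn {m n : ℕ} (f : Fin m → Fin n → ℕ) :
    (List.ofFn fun i => List.ofFn fun j => f i j).flatten =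
      List.ofFn fun k : Fin (m * n) => f k.divNat k.modNat := by
  rw [List.ofFn_mul]
  congr 2
  funext i
  congr 1
  funext j
  have hn : 0 < n := by have := j.2; omega
  congr 1 <;> apply Fin.ext
  · simp [Fin.divNat, Nat.add_div_of_dvd_right, Nat.mul_div_cancel _ hn]
  · simp [Fin.modNat, Nat.mod_eq_of_lt]

theorem InputGraph.length_encode (G : InputGraph) :
    G.encode.length = 1 + G.size + G.size * G.size := by
  rw [encode, flatten_ofFn_ofFn]
  simp only [List.length_cons, List.length_append, List.length_ofFn]
  ring

theorem Holds.encode {a : ℕ → ℕ} {o : ℕ} {G : InputGraph} (h : Holds a o G.encode) :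
    a o = G.size ∧ (∀ i : Fin G.size, a (o + 1 + i) = G.label i) ∧
      ∀ i j : Fin G.size, a (o + 1 + G.size + i * G.size + j) = if G.adj i j then 1 else 0 := by
  rw [InputGraph.encode, flatten_ofFn_ofFn (f := fun i j => if G.adj i j then 1 else 0),
    holds_cons, holds_append, holds_ofFn, holds_ofFn] at h
  refine ⟨h.1, h.2.1, fun i j => ?_⟩
  have hn : 0 < G.size := by have := j.2; omega
  have hlt : i * G.size + j < G.size * G.size := by
    calc i * G.size + j < i * G.size + G.size := by omega
      _ = (i + 1) * G.size := by ring
      _ ≤ G.size * G.size := Nat.mul_le_mul_right _ i.2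
  have := h.2.2 ⟨i * G.size + j, hlt⟩
  rw [List.length_ofFn] at this
  rw [add_assoc _ (i * G.size : ℕ), this]
  congr 3
  · apply Fin.ext
    simp only [Fin.divNat]
    rw [mul_comm, Nat.mul_add_div hn, Nat.div_eq_of_lt j.2, add_zero]
  · apply Fin.ext
    simp only [Fin.modNat]
    rw [mul_comm, Nat.mul_add_mod, Nat.mod_eq_of_lt j.2]

/-- From index `M` on, the arrays `op` and `off` hold the codes of the symbols `ts` and the
positions of the input graphs in the input. -/
def Parsed (inp op off : ℕ → ℕ) : ℕ → List Tok → Prop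
  | _, [] => True
  | M, t :: ts => (op M = t.code ∧ ∀ G, t = .leaf G → Holds inp (off M) G.encode) ∧
      Parsed inp op off (M + 1) ts

theorem parsed_append {inp op off : ℕ → ℕ} {ts ts' : List Tok} : ∀ {M : ℕ},
    Parsed inp op off M (ts ++ ts') ↔
      Parsed inp op off M ts ∧ Parsed inp op off (M + ts.length) ts' := by
  induction ts with
  | nil => simp [Parsed]
  | cons t ts ih =>
    intro M
    simp only [List.cons_append, Parsed, ih, List.length_cons, and_assoc]
    rw [show M + (ts.length + 1) = M + 1 + ts.length by ring]

theorem Parsed.congr {inp op off op' off' : ℕ → ℕ} {ts : List Tok} : ∀ {M : ℕ},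
    Parsed inp op off M ts → (∀ p < M + ts.length, op' p = op p ∧ off' p = off p) →
    Parsed inp op' off' M ts := by
  induction ts with
  | nil => simp [Parsed]
  | cons t ts ih =>
    rintro M ⟨h₁, h₂⟩ h
    simp only [List.length_cons] at h
    refine ⟨?_, ih h₂ fun p hp => h p (by omega)⟩
    rw [(h M (by omega)).1, (h M (by omega)).2]
    exact h₁

theorem Parsed.symb {inp op off : ℕ → ℕ} {ts : List Tok} : ∀ {M : ℕ},
    Parsed inp op off M ts → ∀ t < ts.length, op (M + t) = (symb ts t).code ∧
      ∀ G, symb ts t = .leaf G → Holds inp (off (M + t)) G.encode := by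
  induction ts with
  | nil => simp
  | cons t ts ih =>
    rintro M ⟨h₁, h₂⟩ j hj
    cases j with
    | zero => exact h₁
    | succ j =>
      rw [show M + (j + 1) = M + 1 + j by ring]
      exact ih h₂ j (by simpa using hj)

namespace Prog

/-- Read one symbol. -/
def parseStep : Prog :=
  .load 12 0 10 ;; .const 14 1 ;; .plus 10 10 14 ;; .store 1 1 12 ;;
  .branch 12 (.plus 11 11 14)
    (.store 2 1 10 ;; .load 13 0 10 ;; .plus 10 10 14 ;; .plus 10 10 13 ;;
      forUp 15 13 (.plus 10 10 13) ;; .minus 11 11 14) ;;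
  .plus 1 1 14

/-- Split the formula into its symbols. -/
def parse : Prog :=
  .const 1 0 ;; .const 10 0 ;; .const 11 1 ;; .loop 11 parseStep

end Prog

/-- The state `τ` after reading the symbols `ts`, with encoding of length `l`, in the state `σ`. -/
structure HasRead (ts : List Tok) (l : ℕ) (σ τ : RamState) : Prop where
  pos : τ.reg 10 = σ.reg 10 + l
  size : τ.reg 1 = σ.reg 1 + ts.length
  inp : τ.arr 0 = σ.arr 0
  parsed : Parsed (τ.arr 0) (τ.arr 1) (τ.arr 2) (σ.reg 1) ts
  old : ∀ p < σ.reg 1, τ.arr 1 p = σ.arr 1 p ∧ τ.arr 2 p = σ.arr 2 p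

theorem HasRead.trans {ts ts' : List Tok} {l l' : ℕ} {ρ σ τ : RamState}
    (h : HasRead ts l ρ σ) (h' : HasRead ts' l' σ τ) : HasRead (ts ++ ts') (l + l') ρ τ where
  pos := by rw [h'.pos, h.pos, add_assoc]
  size := by rw [h'.size, h.size, List.length_append, add_assoc]
  inp := h'.inp.trans h.inp
  parsed := by
    refine parsed_append.2 ⟨?_, h.size ▸ h'.parsed⟩
    rw [h'.inp]
    exact h.parsed.congr fun p hp => h'.old p (by rw [h.size]; exact hp)
  old p hp := by
    have := h.size
    rw [(h'.old p (by omega)).1, (h'.old p (by omega)).2]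
    exact h.old p hp

/-- The adjacency matrix is not read but jumped over, by adding the number of vertices to the
position that many times. This keeps the time linear in `n`. -/
theorem wp_parseStep {t : Tok} {n : ℕ} {σ : RamState} (h : Holds (σ.arr 0) (σ.reg 10) t.encode)
    (hn : ∀ G, t = .leaf G → G.size ≤ n) :
    WP .parseStep (5 * n + 30) (fun τ => HasRead [t] t.encode.length σ τ ∧
      τ.reg 11 = (match t with | .leaf _ => σ.reg 11 - 1 | .op _ => σ.reg 11 + 1)) σ := by
  refine WP.load_bind (WP.const_bind (WP.plus_bind (WP.store_bind ?_)))
  cases t with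
  | op c =>
    have hc : σ.arr 0 (σ.reg 10) = c + 1 := by simpa [Holds, Tok.encode] using h
    refine WP.bind (T₁ := 2) (R := fun τ => τ = _)
      (WP.branch_end (fun _ => WP.plus_end rfl) (fun h0 => absurd h0 (by simp [hc]))) ?_
    rintro _ rfl
    refine WP.plus_end ⟨⟨?_, ?_, ?_, ?_, ?_⟩, ?_⟩
    · simp [Tok.encode]
    · simp
    · simp
    · refine ⟨⟨?_, by simp⟩, trivial⟩
      simp [hc, Tok.code]
    · intro p hp
      simp [Function.update_apply]
      omega
    · simp
  | leaf G =>
    have hh := h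
    rw [Tok.encode, holds_cons] at h
    obtain ⟨h0, hG⟩ := h
    have hsz := hG.encode.1
    have hnG := hn G rfl
    refine WP.bind (T₁ := 5 * n + 20) (R := fun τ => HasRead [.leaf G] (Tok.leaf G).encode.length
      σ (τ.setReg 1 (σ.reg 1 + 1)) ∧ τ.reg 1 = σ.reg 1 ∧ τ.reg 14 = 1 ∧
      τ.reg 11 = σ.reg 11 - 1)
      (WP.branch_end (fun hne => absurd h0 (by simpa using hne)) (fun _ => ?_)) ?_
    · refine WP.store_bind (WP.load_bind (WP.plus_bind (WP.plus_bind (WP.bind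
        (T₁ := n * (1 + 4) + 3)
        (R := ?_) (WP.forUp_fold (x := 10) (n := G.size) (N := n) (fun _ v => v + G.size)
          (fun _ => True) (by simp [hsz]) hnG (by omega) (by simp [Prog.wr]) (by omega)
          trivial (fun _ _ _ _ => trivial) ?_ ?_) ?_))))
      · exact fun τ => τ.reg 10 = σ.reg 10 + 2 + G.size + G.size * G.size ∧
          τ.reg 1 = σ.reg 1 ∧ τ.reg 14 = 1 ∧ τ.reg 11 = σ.reg 11 ∧
          τ.arr 0 = σ.arr 0 ∧
          τ.arr 1 = Function.update (σ.arr 1) (σ.reg 1) 0 ∧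
          τ.arr 2 = Function.update (σ.arr 2) (σ.reg 1) (σ.reg 10 + 1)
      · rintro j hj τ hf - -
        refine WP.plus_end ?_
        have : τ.reg 13 = G.size := by
          rw [hf.1 13 (by simp [Prog.wr])]
          simp [hsz]
        simp [this]
      · rintro τ hf hx -
        rw [foldN_add] at hx
        refine ⟨?_, ?_, ?_, ?_, ?_, ?_, ?_⟩
        · simp [hx, hsz]
        · rw [hf.1 1 (by simp [Prog.wr])]; simp
        · rw [hf.1 14 (by simp [Prog.wr])]; simp
        · rw [hf.1 11 (by simp [Prog.wr])]; simp
        · rw [hf.2 0 (by simp [Prog.wa])]; simp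
        · rw [hf.2 1 (by simp [Prog.wa])]; simp [h0]
        · rw [hf.2 2 (by simp [Prog.wa])]; simp
      · rintro τ ⟨h10, h1, h14, h11, ha0, ha1, ha2⟩
        refine WP.minus_end ⟨⟨?_, ?_, ?_, ?_, ?_⟩, ?_, ?_, ?_⟩
        · simp [h10, Tok.encode, G.length_encode]
          ring
        · simp
        · simp [ha0]
        · refine ⟨⟨?_, ?_⟩, trivial⟩
          · simp [ha1, Tok.code]
          · rintro _ ⟨⟩
            simpa [ha0, ha2] using hG
        · intro p hp
          simp [ha1, ha2, Function.update_apply]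
          omega
        · simp [h1]
        · simp [h14]
        · simp [h11, h14]
    · rintro τ ⟨h₁, h₂, h₃, h₄⟩
      refine WP.plus_end ?_
      rw [h₂, h₃]
      exact ⟨h₁, by simp [h₄]⟩

/-- The parsing loop reads the symbols `ts`, encoded by `l`, and lowers by one the number of
formulas that are still expected. -/
def Reads (n : ℕ) (ts : List Tok) (l : List ℕ) : Prop :=
  ∀ (P T : ℕ) (σ : RamState) (Q : RamState → Prop), Holds (σ.arr 0) (σ.reg 10) l →
    σ.reg 11 = P + 1 →
    (∀ τ, HasRead ts l.length σ τ → τ.reg 11 = P → WP (.loop 11 .parseStep) T Q τ) →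
    WP (.loop 11 .parseStep) (T + ts.length * (5 * n + 31)) Q σ

/-- Prefix notation needs no stack: an operation raises the number of expected formulas by one, an
input graph lowers it by one. The continuation form of `Reads` lets the two parts of a formula be
read one after the other within the same loop. -/
theorem reads_tokens (F : FactoredGraph) {n : ℕ} (hn : F.SizeLE n) :
    Reads n F.tokens F.encode := by
  have hop : ∀ (c : ℕ) (A B : FactoredGraph), Reads n A.tokens A.encode →
      Reads n B.tokens B.encode →
      Reads n (.op c :: (A.tokens ++ B.tokens)) ((c + 1) :: (A.encode ++ B.encode)) := by
    intro c A B ihA ihB P T σ Q h hP k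
    rw [show (c + 1) :: (A.encode ++ B.encode) = (Tok.op c).encode ++ (A.encode ++ B.encode)
      from rfl] at h k
    rw [holds_append, holds_append] at h
    refine (WP.loop_step (T₂ := T + B.tokens.length * (5 * n + 31) +
      A.tokens.length * (5 * n + 31)) (by omega)
      ((wp_parseStep (n := n) h.1 (by simp)).post ?_)).time ?_
    · rintro τ₁ ⟨h₁, hP₁⟩
      simp only at hP₁
      -- After the operation symbol `P + 2` formulas are expected, and `P + 1` once the left part
      -- has been read.
      refine ihA (P + 1) _ _ _ (by rw [h₁.inp, h₁.pos]; exact h.2.1) (by omega) ?_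
      intro τ₂ h₂ hP₂
      refine ihB P _ _ _ ?_ (by omega) ?_
      · rw [h₂.inp, h₁.inp, h₂.pos, h₁.pos]; exact h.2.2
      intro τ₃ h₃ hP₃
      refine k τ₃ ?_ hP₃
      have := h₁.trans (h₂.trans h₃)
      simpa only [List.length_append, List.cons_append, List.nil_append] using this
    · simp only [List.length_cons, List.length_append]
      ring_nf
      omega
  induction F with
  | leaf G =>
    intro P T σ Q h hP k
    refine (WP.loop_step (T₂ := T) (by omega)
      ((wp_parseStep (t := .leaf G) (n := n) h (by rintro _ ⟨⟩; exact hn)).post ?_)).time ?_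
    · rintro τ ⟨h₁, hP₁⟩
      simp only at hP₁
      exact k τ h₁ (by omega)
    · simp [FactoredGraph.tokens]
      omega
  | cartesian A B hA hB => exact hop 0 A B (hA hn.1) (hB hn.2)
  | tensor A B hA hB => exact hop 1 A B (hA hn.1) (hB hn.2)
  | union A B hA hB => exact hop 2 A B (hA hn.1) (hB hn.2)

theorem wp_parse (F : FactoredGraph) {n : ℕ} (hn : F.SizeLE n) :
    WP .parse (F.tokens.length * (5 * n + 31) + 4) (fun τ => τ.reg 1 = F.tokens.length ∧
      Parsed (τ.arr 0) (τ.arr 1) (τ.arr 2) 0 F.tokens) (RamState.start F.encode) := by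
  refine WP.const_bind (WP.const_bind (WP.const_bind ((reads_tokens F hn 0 1 _ _
    ?_ (by simp) ?_).time (by omega))))
  · intro j hj
    simp [RamState.start, hj]
  · intro τ h hP
    refine WP.loop_done hP ⟨?_, ?_⟩
    · simpa using h.size
    · simpa using h.parsed

/-! ### Setting up the tables -/

namespace Prog

/-- Enter the vertex number `reg 26` of the input graph of the symbol number `reg 20`. -/
def addVertex : Prog :=
  .load 29 0 28 ;; mulAdd 30 1 20 29 ;; .store 3 30 25 ;; .store 4 30 26 ;; .plus 25 25 24 ;;
  .const 34 1 ;; .plus 28 28 34 ;; .load 33 5 29 ;;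
  .branch 33 .skip (.store 5 29 34 ;; .store 6 2 29 ;; .plus 2 2 34)

/-- Enter all vertices of the input graph of the symbol number `reg 20`. -/
def addGraph : Prog :=
  .load 23 2 20 ;; .load 24 0 23 ;; .const 34 1 ;; .plus 28 23 34 ;; .plus 25 28 24 ;;
  forUp 26 24 addVertex

/-- Set up the tables and the list of labels. -/
def tables : Prog :=
  .const 2 0 ;; forUp 20 1 (.load 22 1 20 ;; .branch 22 .skip addGraph)

theorem wr_addVertex {x : ℕ} (h : addVertex.wr x) : x = 2 ∨ x = 25 ∨ (28 ≤ x ∧ x ≤ 34) := by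
  simp [addVertex, wr] at h; omega

theorem wa_addVertex {a : ℕ} (h : addVertex.wa a) : 3 ≤ a ∧ a ≤ 6 := by
  simp [addVertex, wa] at h; omega

theorem wr_addGraph {x : ℕ} (h : addGraph.wr x) : x = 2 ∨ (23 ≤ x ∧ x ≤ 34) := by
  simp only [addGraph, wr, wr_forUp] at h
  by_cases hl : addVertex.wr x
  · have := wr_addVertex hl
    omega
  · simp only [hl, or_false] at h
    omega

theorem wa_addGraph {a : ℕ} (h : addGraph.wa a) : 3 ≤ a ∧ a ≤ 6 := by
  simp only [addGraph, wa, wa_forUp, false_or] at h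
  exact wa_addVertex h

end Prog

/-- Array `6` lists without repetition `reg 2` labels, which are marked in array `5`. -/
def LabelInv (σ : RamState) : Prop :=
  Set.InjOn (σ.arr 6) (Set.Iio (σ.reg 2)) ∧
    ∀ l, σ.arr 5 l ≠ 0 ↔ ∃ j < σ.reg 2, σ.arr 6 j = l

theorem LabelInv.insert {σ τ : RamState} {l : ℕ} (h : LabelInv σ) (hl : σ.arr 5 l = 0)
    (h2 : τ.reg 2 = σ.reg 2 + 1) (h5 : τ.arr 5 = Function.update (σ.arr 5) l 1)
    (h6 : τ.arr 6 = Function.update (σ.arr 6) (σ.reg 2) l) : LabelInv τ := by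
  have hne : ∀ j < σ.reg 2, σ.arr 6 j ≠ l := fun j hj he => ((h.2 l).2 ⟨j, hj, he⟩) hl
  refine ⟨?_, fun l' => ?_⟩
  · rw [h2, h6]
    intro x hx y hy hxy
    rw [Set.mem_Iio] at hx hy
    simp only [Function.update_apply] at hxy
    split_ifs at hxy with h₁ h₂ h₂
    · rw [h₁, h₂]
    · exact absurd hxy.symm (hne y (by omega))
    · exact absurd hxy (hne x (by omega))
    · exact h.1 (by rw [Set.mem_Iio]; omega) (by rw [Set.mem_Iio]; omega) hxy
  · rw [h2, h5, h6]
    by_cases he : l' = l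
    · subst he
      simp only [Function.update_self, ne_eq, one_ne_zero, not_false_eq_true, true_iff]
      exact ⟨σ.reg 2, by omega, by simp⟩
    · rw [Function.update_of_ne he, h.2]
      constructor
      · rintro ⟨j, hj, hj'⟩
        exact ⟨j, by omega, by rw [Function.update_of_ne (by omega), hj']⟩
      · rintro ⟨j, hj, hj'⟩
        by_cases hj2 : j = σ.reg 2
        · subst hj2
          rw [Function.update_self] at hj'
          exact absurd hj'.symm he
        · rw [Function.update_of_ne hj2] at hj'
          exact ⟨j, by omega, hj'⟩

/-- The labels of the first `i` vertices of `G` are entered, beyond the state `σ`. -/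
structure Entered (m t : ℕ) (G : InputGraph) (i : ℕ) (σ τ : RamState) : Prop where
  cell : ∀ l, Cell (τ.arr 0) (τ.arr 3) (τ.arr 4) G i (t + m * l) l
  old : ∀ p, (∀ l, p ≠ t + m * l) → τ.arr 3 p = σ.arr 3 p ∧ τ.arr 4 p = σ.arr 4 p
  labels : LabelInv τ
  keep : ∀ l, σ.arr 5 l ≠ 0 → τ.arr 5 l ≠ 0
  marked : ∀ j : Fin G.size, (j : ℕ) < i → τ.arr 5 (G.label j) ≠ 0
  card : τ.reg 2 ≤ σ.reg 2 + i

theorem wp_addVertex {m t i o : ℕ} {G : InputGraph} {σ ρ : RamState} (hi : i < G.size)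
    (hG : Holds (σ.arr 0) o G.encode) (hE : Entered m t G i ρ σ) (hm : σ.reg 1 = m)
    (hm0 : 0 < m) (ht : σ.reg 20 = t) (h24 : σ.reg 24 = G.size) (h26 : σ.reg 26 = i)
    (h25 : σ.reg 25 = o + 1 + G.size + i * G.size) (h28 : σ.reg 28 = o + 1 + i) :
    WP .addVertex (5 * m + 22) (fun τ => Entered m t G (i + 1) ρ τ ∧
      τ.reg 25 = o + 1 + G.size + (i + 1) * G.size ∧ τ.reg 28 = o + 1 + (i + 1)) σ := by
  obtain ⟨-, hlab, hadj⟩ := hG.encode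
  set a := G.label ⟨i, hi⟩ with ha
  have hla : σ.arr 0 (o + 1 + i) = a := hlab ⟨i, hi⟩
  refine WP.load_bind ((wp_mulAdd (N := m) (by omega) (by simp [hm])).bind ?_)
  rintro τ₁ ⟨h30, hr₁, ha₁⟩
  simp [ht, hm, h28, hla] at h30
  have h29 : τ₁.reg 29 = a := by rw [hr₁ 29 (by omega)]; simp [h28, hla]
  have hr : ∀ x, x < 29 → τ₁.reg x = σ.reg x := fun x hx => by
    rw [hr₁ x (by omega), RamState.reg_setReg, if_neg (by omega)]
  rw [RamState.arr_setReg] at ha₁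
  -- The table entry is the same whether or not the label has occurred before; the final branch
  -- concerns only the list of labels.
  have key : ∀ τ : RamState, τ.arr 0 = σ.arr 0 →
      τ.arr 3 = Function.update (σ.arr 3) (t + m * a) (σ.reg 25) →
      τ.arr 4 = Function.update (σ.arr 4) (t + m * a) i →
      (∀ l, Cell (τ.arr 0) (τ.arr 3) (τ.arr 4) G (i + 1) (t + m * l) l) ∧
      ∀ p, (∀ l, p ≠ t + m * l) → τ.arr 3 p = ρ.arr 3 p ∧ τ.arr 4 p = ρ.arr 4 p := by
    intro τ e0 e3 e4
    constructor
    · intro l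
      rw [e0, e3, e4]
      by_cases hl : l = a
      · subst hl
        simp only [Cell, Function.update_self]
        refine ⟨fun i' hi' he => ?_, fun h => absurd rfl (h ⟨i, hi⟩ (by simp))⟩
        obtain rfl := G.label_injective (he.trans ha)
        exact ⟨by omega, rfl, fun j => by rw [h25]; exact hadj ⟨i, hi⟩ j⟩
      -- Since `m` is positive, different labels have different table indices.
      · have hne : t + m * l ≠ t + m * a := fun h =>
          hl (Nat.eq_of_mul_eq_mul_left hm0 (by omega))
        obtain ⟨h₁, h₂⟩ := hE.cell l
        simp only [Cell, Function.update_of_ne hne]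
        refine ⟨fun i' hi' he => h₁ i' ?_ he, fun h => h₂ fun i' hi' => h i' (by omega)⟩
        by_contra hc
        refine hl ?_
        rw [← he, ha]
        congr 1
        apply Fin.ext
        simp only
        omega
    · intro p hp
      rw [e3, e4, Function.update_of_ne (hp a), Function.update_of_ne (hp a)]
      exact hE.old p hp
  have hmark : ∀ τ : RamState, (∀ l, σ.arr 5 l ≠ 0 → τ.arr 5 l ≠ 0) → τ.arr 5 a ≠ 0 →
      ∀ j : Fin G.size, (j : ℕ) < i + 1 → τ.arr 5 (G.label j) ≠ 0 := by
    intro τ h h' j hj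
    rcases Nat.lt_succ_iff_lt_or_eq.1 hj with hj | hj
    · exact h _ (hE.marked j hj)
    · rwa [show j = ⟨i, hi⟩ from Fin.ext hj]
  have hcard := hE.card
  refine WP.store_bind (WP.store_bind (WP.plus_bind (WP.const_bind (WP.plus_bind (WP.load_bind
    (WP.branch_end (fun h₁ => WP.skip_end ?_) (fun h₁ => WP.store_bind (WP.store_bind
      (WP.plus_end ?_)))))))))
  · simp [ha₁, h29] at h₁
    obtain ⟨k₁, k₂⟩ := key ((τ₁.setArr 3 (τ₁.reg 30) (τ₁.reg 25)).setArr 4 (τ₁.reg 30)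
      (τ₁.reg 26)) (by simp [ha₁]) (by simp [ha₁, h30, hr]) (by simp [ha₁, h30, hr, h26])
    refine ⟨⟨?_, ?_, ?_, ?_, ?_, ?_⟩, ?_, ?_⟩
    · simpa using k₁
    · simpa using k₂
    · simpa [LabelInv, ha₁, hr] using hE.labels
    · simpa [ha₁] using hE.keep
    · refine hmark _ ?_ ?_
      · simp [ha₁]
      · simpa [ha₁] using h₁
    · simp [hr]; omega
    · simp [hr, h24, h25]; ring
    · simp [hr, h28]; ring
  · simp [ha₁, h29] at h₁
    obtain ⟨k₁, k₂⟩ := key ((τ₁.setArr 3 (τ₁.reg 30) (τ₁.reg 25)).setArr 4 (τ₁.reg 30)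
      (τ₁.reg 26)) (by simp [ha₁]) (by simp [ha₁, h30, hr]) (by simp [ha₁, h30, hr, h26])
    have hkeep : ∀ l, σ.arr 5 l ≠ 0 → Function.update (σ.arr 5) a 1 l ≠ 0 := by
      intro l hl
      rw [Function.update_apply]
      split_ifs
      exacts [one_ne_zero, hl]
    refine ⟨⟨?_, ?_, ?_, ?_, ?_, ?_⟩, ?_, ?_⟩
    · simpa using k₁
    · simpa using k₂
    · exact hE.labels.insert h₁ (by simp [hr]) (by simp [ha₁, h29]) (by simp [ha₁, h29, hr])
    · intro l hl
      have := hkeep l (hE.keep l hl)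
      simpa [ha₁, h29] using this
    · refine hmark _ ?_ ?_
      · intro l hl
        have := hkeep l hl
        simpa [ha₁, h29] using this
      · simp [h29]
    · simp [hr]; omega
    · simp [hr, h24, h25]; ring
    · simp [hr, h28]; ring

theorem wp_addGraph {m t n : ℕ} {G : InputGraph} {σ : RamState} (hn : G.size ≤ n)
    (hG : Holds (σ.arr 0) (σ.arr 2 t) G.encode) (hL : LabelInv σ) (hm : σ.reg 1 = m)
    (hm0 : 0 < m) (ht : σ.reg 20 = t) (h0 : ∀ l, σ.arr 3 (t + m * l) = 0) :
    WP .addGraph (n * (5 * m + 22 + 4) + 10) (fun τ => Entered m t G G.size σ τ) σ := by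
  have hsz := hG.encode.1
  have hnw : ∀ x, (x < 25 ∧ x ≠ 2 ∨ x = 26) → ¬ Prog.addVertex.wr x := fun x hx h => by
    have := Prog.wr_addVertex h; omega
  have hna : ∀ a, a < 3 → ¬ Prog.addVertex.wa a := fun a ha h => by
    have := Prog.wa_addVertex h; omega
  refine WP.load_bind (WP.load_bind (WP.const_bind (WP.plus_bind (WP.plus_bind ((WP.forUp
    (n := G.size) (N := n) (T := 5 * m + 22) (fun i τ => Entered m t G i σ τ ∧
      τ.reg 25 = σ.arr 2 t + 1 + G.size + i * G.size ∧ τ.reg 28 = σ.arr 2 t + 1 + i)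
    ?_ hn (by omega) ⟨hnw _ (by omega), hnw _ (by omega)⟩ ?_ ?_ ?_ ?_).time (by omega))))))
  · simp [ht, hsz]
  · rintro j τ τ' ⟨hr, ha⟩ ⟨hE, h25, h28⟩
    have h2 := hr 2 (by omega) (by omega)
    refine ⟨⟨?_, ?_, ?_, ?_, ?_, ?_⟩, ?_, ?_⟩
    · rw [ha]; exact hE.cell
    · rw [ha]; exact hE.old
    · unfold LabelInv; rw [ha, h2]; exact hE.labels
    · rw [ha]; exact hE.keep
    · rw [ha]; exact hE.marked
    · rw [h2]; exact hE.card
    · rw [hr 25 (by omega) (by omega), h25]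
    · rw [hr 28 (by omega) (by omega), h28]
  · refine ⟨⟨fun l => ⟨by simp, fun _ => by simpa using h0 l⟩, by simp, ?_, by simp, by simp,
      by simp⟩, ?_, ?_⟩
    · simpa [LabelInv] using hL
    · simp [ht, hsz]
    · simp [ht]
  · rintro j hj τ hf h26 ⟨hE, h25, h28⟩
    have hr : ∀ x, (x < 23 ∧ x ≠ 2 ∨ x = 24) → τ.reg x = if x = 24 then G.size else σ.reg x := by
      intro x hx
      rw [hf.1 x (by simp only [Prog.wr_forUp, hnw x (by omega), or_false]; omega)]
      rcases hx with hx | rfl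
      · simp [show x ≠ 23 by omega, show x ≠ 24 by omega, show x ≠ 25 by omega,
          show x ≠ 28 by omega, show x ≠ 34 by omega]
      · simp [ht, hsz]
    refine wp_addVertex (o := σ.arr 2 t) hj ?_ hE ?_ hm0 ?_ ?_ h26 h25 h28
    · rw [hf.2 0 (by simpa using hna 0 (by omega))]
      simpa using hG
    · simp [hr, hm]
    · simp [hr, ht]
    · simp [hr]
  · rintro τ - ⟨hE, -, -⟩
    exact hE

theorem wp_tables {ts : List Tok} {n : ℕ} {σ : RamState} (hm : σ.reg 1 = ts.length)
    (hP : Parsed (σ.arr 0) (σ.arr 1) (σ.arr 2) 0 ts)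
    (hn : ∀ G, Tok.leaf G ∈ ts → G.size ≤ n) (h3 : ∀ p, σ.arr 3 p = 0)
    (h5 : ∀ p, σ.arr 5 p = 0) :
    WP .tables (ts.length * (n * (5 * ts.length + 22 + 4) + 12 + 4) + 4) (fun τ => Tables ts τ ∧
      Set.InjOn (τ.arr 6) (Set.Iio (τ.reg 2)) ∧ τ.reg 2 ≤ ts.length * n ∧
      ∀ G, Tok.leaf G ∈ ts → ∀ i, ∃ j < τ.reg 2, τ.arr 6 j = G.label i) σ := by
  have hnw : ∀ x, (x < 23 ∧ x ≠ 2) → ¬ Prog.addGraph.wr x := fun x hx h => by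
    have := Prog.wr_addGraph h; omega
  have hna : ∀ a, a < 3 → ¬ Prog.addGraph.wa a := fun a ha h => by
    have := Prog.wa_addGraph h; omega
  have hsymb : ∀ t < ts.length, symb ts t ∈ ts := fun t ht => by
    rw [symb, List.getD_eq_getElem _ _ ht]
    exact List.getElem_mem ht
  have hPs : ∀ t < ts.length, _ := fun t ht => hP.symb t ht
  simp only [zero_add] at hPs
  -- The rows of symbols not yet processed are still `0`: this is the correct entry for an operation
  -- and the starting point for an input graph.
  refine WP.const_bind ((WP.forUp (n := ts.length) (N := ts.length)
    (T := n * (5 * ts.length + 22 + 4) + 12)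
    (fun t τ => (∀ t' < ts.length, ∀ l, if t' < t then Entry (τ.arr 0) (τ.arr 3) (τ.arr 4)
        (t' + ts.length * l) l (symb ts t') else τ.arr 3 (t' + ts.length * l) = 0) ∧
      LabelInv τ ∧ (∀ t' < ts.length, t' < t → ∀ G, symb ts t' = .leaf G → ∀ i,
        τ.arr 5 (G.label i) ≠ 0) ∧ τ.reg 2 ≤ t * n)
    (by simp [hm]) le_rfl (by omega) ?_ ?_ ?_ ?_ ?_).time (by omega))
  · simp [Prog.wr, hnw]
  · rintro j τ τ' ⟨hr, ha⟩
    unfold LabelInv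
    rw [hr 2 (by omega) (by omega), ha]
    exact id
  · refine ⟨fun t' _ l => by simp [h3], ⟨by simp, by simp [h5]⟩, by simp, by simp⟩
  · rintro t ht τ hf h20 ⟨hE, hL, hM, hc⟩
    have h1 : τ.reg 1 = ts.length := by
      rw [hf.1 1 (by simp [Prog.wr, hnw])]; simpa using hm
    have ha : ∀ a, a < 3 → τ.arr a = σ.arr a := fun a ha' => by
      rw [hf.2 a (by simp [Prog.wa, hna a ha'])]; rfl
    obtain ⟨hcode, hG⟩ := hPs t ht
    have hmul : (t + 1) * n = t * n + n := by ring
    refine WP.load_bind (WP.branch_end (fun h => WP.skip_end ?_) (fun h => ?_))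
    · simp [h20, ha 1 (by omega), hcode] at h
      cases hs : symb ts t with
      | leaf G => simp [hs, Tok.code] at h
      | op c =>
        refine ⟨fun t' ht' l => ?_, by simpa [LabelInv] using hL, fun t' ht' htt G hG' => ?_, ?_⟩
        · have := hE t' ht' l
          rcases Nat.lt_trichotomy t' t with h' | rfl | h'
          · rw [if_pos (by omega)]
            rw [if_pos h'] at this
            simpa using this
          · rw [if_neg (by omega)] at this
            rw [if_pos (by omega), hs]
            simpa [Entry] using this
          · rw [if_neg (by omega)]
            rw [if_neg (by omega)] at this
            simpa using this
        · rcases Nat.lt_succ_iff_lt_or_eq.1 htt with h' | rfl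
          · simpa using hM t' ht' h' G hG'
          · rw [hs] at hG'; cases hG'
        · simp; omega
    · simp [h20, ha 1 (by omega), hcode] at h
      cases hs : symb ts t with
      | op c => simp [hs, Tok.code] at h
      | leaf G =>
        have hGn := hn G (hs ▸ hsymb t ht)
        refine (wp_addGraph (m := ts.length) (t := t) (n := n) (G := G) hGn ?_ ?_ ?_
          (by omega) ?_ ?_).frame.mono (by omega) ?_
        · simpa [ha] using hG G hs
        · simpa [LabelInv] using hL
        · simp [h1]
        · simp [h20]
        · intro l
          have := hE t ht l
          rw [if_neg (by omega)] at this
          simpa using this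
        rintro τ' ⟨hEn, hf'⟩
        have ha0 : τ'.arr 0 = τ.arr 0 := by rw [hf'.2 0 (hna 0 (by omega))]; rfl
        have hcd := hEn.card
        simp at hcd
        refine ⟨fun t' ht' l => ?_, hEn.labels, fun t' ht' htt G' hG' i => ?_, by omega⟩
        · have := hE t' ht' l
          -- The table index modulo `m` is the number of the symbol, so the tables of different
          -- symbols do not overlap.
          have hold : t' ≠ t → _ := fun hne => hEn.old (t' + ts.length * l) fun l' he => hne (by
            have := congrArg (· % ts.length) he
            simpa [Nat.mod_eq_of_lt ht, Nat.mod_eq_of_lt ht'] using this)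
          simp only [RamState.arr_setReg] at hold
          rcases Nat.lt_trichotomy t' t with h' | rfl | h'
          · rw [if_pos (by omega)]
            rw [if_pos h'] at this
            obtain ⟨o₃, o₄⟩ := hold (by omega)
            cases hs' : symb ts t' with
            | op c => rw [hs'] at this; exact o₃.trans this
            | leaf G' =>
              rw [hs'] at this
              simpa only [Entry, Cell, o₃, o₄, ha0] using this
          · rw [if_pos (by omega), hs]
            exact hEn.cell l
          · rw [if_neg (by omega)]
            rw [if_neg (by omega)] at this
            rw [(hold (by omega)).1, this]
        · rcases Nat.lt_succ_iff_lt_or_eq.1 htt with h' | rfl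
          · exact hEn.keep _ (by simpa using hM t' ht' h' G' hG' i)
          · rw [hs] at hG'
            cases hG'
            exact hEn.marked i i.2
  · rintro τ hf ⟨hE, hL, hM, hc⟩
    have h1 : τ.reg 1 = ts.length := by
      rw [hf.1 1 (by simp [Prog.wr, hnw])]; simpa using hm
    have ha1 : τ.arr 1 = σ.arr 1 := by
      rw [hf.2 1 (by simp [Prog.wa, hna])]; rfl
    refine ⟨⟨h1, fun t ht => ?_, fun t ht l => ?_⟩, hL.1, hc, fun G hG i => ?_⟩
    · rw [ha1]; exact (hPs t ht).1
    · have := hE t ht l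
      rwa [if_pos ht] at this
    · obtain ⟨t, ht, rfl'⟩ := List.getElem_of_mem hG
      exact (hL.2 _).1 (hM t ht ht G (by rw [symb, List.getD_eq_getElem _ _ ht, rfl']) i)

/-! ### The algorithm -/

namespace FactoredGraph

theorem SizeLE.size_le {F : FactoredGraph} {n : ℕ} (h : F.SizeLE n) {G : InputGraph}
    (hG : Tok.leaf G ∈ F.tokens) : G.size ≤ n := by
  induction F with
  | leaf G' =>
    simp only [tokens, List.mem_singleton, Tok.leaf.injEq] at hG
    exact hG ▸ h
  | cartesian A B hA hB | tensor A B hA hB | union A B hA hB =>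
    simp only [tokens, List.mem_cons, List.mem_append, reduceCtorEq, false_or] at hG
    exact hG.elim (hA h.1) (hB h.2)

/-- There is exactly one copy of the empty graph. -/
theorem countCopies_of_fin_zero (H : SimpleGraph (Fin 0)) (F : FactoredGraph) :
    F.countCopies H = 1 := by
  have h : F.toUGraph.exactCopies H = Set.univ := Set.eq_univ_of_forall fun a =>
    ⟨fun i => i.elim0, fun i => i.elim0, fun i => i.elim0⟩
  rw [countCopies, h, Set.ncard_univ, Nat.card_unique]

end FactoredGraph

/-- Count the ordered cliques of size `s`. -/
def Prog.cliques (s : ℕ) : Prog :=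
  parse ;; tables ;; .const 3 s ;; .const 4 2 ;; columnLoops s ;; total

/-- `totalTime` is linear in the bound for the counts, so only the terms without it leave a
difference, which is exhibited in the proof. -/
theorem totalTime_mul_le (m s q M : ℕ) {P : ℕ} (hP : 1 ≤ P) :
    totalTime m s q (M * P) ≤ totalTime m s q M * P := by
  obtain ⟨P, rfl⟩ := Nat.exists_eq_add_of_le' hP
  unfold totalTime
  generalize q ^ m = Y
  generalize cliqueTime m s Y = c
  refine le_of_le_of_eq (Nat.le_add_right _
    (P * (m * (5 * q + 20) + m * 5 + Y * (m * (12 * Y + 30) + c + 30) + 30))) ?_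
  ring

/-- The factor of `n ^ s` in the time for counting the cliques of size `s` in a formula with `m`
symbols whose input graphs have at most `n` vertices. -/
def cliquesTime (m s : ℕ) : ℕ :=
  m * 36 + m * (5 * m + 42) + 10 + (columnTime m s 0 0 + 7 * s) * (m + 1) ^ s +
    totalTime m s (max 2 (sigBound m s)) (m ^ s)

/-- Powers of `m * n` and of `N + 1 ≤ (m + 1) * n` yield the factor `n ^ s`; the linear cost of
reading the input is absorbed because `n ≤ n ^ s` for `s ≥ 1`. -/
theorem time_le_cliquesTime {m s n N : ℕ} (hs : 1 ≤ s) (hn : 1 ≤ n) (hN : N ≤ m * n) :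
    m * (5 * n + 31) + 4 + (m * (n * (5 * m + 22 + 4) + 12 + 4) + 4 + (1 + (1 +
      (columnTime m s N s + totalTime m s (max 2 (sigBound m s)) ((m * n) ^ s))))) ≤
    cliquesTime m s * n ^ s := by
  have h1 : 1 ≤ n ^ s := Nat.one_le_pow _ _ hn
  have h2 : n ≤ n ^ s := Nat.le_self_pow (by omega) n
  have h3 := totalTime_mul_le m s (max 2 (sigBound m s)) (m ^ s) h1
  rw [← mul_pow] at h3
  have h4 : (N + 1) ^ s ≤ (m + 1) ^ s * n ^ s := by
    rw [← mul_pow]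
    exact Nat.pow_le_pow_left (by rw [add_mul]; omega) s
  have h5 := (columnTime_le m s N s).trans (Nat.mul_le_mul_left _ h4)
  have h6 : m * (5 * n + 31) ≤ m * 36 * n ^ s := by
    rw [mul_assoc]
    exact Nat.mul_le_mul_left _ (by omega)
  have h7 : m * (n * (5 * m + 22 + 4) + 12 + 4) ≤ m * (5 * m + 42) * n ^ s := by
    rw [mul_assoc]
    refine Nat.mul_le_mul_left _ ?_
    calc n * (5 * m + 22 + 4) + 12 + 4 ≤ n ^ s * (5 * m + 22 + 4) + 16 * n ^ s := by
          have := Nat.mul_le_mul_right (5 * m + 22 + 4) h2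
          omega
      _ = (5 * m + 42) * n ^ s := by ring
  unfold cliquesTime
  simp only [add_mul]
  rw [← mul_assoc] at h5
  simp only [add_mul] at h5 h7
  omega

theorem wp_cliques {s : ℕ} (hs : 1 ≤ s) (F : FactoredGraph) {n : ℕ} (hn : 1 ≤ n)
    (hF : F.SizeLE n) :
    WP (.cliques s) (cliquesTime F.tokens.length s * n ^ s)
      (fun τ => τ.reg 0 = F.countCopies (⊤ : SimpleGraph (Fin s))) (.start F.encode) := by
  classical
  have hnp : ∀ a, 3 ≤ a → ¬ Prog.parse.wa a := fun a ha => by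
    simp [Prog.parse, Prog.parseStep, Prog.wa]; omega
  have hnt : ∀ a, 7 ≤ a → ¬ Prog.tables.wa a := fun a ha h => by
    simp only [Prog.tables, Prog.wa, Prog.wa_forUp, false_or] at h
    have := Prog.wa_addGraph h
    omega
  obtain ⟨t₁, τ₁, e₁, b₁, ⟨h1, hP⟩, -, ha₁⟩ := (wp_parse F hF).frame
  have hz₁ : ∀ a, 3 ≤ a → τ₁.arr a = fun _ => 0 := fun a ha => by
    rw [ha₁ a (hnp a ha)]
    funext i
    simp [RamState.start, show a ≠ 0 by omega]
  obtain ⟨t₂, τ₂, e₂, b₂, ⟨hT, hinj, hN, hlab⟩, -, ha₂⟩ :=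
    (wp_tables h1 hP (fun G hG => hF.size_le hG) (by simp [hz₁]) (by simp [hz₁])).frame
  -- The enumeration starts from the zero column and from zero counts.
  have hz₂ : ∀ a, 7 ≤ a → τ₂.arr a = fun _ => 0 := fun a ha => by
    rw [ha₂ a (hnt a ha), hz₁ a (by omega)]
  set σ := (τ₂.setReg 3 s).setReg 4 2 with hσ
  set U := (Finset.range (τ₂.reg 2)).image (τ₂.arr 6) with hU
  have hR : RepInv F.tokens s σ := ⟨by simp [hσ], by simp [hσ, hz₂]⟩
  obtain ⟨t₃, τ₃, e₃, b₃, ⟨h8, -, h4, hR₃⟩, hr₃, ha₃⟩ :=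
    (wp_columnLoops (σ := σ) (s := s) hinj s (hT.of_eq (by simp [hσ]) (by simp [hσ]))
      (by simp [hσ]) (by simp [hσ]) (by simp [hσ]) hR).frame
  have h8' : τ₃.arr 8 = numCols F.tokens s U s fun _ => 0 := by
    funext e
    rw [h8 e]
    simp [hσ, hz₂, hU]
  have hrr : ∀ x, x < 4 → τ₃.reg x = σ.reg x := fun x hx => hr₃ x fun h => by
    have := Prog.wr_columnLoops h
    omega
  have h3 : τ₃.reg 3 = s := by simp [hrr, hσ]
  have hT₃ : Tables F.tokens τ₃ := hT.of_eq (by simp [hrr, hσ]) fun a ha => by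
    rw [ha₃ a fun h => by have := Prog.wa_columnLoops h; omega]
    rfl
  have hcard : U.card ≤ F.tokens.length * n :=
    (Finset.card_image_le.trans (Finset.card_range _).le).trans hN
  obtain ⟨t₄, τ₄, e₄, b₄, h0⟩ := wp_total (q := max 2 (sigBound F.tokens.length s))
    (M := (F.tokens.length * n) ^ s) hT₃ hR₃.1 (by simpa [hσ] using h4) fun d => by
      rw [h8']
      exact (numCols_le _ _ _ _ _ _).trans (Nat.pow_le_pow_left hcard s)
  rw [h3] at b₄ h0
  refine ⟨_, _, .seq e₁ (.seq e₂ (.seq (.const _ _ _) (.seq (.const _ _ _) (.seq e₃ e₄)))),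
    le_trans ?_ (time_le_cliquesTime hs hn hN), ?_⟩
  · omega
  · refine h0.trans ?_
    rw [countCopies_top_eq F s hs U (fun G hG i => ?_) (τ₃.reg 4) hR₃.1 (τ₃.arr 9)
      (by rw [← h8']; exact hR₃.2), h8']
    obtain ⟨j, hj, hj'⟩ := hlab G hG i
    exact Finset.mem_image.2 ⟨j, Finset.mem_range.2 hj, hj'⟩

/-- Counting cliques in factored graphs takes time `O(n ^ s)` for formulas of fixed size. -/
theorem exists_solvesInTime_countCopies_top (s : ℕ) : ∃ (p : Prog) (g : ℕ → ℕ),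
    SolvesInTime p (FactoredGraph.countCopies (⊤ : SimpleGraph (Fin s)))
      fun n k => g k * n ^ s := by
  rcases Nat.eq_zero_or_pos s with rfl | hs
  -- For `s = 0` the bound leaves no time to read the input, but the answer is always `1`.
  · exact ⟨.const 0 1, fun _ => 1, fun F n k _ _ => ⟨_, _, .const _ _ _, by simp, by
      simp [F.countCopies_of_fin_zero]⟩⟩
  · refine ⟨.cliques s, fun k => cliquesTime (2 * k - 1) s, fun F n k hn hF => ?_⟩
    have hk : F.tokens.length = 2 * k - 1 := by
      rw [F.length_tokens, ← hF.1]
      omega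
    have := wp_cliques hs F hn hF.2
    rwa [hk] at this

theorem theorem2 :
    ∃ g : ℕ → ℕ → ℕ, ∀ s : ℕ,
      FixedParameterTractable (FactoredGraph.countCopies (⊤ : SimpleGraph (Fin s))) ∧
      ∃ p : Prog, SolvesInTime p (FactoredGraph.countCopies (⊤ : SimpleGraph (Fin s)))
        fun n k => g s k * n ^ s := by
  choose p g h using exists_solvesInTime_countCopies_top
  -- The same program serves both assertions, with the exponent `C = s`.
  exact ⟨g, fun s => ⟨⟨p s, g s, s, h s⟩, p s, h s⟩⟩
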